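/- Let $\mathfrak g=\bigoplus_{i\in\mathbb Z}\mathfrak g_i$ be a $\mathbb Z$-graded complex Lie algebra with finite-dimensional graded components. Put $\mathfrak n_+=\bigoplus_{i>0}\mathfrak g_i$, $\mathfrak n_-=\bigoplus_{i<0}\mathfrak g_i$, $\mathfrak p_+=\bigoplus_{i\ge 0}\mathfrak g_i$, and let $x\mapsto x_0$ be the projection of $\mathfrak g$ onto $\mathfrak g_0$. Let $\chi:\mathfrak g_0\to\mathbb C$ be a character that is nonsingular, i.e. the pairing $\mathfrak n_+\times\mathfrak n_-\to\mathbb C$, $(u,v)\mapsto\chi([u,v]_0)$, is nondegenerate. Let $\Delta$ and $S$ be the standard coproduct and antipode of enveloping algebras, with $\Delta(x)=x\otimes 1+1\otimes x$ and $S(x)=-x$ on the Lie algebra. Let $\phi:U\mathfrak g\to U\mathfrak g_0$ be the projection along $\mathfrak n_-U\mathfrak g+U\mathfrak g\,\mathfrak n_+$. For $\lambda\in\mathbb C$ put $\chi_\lambda=\lambda\chi$ and $$(x,y)_\lambda=\chi_\lambda(\phi(S(y)x)),\qquad x\in U\mathfrak n_-,\ y\in U\mathfrak n_+ .$$ Let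 $M^+_\lambda=U\mathfrak g\otimes_{U\mathfrak p_+}\chi_\lambda$ be the generalized Verma module, where $\mathfrak p_+$ acts on $\mathbb C$ by $x\mapsto\chi_\lambda(x_0)$. The symbol $\check\otimes$ denotes the completed tensor product, whose elements are possibly infinite sums of elements of the tensor products of homogeneous components; in $U\mathfrak n_-\check\otimes\,U\mathfrak g/U\mathfrak g\cdot\mathfrak g_0\,\check\otimes U\mathfrak n_+$ the components are taken with respect to the gradings of the two outer factors. Suppose that the $U\mathfrak g$-module $M^+_\lambda$ is irreducible. Then the pairing $(\cdot,\cdot)_\lambda$ has a unique canonical element $F_\lambda\in U\mathfrak n_-\check\otimes U\mathfrak n_+$, that is, $F_\lambda=\sum_{n\ge 0}F_n$, where $F_n\in(U\mathfrak n_-)_{-n}\otimes(U\mathfrak n_+)_n$ is the canonical element of the (nondegenerate) restriction of the pairing to $(U\mathfrak n_-)_{-n}\times(U\mathfrak n_+)_n$. Let $p:U\mathfrak g\to U\mathfrak g/U\mathfrak g\cdot\mathfrak g_0$ be the natural projection. Then $$(1\otimes p\otimes 1)\big[(\Delta\otimes 1)F_\lambda\cdot(F_\lambda\otimes 1)\big]=(1\otimes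 p\otimes 1)\big[(1\otimes\Delta)F_\lambda\cdot(1\otimes F_\lambda)\big]$$ in $U\mathfrak n_-\check\otimes\,U\mathfrak g/U\mathfrak g\cdot\mathfrak g_0\,\check\otimes\,U\mathfrak n_+$. Here both products are expanded over the homogeneous components of the two factors, and each bihomogeneous component of the result is a finite sum. -/

import Mathlib

open scoped TensorProduct DirectSum

attribute [local instance 100] LieRing.ofAssociativeRing

noncomputable section

namespace ShapovalovAssoc

/-! ### Structure maps of the universal enveloping algebra -/

section Enveloping

variable (L : Type*) [LieRing L] [LieAlgebra ℂ L]

/-- The universal enveloping algebra of a complex Lie algebra. -/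
abbrev U : Type _ := UniversalEnvelopingAlgebra ℂ L

/-- The coproduct `Δ`, the algebra homomorphism with `Δ x = x ⊗ 1 + 1 ⊗ x` for `x` in `L`. -/
def comul : U L →ₐ[ℂ] U L ⊗[ℂ] U L :=
  UniversalEnvelopingAlgebra.lift ℂ
    { toFun := fun x => UniversalEnvelopingAlgebra.ι ℂ x ⊗ₜ[ℂ] (1 : U L)
        + (1 : U L) ⊗ₜ[ℂ] UniversalEnvelopingAlgebra.ι ℂ x
      map_add' := fun x y => by
        simp only [map_add, TensorProduct.add_tmul, TensorProduct.tmul_add]; abel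
      map_smul' := fun c x => by
        simp only [map_smul, TensorProduct.smul_tmul', TensorProduct.tmul_smul, smul_add,
          RingHom.id_apply]
      map_lie' := fun {x y} => by
        simp only [LieHom.map_lie, LieRing.of_associative_ring_bracket, mul_add, add_mul,
          Algebra.TensorProduct.tmul_mul_tmul, mul_one, one_mul, TensorProduct.sub_tmul,
          TensorProduct.tmul_sub]
        abel }

/-- The antipode as an algebra homomorphism to the opposite algebra. -/
def antipodeOp : U L →ₐ[ℂ] (U L)ᵐᵒᵖ :=
  UniversalEnvelopingAlgebra.lift ℂ
    { toFun := fun x => MulOpposite.op (-UniversalEnvelopingAlgebra.ι ℂ x)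
      map_add' := fun x y => by
        rw [← MulOpposite.op_add, map_add, neg_add]
      map_smul' := fun c x => by
        rw [map_smul, RingHom.id_apply, ← MulOpposite.op_smul, smul_neg]
      map_lie' := fun {x y} => by
        simp only [LieHom.map_lie, LieRing.of_associative_ring_bracket, ← MulOpposite.op_mul,
          ← MulOpposite.op_sub, neg_mul_neg, neg_sub] }

/-- The antipode `S`, the anti-automorphism with `S x = -x` for `x` in `L`. -/
def antipode : U L →ₗ[ℂ] U L :=
  (MulOpposite.opLinearEquiv ℂ).symm.toLinearMap ∘ₗ (antipodeOp L).toLinearMap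

variable {L}

/-- The canonical algebra homomorphism `U 𝔞 → U L` for a Lie subalgebra `𝔞` of `L`. -/
def incl (𝔞 : LieSubalgebra ℂ L) : U 𝔞 →ₐ[ℂ] U L :=
  UniversalEnvelopingAlgebra.lift ℂ ((UniversalEnvelopingAlgebra.ι ℂ).comp 𝔞.incl)

end Enveloping

/-! ### The grading of the universal enveloping algebra of a graded Lie algebra -/

section UGrading

variable {L : Type*} [LieRing L] [LieAlgebra ℂ L] (ℒ : ℤ → Submodule ℂ L)

/-- The degree `k` component of `U L`: the span of all products `x₁ ⋯ xᵣ` of homogeneous elements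
of `L` whose degrees add up to `k`. -/
def uDeg (k : ℤ) : Submodule ℂ (U L) :=
  Submodule.span ℂ
    {u | ∃ l : List (Σ i : ℤ, ℒ i), (l.map Sigma.fst).sum = k ∧
      (l.map fun x => UniversalEnvelopingAlgebra.ι ℂ (x.2 : L)).prod = u}

theorem ι_mem_uDeg {i : ℤ} (x : ℒ i) : UniversalEnvelopingAlgebra.ι ℂ (x : L) ∈ uDeg ℒ i :=
  Submodule.subset_span ⟨[⟨i, x⟩], by simp, by simp⟩

instance uDeg_gradedMonoid : SetLike.GradedMonoid (uDeg ℒ) where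
  one_mem := Submodule.subset_span ⟨[], by simp, by simp⟩
  mul_mem i j p q hp hq := by
    have h : uDeg ℒ i * uDeg ℒ j ≤ uDeg ℒ (i + j) := by
      rw [uDeg, uDeg, Submodule.span_mul_span]
      refine Submodule.span_mono ?_
      rintro _ ⟨_, ⟨l, hl, rfl⟩, _, ⟨m, hm, rfl⟩, rfl⟩
      exact ⟨l ++ m, by simp [hl, hm], by simp⟩
    exact h (Submodule.mul_mem_mul hp hq)

variable [GradedLieAlgebra ℒ]

/-- Auxiliary: the linear map sending a homogeneous element `x` of `L` to itself, placed in its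
degree. -/
def uGradeLin : L →ₗ[ℂ] ⨁ k, uDeg ℒ k :=
  (DirectSum.toModule ℂ ℤ _ fun i =>
    DirectSum.lof ℂ ℤ (fun k => uDeg ℒ k) i ∘ₗ
      (LinearMap.codRestrict (uDeg ℒ i)
        ((UniversalEnvelopingAlgebra.ι ℂ : L →ₗ⁅ℂ⁆ U L).toLinearMap ∘ₗ (ℒ i).subtype)
        (fun x => ι_mem_uDeg ℒ x))) ∘ₗ
    (DirectSum.decomposeLinearEquiv ℒ).toLinearMap

theorem uGradeLin_coe {i : ℤ} (x : ℒ i) :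
    uGradeLin ℒ (x : L) =
      DirectSum.of (fun k => uDeg ℒ k) i ⟨UniversalEnvelopingAlgebra.ι ℂ (x : L), ι_mem_uDeg ℒ x⟩ := by
  simp only [uGradeLin, LinearMap.comp_apply, LinearEquiv.coe_coe,
    DirectSum.decomposeLinearEquiv_apply, DirectSum.decompose_coe]
  rw [← DirectSum.lof_eq_of ℂ, DirectSum.toModule_lof]
  rfl

theorem uGradeLin_lie (x y : L) :
    uGradeLin ℒ ⁅x, y⁆ = uGradeLin ℒ x * uGradeLin ℒ y - uGradeLin ℒ y * uGradeLin ℒ x := by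
  induction x using DirectSum.Decomposition.inductionOn ℒ with
  | zero => simp
  | add a b ha hb => rw [add_lie, map_add, map_add, ha, hb, add_mul, mul_add]; abel
  | @homogeneous i a =>
    induction y using DirectSum.Decomposition.inductionOn ℒ with
    | zero => simp
    | add c d hc hd => rw [lie_add, map_add, map_add, hc, hd, add_mul, mul_add]; abel
    | @homogeneous j b =>
      have hab : ⁅(a : L), (b : L)⁆ ∈ ℒ (i + j) := SetLike.GradedBracket.bracket_mem a.2 b.2
      have h1 := uGradeLin_coe ℒ (⟨_, hab⟩ : ℒ (i + j))
      simp only at h1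
      have h2 : uGradeLin ℒ (b : L) * uGradeLin ℒ (a : L) =
          DirectSum.of (fun k => uDeg ℒ k) (i + j)
            ⟨UniversalEnvelopingAlgebra.ι ℂ (b : L) * UniversalEnvelopingAlgebra.ι ℂ (a : L), by
              rw [add_comm]
              exact SetLike.mul_mem_graded (ι_mem_uDeg ℒ b) (ι_mem_uDeg ℒ a)⟩ := by
        rw [uGradeLin_coe, uGradeLin_coe, DirectSum.of_mul_of]
        exact DirectSum.of_eq_of_gradedMonoid_eq (Sigma.subtype_ext (add_comm j i) rfl)
      rw [h1, h2, uGradeLin_coe, uGradeLin_coe, DirectSum.of_mul_of, ← map_sub]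
      congr 1
      refine Subtype.ext ?_
      simp only [LieHom.map_lie, LieRing.of_associative_ring_bracket, AddSubgroupClass.coe_sub]
      rfl

/-- Auxiliary: the decomposition of `U L` into homogeneous components. -/
def uDecompose : U L →ₐ[ℂ] ⨁ k, uDeg ℒ k :=
  UniversalEnvelopingAlgebra.lift ℂ
    { uGradeLin ℒ with
      map_lie' := fun {x y} => by
        rw [LieRing.of_associative_ring_bracket]; exact uGradeLin_lie ℒ x y }

theorem uDecompose_ι {i : ℤ} (x : ℒ i) :
    uDecompose ℒ (UniversalEnvelopingAlgebra.ι ℂ (x : L)) =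
      DirectSum.of (fun k => uDeg ℒ k) i ⟨UniversalEnvelopingAlgebra.ι ℂ (x : L), ι_mem_uDeg ℒ x⟩ :=
  (UniversalEnvelopingAlgebra.lift_ι_apply ℂ _ _).trans (uGradeLin_coe ℒ x)

theorem uDecompose_prod (l : List (Σ i : ℤ, ℒ i))
    (h : (l.map fun x => UniversalEnvelopingAlgebra.ι ℂ (x.2 : L)).prod ∈
      uDeg ℒ (l.map Sigma.fst).sum) :
    uDecompose ℒ (l.map fun x => UniversalEnvelopingAlgebra.ι ℂ (x.2 : L)).prod =
      DirectSum.of (fun k => uDeg ℒ k) (l.map Sigma.fst).sum ⟨_, h⟩ := by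
  induction l with
  | nil => simp only [List.map_nil, List.prod_nil, map_one]; rfl
  | cons a l ih =>
    have h' : (l.map fun x => UniversalEnvelopingAlgebra.ι ℂ (x.2 : L)).prod ∈
        uDeg ℒ (l.map Sigma.fst).sum := Submodule.subset_span ⟨l, rfl, rfl⟩
    simp only [List.map_cons, List.prod_cons, map_mul]
    rw [ih h', uDecompose_ι, DirectSum.of_mul_of]
    exact DirectSum.of_eq_of_gradedMonoid_eq (Sigma.subtype_ext (by simp; rfl) rfl)

/-- `U L` is a graded algebra. -/
instance uGraded : GradedAlgebra (uDeg ℒ) :=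
  GradedAlgebra.ofAlgHom (uDeg ℒ) (uDecompose ℒ)
    (by
      refine UniversalEnvelopingAlgebra.hom_ext ℂ ?_
      ext x
      simp only [LieHom.comp_apply, AlgHom.coe_toLieHom, AlgHom.comp_apply, AlgHom.id_apply]
      induction x using DirectSum.Decomposition.inductionOn ℒ with
      | zero => simp
      | add a b ha hb => simp only [map_add, ha, hb]
      | homogeneous a => rw [uDecompose_ι, DirectSum.coeAlgHom_of])
    (by
      rintro k ⟨u, hu⟩
      have key : ∀ u (hu : u ∈ uDeg ℒ k), uDecompose ℒ u = DirectSum.of _ k ⟨u, hu⟩ := by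
        intro u hu
        induction hu using Submodule.span_induction with
        | mem u h =>
          obtain ⟨l, rfl, rfl⟩ := h
          exact uDecompose_prod ℒ l _
        | zero => rw [map_zero]; exact (map_zero (DirectSum.of (fun k => uDeg ℒ k) k)).symm
        | add x y hx hy ihx ihy =>
          rw [map_add, ihx, ihy, ← map_add]; rfl
        | smul c x hx ih =>
          rw [map_smul, ih, ← DirectSum.lof_eq_of ℂ, ← map_smul]; rfl
      exact key u hu)

/-- The projection of `U L` onto its degree `k` component. -/
def uProj (k : ℤ) : U L →ₗ[ℂ] uDeg ℒ k :=
  DirectSum.component ℂ ℤ (fun k => uDeg ℒ k) k ∘ₗ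
    (DirectSum.decomposeLinearEquiv (uDeg ℒ)).toLinearMap

end UGrading

/-! ### The subalgebras `𝔤₀`, `𝔫₊`, `𝔫₋` of a graded Lie algebra -/

section Triangular

variable {𝔤 : Type*} [LieRing 𝔤] [LieAlgebra ℂ 𝔤] (𝒢 : ℤ → Submodule ℂ 𝔤) [GradedLieAlgebra 𝒢]

/-- The subalgebra `⊕_{i ∈ S} 𝔤_i`, for a set `S` of degrees that is closed under addition. -/
def gradedPart (S : AddSubsemigroup ℤ) : LieSubalgebra ℂ 𝔤 :=
  { (⨆ i : S, 𝒢 i : Submodule ℂ 𝔤) with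
    lie_mem' := by
      intro x y hx hy
      change x ∈ (⨆ i : S, 𝒢 i) at hx
      change y ∈ (⨆ i : S, 𝒢 i) at hy
      change ⁅x, y⁆ ∈ (⨆ i : S, 𝒢 i)
      induction hx using Submodule.iSup_induction' with
      | zero => rw [zero_lie]; exact Submodule.zero_mem _
      | add a b _ _ ha hb => rw [add_lie]; exact Submodule.add_mem _ ha hb
      | mem i a ha =>
        induction hy using Submodule.iSup_induction' with
        | zero => rw [lie_zero]; exact Submodule.zero_mem _
        | add c d _ _ hc hd => rw [lie_add]; exact Submodule.add_mem _ hc hd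
        | mem j b hb =>
          exact Submodule.mem_iSup_of_mem (p := fun i : S => 𝒢 i) (i + j)
            (SetLike.GradedBracket.bracket_mem ha hb) }

theorem mem_gradedPart (S : AddSubsemigroup ℤ) (x : 𝔤) :
    x ∈ gradedPart 𝒢 S ↔ x ∈ (⨆ i : S, 𝒢 i) := Iff.rfl

theorem component_mem_gradedPart (S : AddSubsemigroup ℤ) {x : 𝔤} (hx : x ∈ gradedPart 𝒢 S)
    (j : ℤ) : (DirectSum.decompose 𝒢 x j : 𝔤) ∈ gradedPart 𝒢 S := by
  rw [mem_gradedPart] at hx ⊢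
  induction hx using Submodule.iSup_induction' with
  | zero => simp
  | add a b _ _ ha hb =>
    rw [DirectSum.decompose_add, DirectSum.add_apply, Submodule.coe_add]
    exact Submodule.add_mem _ ha hb
  | mem i a ha =>
    rw [DirectSum.decompose_of_mem 𝒢 ha, DirectSum.coe_of_apply]
    split_ifs
    · exact Submodule.mem_iSup_of_mem (p := fun i : S => 𝒢 i) i ha
    · exact Submodule.zero_mem _

/-- The grading of `⊕_{i ∈ S} 𝔤_i` inherited from `𝔤`. -/
def partGrading (S : AddSubsemigroup ℤ) (i : ℤ) : Submodule ℂ (gradedPart 𝒢 S) :=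
  (𝒢 i).comap (gradedPart 𝒢 S).toSubmodule.subtype

theorem partGrading_isInternal (S : AddSubsemigroup ℤ) :
    DirectSum.IsInternal (partGrading 𝒢 S) := by
  rw [DirectSum.isInternal_submodule_iff_iSupIndep_and_iSup_eq_top]
  constructor
  · have hind : iSupIndep 𝒢 := (DirectSum.Decomposition.isInternal 𝒢).submodule_iSupIndep
    intro i
    rw [Submodule.disjoint_def]
    intro x hx hx'
    refine Subtype.ext ((Submodule.disjoint_def.mp (hind i)) (x : 𝔤) hx ?_)
    have hle : (⨆ (j) (_ : j ≠ i), partGrading 𝒢 S j) ≤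
        (⨆ (j) (_ : j ≠ i), 𝒢 j).comap (gradedPart 𝒢 S).toSubmodule.subtype :=
      iSup₂_le fun j hj => Submodule.comap_mono (le_iSup₂_of_le j hj le_rfl)
    exact hle hx'
  · rw [eq_top_iff]
    rintro ⟨x, hx⟩ -
    have key : ∀ x (hx' : x ∈ (⨆ i : S, 𝒢 i)) (hx : x ∈ gradedPart 𝒢 S),
        (⟨x, hx⟩ : gradedPart 𝒢 S) ∈ ⨆ i, partGrading 𝒢 S i := by
      intro x hx'
      induction hx' using Submodule.iSup_induction' with
      | zero => intro _; exact Submodule.zero_mem _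
      | add a b ha hb iha ihb => intro _; exact Submodule.add_mem _ (iha ha) (ihb hb)
      | mem i a ha =>
        intro hx
        exact Submodule.mem_iSup_of_mem (p := partGrading 𝒢 S) (i : ℤ) ha
    exact key x hx hx

instance partGraded (S : AddSubsemigroup ℤ) : GradedLieAlgebra (partGrading 𝒢 S) where
  bracket_mem := fun _ _ _ _ hx hy =>
    SetLike.GradedBracket.bracket_mem (ℒ := 𝒢) (by exact hx) (by exact hy)
  toDecomposition := (partGrading_isInternal 𝒢 S).chooseDecomposition

/-- The degree zero subalgebra `𝔤₀`. -/
def gZero : LieSubalgebra ℂ 𝔤 :=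
  { 𝒢 0 with
    lie_mem' := fun {x y} hx hy => by
      have h := SetLike.GradedBracket.bracket_mem (ℒ := 𝒢) hx hy
      rwa [add_zero] at h }

/-- The projection `x ↦ x₀` of `𝔤` onto `𝔤₀`. -/
def zeroPart (x : 𝔤) : gZero 𝒢 :=
  ⟨DirectSum.decompose 𝒢 x 0, (DirectSum.decompose 𝒢 x 0).2⟩

/-- The semigroup of positive degrees. -/
def posDeg : AddSubsemigroup ℤ where
  carrier := {i | 0 < i}
  add_mem' := fun {a b} (ha : 0 < a) (hb : 0 < b) => add_pos ha hb

/-- The semigroup of negative degrees. -/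
def negDeg : AddSubsemigroup ℤ where
  carrier := {i | i < 0}
  add_mem' := fun {a b} (ha : a < 0) (hb : b < 0) => add_neg ha hb

/-- The semigroup of nonnegative degrees. -/
def nonnegDeg : AddSubsemigroup ℤ where
  carrier := {i | 0 ≤ i}
  add_mem' := fun {a b} (ha : 0 ≤ a) (hb : 0 ≤ b) => add_nonneg ha hb

/-- `𝔫₊ = ⊕_{i > 0} 𝔤_i`. -/
abbrev nPlus : LieSubalgebra ℂ 𝔤 := gradedPart 𝒢 posDeg

/-- `𝔫₋ = ⊕_{i < 0} 𝔤_i`. -/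
abbrev nMinus : LieSubalgebra ℂ 𝔤 := gradedPart 𝒢 negDeg

/-- `𝔭₊ = ⊕_{i ≥ 0} 𝔤_i`. -/
abbrev pPlus : LieSubalgebra ℂ 𝔤 := gradedPart 𝒢 nonnegDeg

/-- The degree `i` component of `U 𝔫₊`. -/
abbrev UPlus (i : ℤ) : Submodule ℂ (U (nPlus 𝒢)) := uDeg (partGrading 𝒢 posDeg) i

/-- The degree `i` component of `U 𝔫₋`. -/
abbrev UMinus (i : ℤ) : Submodule ℂ (U (nMinus 𝒢)) := uDeg (partGrading 𝒢 negDeg) i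

/-! ### Characters, generalized Verma modules and the Shapovalov pairing -/

variable (χ : LieAlgebra.LieCharacter ℂ (gZero 𝒢)) (lam : ℂ)

/-- The character `χ` is nonsingular: the pairing `(u, v) ↦ χ([u, v]₀)` of `𝔫₊` and `𝔫₋` is
nondegenerate. -/
def IsNonsingular : Prop :=
  (∀ u ∈ nPlus 𝒢, (∀ v ∈ nMinus 𝒢, χ (zeroPart 𝒢 ⁅u, v⁆) = 0) → u = 0) ∧
  (∀ v ∈ nMinus 𝒢, (∀ u ∈ nPlus 𝒢, χ (zeroPart 𝒢 ⁅u, v⁆) = 0) → v = 0)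

/-- The rescaled character `χ_λ = λ χ`, extended to an algebra homomorphism `U 𝔤₀ → ℂ`. -/
def chiU : U (gZero 𝒢) →ₐ[ℂ] ℂ :=
  UniversalEnvelopingAlgebra.lift ℂ
    { lam • (χ : gZero 𝒢 →ₗ[ℂ] ℂ) with
      map_lie' := fun {x y} => by
        have h : χ ⁅x, y⁆ = 0 := LieAlgebra.lieCharacter_apply_lie χ x y
        simp only [LieRing.of_associative_ring_bracket]
        change lam * χ ⁅x, y⁆ = (lam * χ x) * (lam * χ y) - (lam * χ y) * (lam * χ x)
        rw [h]; ring }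

/-- The generalized Verma module `M⁺_λ = Ind_{U 𝔭₊}^{U 𝔤} χ_λ`, where `𝔭₊` acts on the
one-dimensional module through `x ↦ λ χ(x₀)`. The induced module `U 𝔤 ⊗_{U 𝔭₊} χ_λ` is the quotient
of `U 𝔤` by the left ideal generated by the elements `x - λ χ(x₀)` with `x` in `𝔭₊`; the
generating vector is the class of `1`. -/
abbrev VermaPlus : Type _ :=
  U 𝔤 ⧸ Submodule.span (U 𝔤)
    {a : U 𝔤 | ∃ x ∈ pPlus 𝒢,
      a = UniversalEnvelopingAlgebra.ι ℂ x - algebraMap ℂ (U 𝔤) (lam * χ (zeroPart 𝒢 x))}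

/-- `φ` is the projection `U 𝔤 → U 𝔤₀` along `𝔫₋ U 𝔤 + U 𝔤 𝔫₊`. -/
def IsTriangularProjection (φ : U 𝔤 →ₗ[ℂ] U (gZero 𝒢)) : Prop :=
  (∀ z : U (gZero 𝒢), φ (incl (gZero 𝒢) z) = z) ∧
  (∀ x ∈ nMinus 𝒢, ∀ a : U 𝔤, φ (UniversalEnvelopingAlgebra.ι ℂ x * a) = 0) ∧
  (∀ a : U 𝔤, ∀ x ∈ nPlus 𝒢, φ (a * UniversalEnvelopingAlgebra.ι ℂ x) = 0)

open Classical in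
/-- The projection `φ : U 𝔤 → U 𝔤₀` along `𝔫₋ U 𝔤 + U 𝔤 𝔫₊`. By the Poincaré–Birkhoff–Witt theorem
there is exactly one, so that the default value is never taken. -/
def triangularProjection : U 𝔤 →ₗ[ℂ] U (gZero 𝒢) :=
  if h : ∃ φ : U 𝔤 →ₗ[ℂ] U (gZero 𝒢), IsTriangularProjection 𝒢 φ then h.choose else 0

/-- The pairing `(x, y)_λ = χ_λ(φ(S(y) x))` of `U 𝔫₋` and `U 𝔫₊`. -/
def shapovalov : U (nMinus 𝒢) →ₗ[ℂ] U (nPlus 𝒢) →ₗ[ℂ] ℂ :=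
  LinearMap.compr₂
    ((LinearMap.mul ℂ (U 𝔤)).flip.compl₁₂ (incl (nMinus 𝒢)).toLinearMap
      (antipode 𝔤 ∘ₗ (incl (nPlus 𝒢)).toLinearMap))
    ((chiU 𝒢 χ lam).toLinearMap ∘ₗ triangularProjection 𝒢)

theorem shapovalov_apply (x : U (nMinus 𝒢)) (y : U (nPlus 𝒢)) :
    shapovalov 𝒢 χ lam x y =
      chiU 𝒢 χ lam (triangularProjection 𝒢
        (antipode 𝔤 (incl (nPlus 𝒢) y) * incl (nMinus 𝒢) x)) := rfl

/-! ### Completed tensor products and the canonical element -/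

/-- The completed tensor product of `U 𝔫₋` and `U 𝔫₊`: possibly infinite sums of elements of the
tensor products of their homogeneous components. -/
abbrev Completed₂ : Type _ := ∀ i j : ℤ, UMinus 𝒢 i ⊗[ℂ] UPlus 𝒢 j

/-- For a bilinear pairing `B` of `V` and `W`, the element `t = ∑ vᵢ ⊗ wᵢ` is the canonical element:
`∑ B(vᵢ, y) wᵢ = y` for all `y` in `W` and `∑ B(x, wᵢ) vᵢ = x` for all `x` in `V`. For
finite-dimensional spaces it exists if and only if `B` is nondegenerate, and it is then the sum
of `vᵢ ⊗ wᵢ` over any pair of dual bases. -/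
def IsCanonicalTensor {V W : Type*} [AddCommGroup V] [Module ℂ V] [AddCommGroup W] [Module ℂ W]
    (B : V →ₗ[ℂ] W →ₗ[ℂ] ℂ) (t : V ⊗[ℂ] W) : Prop :=
  (∀ y : W, TensorProduct.lid ℂ W (TensorProduct.map (B.flip y) LinearMap.id t) = y) ∧
  (∀ x : V, TensorProduct.rid ℂ V (TensorProduct.map LinearMap.id (B x) t) = x)

/-- `F` is the canonical element of the pairing `(·, ·)_λ`: its component in
`(U 𝔫₋)_{-n} ⊗ (U 𝔫₊)_n` is the canonical element of the restricted pairing, and the components in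
the other bidegrees, for which the pairing is zero, vanish. -/
def IsCanonicalElement (F : Completed₂ 𝒢) : Prop :=
  (∀ n : ℤ, IsCanonicalTensor
    ((shapovalov 𝒢 χ lam).domRestrict₁₂ (UMinus 𝒢 (-n)) (UPlus 𝒢 n)) (F (-n) n)) ∧
  (∀ i j : ℤ, i ≠ -j → F i j = 0)

/-! ### The two sides of the cocycle equation -/

/-- The left ideal `U 𝔤 · 𝔤₀`. -/
abbrev leftIdealZero : Submodule (U 𝔤) (U 𝔤) :=
  Submodule.span (U 𝔤) ((UniversalEnvelopingAlgebra.ι ℂ : 𝔤 →ₗ⁅ℂ⁆ U 𝔤) '' (gZero 𝒢 : Set 𝔤))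

/-- The quotient `U 𝔤 / U 𝔤 · 𝔤₀`. -/
abbrev Quot₀ : Type _ := U 𝔤 ⧸ leftIdealZero 𝒢

/-- The natural projection `p : U 𝔤 → U 𝔤 / U 𝔤 · 𝔤₀`. -/
def pMap : U 𝔤 →ₗ[ℂ] Quot₀ 𝒢 := (leftIdealZero 𝒢).mkQ.restrictScalars ℂ

/-- The algebra `U 𝔫₋ ⊗ U 𝔤 ⊗ U 𝔫₊`. -/
abbrev Triple : Type _ := U (nMinus 𝒢) ⊗[ℂ] (U 𝔤 ⊗[ℂ] U (nPlus 𝒢))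

/-- The completed tensor product of `U 𝔫₋`, `U 𝔤 / U 𝔤 · 𝔤₀` and `U 𝔫₊`. -/
abbrev Completed₃ : Type _ := ∀ i j : ℤ, UMinus 𝒢 i ⊗[ℂ] (Quot₀ 𝒢 ⊗[ℂ] UPlus 𝒢 j)

/-- The map `1 ⊗ p ⊗ 1`, from the algebra `U 𝔫₋ ⊗ U 𝔤 ⊗ U 𝔫₊` to the completed tensor product. -/
def onePone (t : Triple 𝒢) : Completed₃ 𝒢 := fun i j =>
  TensorProduct.map (uProj (partGrading 𝒢 negDeg) i)
    (TensorProduct.map (pMap 𝒢) (uProj (partGrading 𝒢 posDeg) j)) t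

/-- `Δ ⊗ 1 : a ⊗ b ↦ Δ(a) ⊗ b`. -/
def comulOne : U (nMinus 𝒢) ⊗[ℂ] U (nPlus 𝒢) →ₐ[ℂ] Triple 𝒢 :=
  (Algebra.TensorProduct.map (AlgHom.id ℂ (U (nMinus 𝒢)))
    (Algebra.TensorProduct.map (incl (nMinus 𝒢)) (AlgHom.id ℂ (U (nPlus 𝒢))))).comp
  ((Algebra.TensorProduct.assoc ℂ ℂ ℂ
      (U (nMinus 𝒢)) (U (nMinus 𝒢)) (U (nPlus 𝒢))).toAlgHom.comp
    (Algebra.TensorProduct.map (comul (nMinus 𝒢)) (AlgHom.id ℂ (U (nPlus 𝒢)))))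

/-- `1 ⊗ Δ : a ⊗ b ↦ a ⊗ Δ(b)`. -/
def oneComul : U (nMinus 𝒢) ⊗[ℂ] U (nPlus 𝒢) →ₐ[ℂ] Triple 𝒢 :=
  Algebra.TensorProduct.map (AlgHom.id ℂ (U (nMinus 𝒢)))
    ((Algebra.TensorProduct.map (incl (nPlus 𝒢)) (AlgHom.id ℂ (U (nPlus 𝒢)))).comp
      (comul (nPlus 𝒢)))

/-- The map `a ⊗ b ↦ a ⊗ b ⊗ 1`. -/
def tensorOne : U (nMinus 𝒢) ⊗[ℂ] U (nPlus 𝒢) →ₐ[ℂ] Triple 𝒢 :=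
  Algebra.TensorProduct.map (AlgHom.id ℂ (U (nMinus 𝒢)))
    (Algebra.TensorProduct.includeLeft.comp (incl (nPlus 𝒢)))

/-- The map `a ⊗ b ↦ 1 ⊗ a ⊗ b`. -/
def oneTensor : U (nMinus 𝒢) ⊗[ℂ] U (nPlus 𝒢) →ₐ[ℂ] Triple 𝒢 :=
  Algebra.TensorProduct.includeRight.comp
    (Algebra.TensorProduct.map (incl (nMinus 𝒢)) (AlgHom.id ℂ (U (nPlus 𝒢))))

/-- The homogeneous component of bidegree `d` of an element of the completed tensor product, as an
element of `U 𝔫₋ ⊗ U 𝔫₊`. -/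
def piece (F : Completed₂ 𝒢) (d : ℤ × ℤ) : U (nMinus 𝒢) ⊗[ℂ] U (nPlus 𝒢) :=
  TensorProduct.mapIncl (UMinus 𝒢 d.1) (UPlus 𝒢 d.2) (F d.1 d.2)

/-- In a completed tensor product, the formal sum of the family `f` is `T`: in every bidegree only
finitely many members of the family have a nonzero component, and these components add up to the
component of `T`. -/
def HasFormalSum {κ : Type*} (f : κ → Completed₃ 𝒢) (T : Completed₃ 𝒢) : Prop :=
  ∀ i j : ℤ, (Function.support fun k => f k i j).Finite ∧ ∑ᶠ k, f k i j = T i j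

/-- `T = (1 ⊗ p ⊗ 1)[(Δ ⊗ 1)F · (F ⊗ 1)]`, the product of the two infinite sums being expanded
over all pairs of bidegrees. -/
def IsLeftSide (F : Completed₂ 𝒢) (T : Completed₃ 𝒢) : Prop :=
  HasFormalSum 𝒢 (fun d : (ℤ × ℤ) × (ℤ × ℤ) =>
    onePone 𝒢 (comulOne 𝒢 (piece 𝒢 F d.1) * tensorOne 𝒢 (piece 𝒢 F d.2))) T

/-- `T = (1 ⊗ p ⊗ 1)[(1 ⊗ Δ)F · (1 ⊗ F)]`, the product of the two infinite sums being expanded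
over all pairs of bidegrees. -/
def IsRightSide (F : Completed₂ 𝒢) (T : Completed₃ 𝒢) : Prop :=
  HasFormalSum 𝒢 (fun d : (ℤ × ℤ) × (ℤ × ℤ) =>
    onePone 𝒢 (oneComul 𝒢 (piece 𝒢 F d.1) * oneTensor 𝒢 (piece 𝒢 F d.2))) T

end Triangular

end ShapovalovAssoc

end

noncomputable section

namespace ShapovalovAssoc

open UniversalEnvelopingAlgebra (ι)

attribute [-simp] UniversalEnvelopingAlgebra.ι_apply

/-! ### Generators of the enveloping algebra and induction on words -/

section Induction

variable {L : Type*} [LieRing L] [LieAlgebra ℂ L]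

/-! Identify `M⁺_λ` with `U 𝔫₋` and the opposite Verma module `M⁻_{-λ}` with `U 𝔫₊`. The form
`(·,·)_λ` then becomes a `𝔤`-invariant pairing between the two modules (`shapovalov_invariant`).

Existence of the canonical element. The radical of the form in `U 𝔫₋` comes from a proper submodule
of `M⁺_λ`, so irreducibility makes it zero (`eq_zero_of_shapovalov_eq_zero`). Hence `(U 𝔫₋)_{-n}`
embeds in the dual of `(U 𝔫₊)_n`, and it remains to bound `dim (U 𝔫₊)_n` by `dim (U 𝔫₋)_{-n}`.
Nonsingularity of `χ` gives `dim 𝔤_i = dim 𝔤_{-i}`, so monomials on both sides are indexed by the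
same multisets. They span `U 𝔫₊`, and they are independent in `U 𝔫₋` because `𝔫₋` acts faithfully on
`𝔤` (`finiteDimensional_and_finrank_le`).

The identity. There is a `𝔤`-equivariant map `M⁻_{-λ} ⊗ M⁺_λ → U 𝔤 / U 𝔤 · 𝔤₀` sending the product
of the generators to the class of `1`; the weights `-λχ` and `λχ` cancel, and the class of `1` is
killed by `𝔤₀`. This is `equivMap`. Pair the outer legs of either side of the identity with `y` in
`U 𝔫₊` and `x` in `U 𝔫₋`. On the left, pairing the third leg with `x` replaces `(Δ ⊗ 1)F` by `Δ(x)`;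
on the right, pairing the first leg with `y` replaces `(1 ⊗ Δ)F` by `Δ(y)`. By invariance of the
form, what remains obeys the recursion that characterises `equivMap` (`contractFst_comul`,
`contractSnd_comul`). So both sides contract to `equivMap y x`, and nondegeneracy recovers the
tensors from their contractions. Everything is done with truncations of `F`, since a fixed bidegree
sees only finitely many components.

The modules are built without a choice of basis: the action of `L = A ⊕ B` on `U A ⊗ W` is
constructed in `induced`, from the universal property of `U A` alone. -/

theorem ι_lie (x y : L) : (ι ℂ ⁅x, y⁆ : U L) = ι ℂ x * ι ℂ y - ι ℂ y * ι ℂ x := by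
  rw [LieHom.map_lie, LieRing.of_associative_ring_bracket]

/-- Lifting `L → S` to `U L` and including `S` back gives an endomorphism of `U L` fixing the
generators, hence the identity; so every element lies in `S`. -/
theorem adjoin_range_ι : Algebra.adjoin ℂ (Set.range (ι ℂ : L → U L)) = ⊤ := by
  set S := Algebra.adjoin ℂ (Set.range (ι ℂ : L → U L)) with hS
  have hι : ∀ x : L, (ι ℂ x : U L) ∈ S := fun x => Algebra.subset_adjoin ⟨x, rfl⟩
  let f : L →ₗ⁅ℂ⁆ S :=
    { toFun := fun x => ⟨ι ℂ x, hι x⟩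
      map_add' := fun x y => Subtype.ext (by simp)
      map_smul' := fun c x => Subtype.ext (by simp)
      map_lie' := fun {x y} => Subtype.ext (by
        rw [LieRing.of_associative_ring_bracket]
        exact ι_lie x y) }
  have h : S.val.comp (UniversalEnvelopingAlgebra.lift ℂ f) = AlgHom.id ℂ (U L) := by
    refine UniversalEnvelopingAlgebra.hom_ext ℂ (LieHom.ext fun x => ?_)
    change ((UniversalEnvelopingAlgebra.lift ℂ f (ι ℂ x) : S) : U L) = ι ℂ x
    rw [UniversalEnvelopingAlgebra.lift_ι_apply]
    rfl
  refine eq_top_iff.2 fun u _ => ?_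
  have := congrArg (fun g : U L →ₐ[ℂ] U L => g u) h
  simp only [AlgHom.comp_apply, AlgHom.id_apply] at this
  rw [← this]
  exact Subtype.property _

/-- A subspace stable under the generators is stable under `U L`. -/
theorem mul_mem_of_ι_mul_mem {M : Type*} [AddCommGroup M] [Module ℂ M] (κ : U L →ₐ[ℂ] Module.End ℂ M)
    (P : Submodule ℂ M) (h : ∀ x : L, ∀ m ∈ P, κ (ι ℂ x) m ∈ P) (u : U L) {m : M} (hm : m ∈ P) :
    κ u m ∈ P := by
  have hu : u ∈ Algebra.adjoin ℂ (Set.range (ι ℂ : L → U L)) := by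
    rw [adjoin_range_ι]; trivial
  induction hu using Algebra.adjoin_induction generalizing m with
  | mem x hx => obtain ⟨x, rfl⟩ := hx; exact h x m hm
  | algebraMap r =>
    rw [AlgHom.commutes, Module.algebraMap_end_apply]
    exact P.smul_mem r hm
  | add x y _ _ hx hy => rw [map_add]; exact P.add_mem (hx hm) (hy hm)
  | mul x y _ _ hx hy => rw [map_mul]; exact hx (hy hm)

theorem mem_of_one_mem (P : Submodule ℂ (U L)) (h1 : (1 : U L) ∈ P)
    (h : ∀ x : L, ∀ u ∈ P, ι ℂ x * u ∈ P) (u : U L) : u ∈ P := by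
  have := mul_mem_of_ι_mul_mem (Algebra.lmul ℂ (U L)) P h u h1
  simpa using this

/-- Induction on `U L` by left multiplication by elements of `L`. -/
theorem induction_left {P : U L → Prop} (one : P 1) (zero : P 0)
    (add : ∀ u v, P u → P v → P (u + v)) (smul : ∀ (c : ℂ) u, P u → P (c • u))
    (mul : ∀ (x : L) u, P u → P (ι ℂ x * u)) (u : U L) : P u :=
  mem_of_one_mem
    { carrier := {u | P u}, zero_mem' := zero, add_mem' := fun {a b} ha hb => add a b ha hb,
      smul_mem' := fun c u hu => smul c u hu } one mul u

variable (L) in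
/-- The counit of `U L`. -/
def counit : U L →ₐ[ℂ] ℂ := UniversalEnvelopingAlgebra.lift ℂ 0

@[simp]
theorem counit_ι (x : L) : counit L (ι ℂ x) = 0 :=
  UniversalEnvelopingAlgebra.lift_ι_apply ℂ _ x

@[simp]
theorem incl_ι (𝔞 : LieSubalgebra ℂ L) (x : 𝔞) : incl 𝔞 (ι ℂ x) = ι ℂ (x : L) :=
  UniversalEnvelopingAlgebra.lift_ι_apply ℂ _ x

@[simp]
theorem comul_ι (x : L) : comul L (ι ℂ x) = ι ℂ x ⊗ₜ[ℂ] (1 : U L) + (1 : U L) ⊗ₜ[ℂ] ι ℂ x :=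
  UniversalEnvelopingAlgebra.lift_ι_apply ℂ _ x

@[simp]
theorem antipode_ι (x : L) : antipode L (ι ℂ x) = -ι ℂ x := by
  have h : antipodeOp L (ι ℂ x) = MulOpposite.op (-ι ℂ x) :=
    UniversalEnvelopingAlgebra.lift_ι_apply ℂ _ x
  simp [antipode, h]

@[simp]
theorem antipode_one : antipode L 1 = 1 := by simp [antipode]

theorem antipode_mul (u v : U L) : antipode L (u * v) = antipode L v * antipode L u := by
  simp [antipode]

end Induction

/-! ### Induced representations -/

section Induced

variable {L : Type*} [LieRing L] [LieAlgebra ℂ L] (A B : LieSubalgebra ℂ L)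
  {W : Type*} [AddCommGroup W] [Module ℂ W]

/-- The action of `A` on linear maps from `L` to an `U A`-module `X`. -/
def homAction (X : Type*) [AddCommGroup X] [Module ℂ X] (κ : U A →ₐ[ℂ] Module.End ℂ X) :
    A →ₗ⁅ℂ⁆ Module.End ℂ (L →ₗ[ℂ] X) where
  toFun a :=
    { toFun := fun F => κ (ι ℂ a) ∘ₗ F - F ∘ₗ (LieAlgebra.ad ℂ L (a : L) : L →ₗ[ℂ] L)
      map_add' := fun F G => by ext g; simp; abel
      map_smul' := fun c F => by ext g; simp [smul_sub] }
  map_add' a b := by ext F g; simp; abel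
  map_smul' c a := by ext F g; simp [smul_sub]
  map_lie' {a b} := by
    ext F g
    simp only [LinearMap.coe_mk, AddHom.coe_mk, LinearMap.sub_apply, LinearMap.comp_apply, ι_lie,
      map_sub, map_mul, Module.End.mul_apply, LieAlgebra.ad_apply, LieSubalgebra.coe_bracket,
      LieRing.of_associative_ring_bracket, lie_lie]
    abel

/-- The action of `U A` on `U A ⊗ W` by left multiplication. -/
def leftAction (W : Type*) [AddCommGroup W] [Module ℂ W] : U A →ₐ[ℂ] Module.End ℂ (U A ⊗[ℂ] W) :=
  Algebra.lsmul ℂ ℂ (U A ⊗[ℂ] W)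

@[simp]
theorem leftAction_tmul (u v : U A) (w : W) : leftAction A W u (v ⊗ₜ w) = (u * v) ⊗ₜ w := rfl

variable {A B} (hAB : IsCompl A.toSubmodule B.toSubmodule) (σ : L →ₗ[ℂ] Module.End ℂ W)

/-- The map `a + b ↦ a ⊗ w + 1 ⊗ σ(b) w`. -/
def inducedStart : W →ₗ[ℂ] L →ₗ[ℂ] U A ⊗[ℂ] W :=
  LinearMap.flip
    ((TensorProduct.mk ℂ (U A) W) ∘ₗ (ι ℂ : A →ₗ⁅ℂ⁆ U A).toLinearMap ∘ₗ
        A.toSubmodule.projectionOnto B.toSubmodule hAB +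
      (LinearMap.llcomp ℂ W W (U A ⊗[ℂ] W) (TensorProduct.mk ℂ (U A) W 1)) ∘ₗ σ ∘ₗ
        B.toSubmodule.projection A.toSubmodule hAB.symm)

theorem inducedStart_left (w : W) (a : A) :
    inducedStart hAB σ w (a : L) = (ι ℂ a : U A) ⊗ₜ[ℂ] w := by
  have h1 : A.toSubmodule.projectionOnto B.toSubmodule hAB (a : L) = a :=
    Submodule.projectionOnto_apply_left hAB a
  have h2 : B.toSubmodule.projection A.toSubmodule hAB.symm (a : L) = 0 :=
    Submodule.projection_apply_right hAB.symm a
  simp [inducedStart, h1, h2]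

theorem inducedStart_right (w : W) {b : L} (hb : b ∈ B) :
    inducedStart hAB σ w b = (1 : U A) ⊗ₜ[ℂ] σ b w := by
  have h1 : A.toSubmodule.projectionOnto B.toSubmodule hAB b = 0 :=
    Submodule.projectionOnto_apply_right hAB ⟨b, hb⟩
  have h2 : B.toSubmodule.projection A.toSubmodule hAB.symm b = b :=
    Submodule.projection_apply_left hAB.symm ⟨b, hb⟩
  simp [inducedStart, h1, h2]

/-- The action of `L` on `U A ⊗ W`, as a linear map. -/
def inducedLin : L →ₗ[ℂ] Module.End ℂ (U A ⊗[ℂ] W) :=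
  -- The required rule `g(a m) = [g, a] m + a(g m)` says that `m ↦ (g ↦ g m)` intertwines left
  -- multiplication by `A` with `homAction`. It is therefore forced by its values on `1 ⊗ w`, and
  -- the universal property of `U A` supplies the extension.
  LinearMap.flip (TensorProduct.lift
    (LinearMap.compl₂ (UniversalEnvelopingAlgebra.lift ℂ
      (homAction A (U A ⊗[ℂ] W) (leftAction A W))).toLinearMap (inducedStart hAB σ)))

theorem inducedLin_one_tmul (g : L) (w : W) :
    inducedLin hAB σ g (1 ⊗ₜ w) = inducedStart hAB σ w g := by
  simp [inducedLin]

theorem inducedLin_ι_smul (g : L) (a : A) (m : U A ⊗[ℂ] W) :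
    inducedLin hAB σ g (leftAction A W (ι ℂ a) m) =
      inducedLin hAB σ ⁅g, (a : L)⁆ m + leftAction A W (ι ℂ a) (inducedLin hAB σ g m) := by
  induction m using TensorProduct.induction_on with
  | zero => simp
  | add x y hx hy => simp only [map_add, hx, hy]; abel
  | tmul u w =>
    have h : UniversalEnvelopingAlgebra.lift ℂ (homAction A (U A ⊗[ℂ] W) (leftAction A W)) (ι ℂ a) =
        homAction A (U A ⊗[ℂ] W) (leftAction A W) a := UniversalEnvelopingAlgebra.lift_ι_apply ℂ _ a
    rw [leftAction_tmul]
    simp only [inducedLin, LinearMap.flip_apply, TensorProduct.lift.tmul, LinearMap.compl₂_apply,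
      AlgHom.toLinearMap_apply, map_mul, h, Module.End.mul_apply]
    rw [← lie_skew g (a : L), map_neg]
    simp only [homAction, LieHom.coe_mk, LinearMap.coe_mk, AddHom.coe_mk, LinearMap.sub_apply,
      LinearMap.comp_apply, LieAlgebra.ad_apply]
    abel

theorem tmul_induction {P : U A ⊗[ℂ] W → Prop} (one : ∀ w, P (1 ⊗ₜ w)) (zero : P 0)
    (add : ∀ u v, P u → P v → P (u + v)) (smul : ∀ (c : ℂ) u, P u → P (c • u))
    (mul : ∀ (a : A) m, P m → P (leftAction A W (ι ℂ a) m)) (m : U A ⊗[ℂ] W) : P m := by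
  induction m using TensorProduct.induction_on with
  | zero => exact zero
  | add x y hx hy => exact add x y hx hy
  | tmul u w =>
    induction u using induction_left with
    | one => exact one w
    | zero => rw [TensorProduct.zero_tmul]; exact zero
    | add x y hx hy => rw [TensorProduct.add_tmul]; exact add _ _ hx hy
    | smul c x hx => rw [← TensorProduct.smul_tmul']; exact smul c _ hx
    | mul x u hu => exact mul x _ hu

theorem inducedLin_left (a : A) (m : U A ⊗[ℂ] W) :
    inducedLin hAB σ (a : L) m = leftAction A W (ι ℂ a) m := by
  induction m using tmul_induction generalizing a with
  | one w => rw [inducedLin_one_tmul, inducedStart_left, leftAction_tmul, mul_one]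
  | zero => simp
  | add x y hx hy => simp [hx, hy]
  | smul c x hx => simp [hx]
  | mul b m hm =>
    rw [inducedLin_ι_smul, ← LieSubalgebra.coe_bracket, hm, hm, ι_lie]
    simp

theorem inducedLin_right_one_tmul {b : L} (hb : b ∈ B) (w : W) :
    inducedLin hAB σ b (1 ⊗ₜ w) = 1 ⊗ₜ σ b w := by
  rw [inducedLin_one_tmul, inducedStart_right hAB σ w hb]

variable (hσ : ∀ b ∈ B, ∀ c ∈ B, σ ⁅b, c⁆ = σ b * σ c - σ c * σ b)

include hσ in
-- Induction on the `U A` factor. On `1 ⊗ w`, split `g` and `h` along `A ⊕ B`: brackets with an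
-- element of `A` follow from `inducedLin_ι_smul`, and the `B`–`B` bracket is the hypothesis on `σ`.
-- Passing from `m` to `a m` is the Jacobi identity.
theorem inducedLin_lie (g h : L) (m : U A ⊗[ℂ] W) :
    inducedLin hAB σ ⁅g, h⁆ m =
      inducedLin hAB σ g (inducedLin hAB σ h m) - inducedLin hAB σ h (inducedLin hAB σ g m) := by
  have key : ∀ (g : L) (a : A) m, inducedLin hAB σ ⁅g, (a : L)⁆ m =
      inducedLin hAB σ g (inducedLin hAB σ (a : L) m) -
        inducedLin hAB σ (a : L) (inducedLin hAB σ g m) := by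
    intro g a m
    rw [inducedLin_left, inducedLin_left, inducedLin_ι_smul]
    abel
  induction m using tmul_induction generalizing g h with
  | one w =>
    obtain ⟨a, b, hab, -⟩ := Submodule.existsUnique_add_of_isCompl hAB g
    obtain ⟨c, d, hcd, -⟩ := Submodule.existsUnique_add_of_isCompl hAB h
    rw [← hab, ← hcd]
    have key' : ∀ (a : A) (h : L) m, inducedLin hAB σ ⁅(a : L), h⁆ m =
        inducedLin hAB σ (a : L) (inducedLin hAB σ h m) -
          inducedLin hAB σ h (inducedLin hAB σ (a : L) m) := by
      intro a h m
      rw [← lie_skew, map_neg, LinearMap.neg_apply, key]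
      abel
    have hbd : inducedLin hAB σ ⁅(b : L), (d : L)⁆ (1 ⊗ₜ w) =
        inducedLin hAB σ (b : L) (inducedLin hAB σ (d : L) (1 ⊗ₜ w)) -
          inducedLin hAB σ (d : L) (inducedLin hAB σ (b : L) (1 ⊗ₜ w)) := by
      rw [inducedLin_right_one_tmul _ _ (B.lie_mem b.2 d.2), hσ _ b.2 _ d.2]
      simp only [inducedLin_right_one_tmul _ _ b.2, inducedLin_right_one_tmul _ _ d.2]
      simp [TensorProduct.tmul_sub]
    simp only [add_lie, lie_add, map_add, LinearMap.add_apply, hbd]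
    erw [key' a d, key' a c, key b c]
    abel
  | zero => simp
  | add x y hx hy => simp only [map_add, hx, hy]; abel
  | smul c x hx => simp only [map_smul, hx, smul_sub]
  | mul a m hm =>
    have hJ : ⁅⁅g, h⁆, (a : L)⁆ = ⁅g, ⁅h, (a : L)⁆⁆ - ⁅h, ⁅g, (a : L)⁆⁆ := lie_lie g h (a : L)
    rw [inducedLin_ι_smul, hJ]
    simp only [inducedLin_ι_smul, map_add, map_sub, LinearMap.sub_apply, hm _ ⁅_, (a : L)⁆, hm g h]
    abel

/-- The representation of `L = A ⊕ B` induced from a representation of `B` on `W`. -/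
def induced : L →ₗ⁅ℂ⁆ Module.End ℂ (U A ⊗[ℂ] W) :=
  { inducedLin hAB σ with
    map_lie' := fun {g h} => by
      refine LinearMap.ext fun m => ?_
      exact inducedLin_lie hAB σ hσ g h m }

end Induced

/-! ### Representations induced from a character -/

section CharRep

variable {L : Type*} [LieRing L] [LieAlgebra ℂ L] {A B : LieSubalgebra ℂ L}
  (hAB : IsCompl A.toSubmodule B.toSubmodule) (ψ : L →ₗ[ℂ] ℂ)
  (hψ : ∀ b ∈ B, ∀ c ∈ B, ψ ⁅b, c⁆ = 0)

/-- The representation of `L = A ⊕ B` on `U A` induced from the character `ψ` of `B`. -/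
def charRep : L →ₗ⁅ℂ⁆ Module.End ℂ (U A) :=
  let ρ := induced (W := ℂ) hAB (ψ.smulRight 1) (fun b hb c hc => by
    ext
    simp [hψ b hb c hc, mul_comm])
  { (TensorProduct.rid ℂ (U A)).conj.toLinearMap ∘ₗ ρ.toLinearMap with
    map_lie' := fun {g h} => by
      refine LinearMap.ext fun u => ?_
      simp [LinearEquiv.conj_apply, LieHom.map_lie, LieRing.of_associative_ring_bracket] }

theorem charRep_apply (g : L) (u : U A) :
    charRep hAB ψ hψ g u = TensorProduct.rid ℂ (U A)
      (inducedLin (W := ℂ) hAB (ψ.smulRight 1) g (u ⊗ₜ 1)) := rfl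

theorem rid_leftAction (u : U A) (m : U A ⊗[ℂ] ℂ) :
    TensorProduct.rid ℂ (U A) (leftAction A ℂ u m) = u * TensorProduct.rid ℂ (U A) m := by
  induction m using TensorProduct.induction_on with
  | zero => simp
  | add x y hx hy => simp only [map_add, hx, hy, mul_add]
  | tmul v c => simp

theorem charRep_left (a : A) (u : U A) : charRep hAB ψ hψ (a : L) u = ι ℂ a * u := by
  rw [charRep_apply, inducedLin_left, rid_leftAction]
  simp

theorem charRep_ι_mul (g : L) (a : A) (u : U A) :
    charRep hAB ψ hψ g (ι ℂ a * u) =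
      charRep hAB ψ hψ ⁅g, (a : L)⁆ u + ι ℂ a * charRep hAB ψ hψ g u := by
  rw [charRep_apply, ← leftAction_tmul, inducedLin_ι_smul, map_add, rid_leftAction]
  rfl

theorem charRep_right_one {b : L} (hb : b ∈ B) :
    charRep hAB ψ hψ b 1 = algebraMap ℂ (U A) (ψ b) := by
  rw [charRep_apply, inducedLin_right_one_tmul _ _ hb, Algebra.algebraMap_eq_smul_one]
  simp

/-- The action of `U L` on `U A` extending `charRep`. -/
def charAct : U L →ₐ[ℂ] Module.End ℂ (U A) := UniversalEnvelopingAlgebra.lift ℂ (charRep hAB ψ hψ)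

@[simp]
theorem charAct_ι (g : L) : charAct hAB ψ hψ (ι ℂ g) = charRep hAB ψ hψ g :=
  UniversalEnvelopingAlgebra.lift_ι_apply ℂ _ g

theorem charAct_incl (u v : U A) : charAct hAB ψ hψ (incl A u) v = u * v := by
  induction u using induction_left generalizing v with
  | one => simp
  | zero => simp
  | add x y hx hy => simp [hx, hy, add_mul]
  | smul c x hx => simp [hx]
  | mul a u hu => simp [hu, charRep_left, mul_assoc]

/-- Both sides satisfy the same commutation rule with `A`, so induction on `u` reduces to `u = 1`.
There `g` splits along `A ⊕ B`, and `hw` treats the part in `B`. -/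
theorem incl_charRep_apply {N : Type*} [AddCommGroup N] [Module ℂ N] (κ : U L →ₐ[ℂ] Module.End ℂ N)
    {w : N} (hw : ∀ b ∈ B, κ (ι ℂ b) w = ψ b • w) (g : L) (u : U A) :
    κ (incl A (charRep hAB ψ hψ g u)) w = κ (ι ℂ g) (κ (incl A u) w) := by
  induction u using induction_left generalizing g with
  | one =>
    obtain ⟨a, b, hab, -⟩ := Submodule.existsUnique_add_of_isCompl hAB g
    have h1 : charRep hAB ψ hψ (a : L) 1 = ι ℂ (⟨a, a.2⟩ : A) * 1 :=
      charRep_left hAB ψ hψ ⟨a, a.2⟩ 1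
    have h2 := charRep_right_one hAB ψ hψ b.2
    rw [← hab, map_add, map_add, LinearMap.add_apply, h1, h2]
    simp [hw _ b.2, Module.algebraMap_end_apply]
  | zero => simp
  | add x y hx hy => simp [hx, hy]
  | smul c x hx => simp [hx]
  | mul a u hu =>
    rw [charRep_ι_mul, map_add, map_mul, map_add, map_mul, LinearMap.add_apply, hu,
      Module.End.mul_apply, hu, incl_ι, map_mul, map_mul, ι_lie, map_sub, map_mul, map_mul]
    simp [Module.End.mul_apply]

/-- The universal property of the induced representation: a vector `w` on which `B` acts through the
character defines an equivariant map. -/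
theorem incl_charAct_apply {N : Type*} [AddCommGroup N] [Module ℂ N] (κ : U L →ₐ[ℂ] Module.End ℂ N)
    {w : N} (hw : ∀ b ∈ B, κ (ι ℂ b) w = ψ b • w) (a : U L) (u : U A) :
    κ (incl A (charAct hAB ψ hψ a u)) w = κ a (κ (incl A u) w) := by
  induction a using induction_left with
  | one => simp
  | zero => simp
  | add x y hx hy => simp [hx, hy]
  | smul c x hx => simp [hx]
  | mul g a ha => simp [incl_charRep_apply hAB ψ hψ κ hw, ha]

end CharRep

/-! ### Gradings -/

section Degrees

variable {L : Type*} [LieRing L] [LieAlgebra ℂ L] (ℒ : ℤ → Submodule ℂ L)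

theorem one_mem_uDeg : (1 : U L) ∈ uDeg ℒ 0 := SetLike.one_mem_graded (uDeg ℒ)

theorem mul_mem_uDeg {i j k : ℤ} (h : i + j = k) {u v : U L} (hu : u ∈ uDeg ℒ i)
    (hv : v ∈ uDeg ℒ j) : u * v ∈ uDeg ℒ k := h ▸ SetLike.mul_mem_graded hu hv

/-- Induction on homogeneous elements of `U L`. -/
theorem uDeg_induction {P : ∀ k u, u ∈ uDeg ℒ k → Prop} (one : P 0 1 (one_mem_uDeg ℒ))
    (zero : ∀ k, P k 0 (Submodule.zero_mem _))
    (add : ∀ k u v hu hv, P k u hu → P k v hv → P k (u + v) (Submodule.add_mem _ hu hv))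
    (smul : ∀ k (c : ℂ) u hu, P k u hu → P k (c • u) (Submodule.smul_mem _ c hu))
    (mul : ∀ i x (hx : x ∈ ℒ i) j u hu, P j u hu →
      P (i + j) (ι ℂ x * u) (mul_mem_uDeg ℒ rfl (ι_mem_uDeg ℒ ⟨x, hx⟩) hu)) {k : ℤ} {u : U L}
    (hu : u ∈ uDeg ℒ k) : P k u hu := by
  induction hu using Submodule.span_induction with
  | mem u h =>
    obtain ⟨l, rfl, rfl⟩ := h
    induction l with
    | nil => exact one
    | cons a l ih =>
      simp only [List.map_cons, List.sum_cons, List.prod_cons]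
      exact mul _ _ a.2.2 _ _ _ ih
  | zero => exact zero k
  | add x y _ _ hx hy => exact add k x y _ _ hx hy
  | smul c x _ hx => exact smul k c x _ hx

theorem counit_eq_zero_of_mem_uDeg {k : ℤ} (hk : k ≠ 0) {u : U L} (hu : u ∈ uDeg ℒ k) :
    counit L u = 0 := by
  revert hk
  induction hu using uDeg_induction with
  | one => exact fun h => absurd rfl h
  | zero => simp
  | add k u v _ _ hu hv => intro h; simp [hu h, hv h]
  | smul k c u _ hu => intro h; simp [hu h]
  | mul i x hx j u _ ih => simp

theorem antipode_mem_uDeg {k : ℤ} {u : U L} (hu : u ∈ uDeg ℒ k) : antipode L u ∈ uDeg ℒ k := by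
  induction hu using uDeg_induction with
  | one => rw [antipode_one]; exact one_mem_uDeg ℒ
  | zero => rw [map_zero]; exact Submodule.zero_mem _
  | add k u v _ _ hu hv => rw [map_add]; exact Submodule.add_mem _ hu hv
  | smul k c u _ hu => rw [map_smul]; exact Submodule.smul_mem _ c hu
  | mul i x hx j u _ ih =>
    rw [antipode_mul, antipode_ι]
    exact mul_mem_uDeg ℒ (add_comm j i) ih (Submodule.neg_mem _ (ι_mem_uDeg ℒ ⟨x, hx⟩))

/-- Serves to show that `U 𝔫₊` lives in degrees `≥ 0` and `U 𝔫₋` in degrees `≤ 0`. -/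
theorem uDeg_eq_bot_of_forall {D : Set ℤ} (hD : ∀ i, i ∉ D → ℒ i = ⊥) (M : AddSubmonoid ℤ)
    (hM : D ⊆ M) {k : ℤ} (hk : k ∉ M) : uDeg ℒ k = ⊥ := by
  refine (Submodule.eq_bot_iff _).2 fun u hu => ?_
  revert hk
  induction hu using uDeg_induction with
  | one => exact fun h => absurd M.zero_mem h
  | zero => simp
  | add k u v _ _ hu hv => intro h; simp [hu h, hv h]
  | smul k c u _ hu => intro h; simp [hu h]
  | mul i x hx j u _ ih =>
    intro h
    by_cases hi : i ∈ D
    · have hj : j ∉ M := fun hj => h (M.add_mem (hM hi) hj)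
      rw [ih hj, mul_zero]
    · rw [hD i hi, Submodule.mem_bot] at hx
      rw [hx, map_zero, zero_mul]

end Degrees

/-! ### Gradings of the subalgebras and of the induced modules -/

section GradedParts

variable {𝔤 : Type*} [LieRing 𝔤] [LieAlgebra ℂ 𝔤] (𝒢 : ℤ → Submodule ℂ 𝔤) [GradedLieAlgebra 𝒢]
  {S S' : AddSubsemigroup ℤ}

theorem mem_gradedPart_of_mem {i : ℤ} (hi : i ∈ S) {x : 𝔤} (hx : x ∈ 𝒢 i) : x ∈ gradedPart 𝒢 S :=
  Submodule.mem_iSup_of_mem (p := fun i : S => 𝒢 i) ⟨i, hi⟩ hx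

theorem decompose_eq_zero_of_mem_gradedPart {i : ℤ} (hi : i ∉ S) {x : 𝔤}
    (hx : x ∈ gradedPart 𝒢 S) : DirectSum.decompose 𝒢 x i = 0 := by
  rw [mem_gradedPart] at hx
  induction hx using Submodule.iSup_induction' with
  | zero => simp
  | add a b _ _ ha hb => rw [DirectSum.decompose_add, DirectSum.add_apply, ha, hb, add_zero]
  | mem j a ha =>
    refine Subtype.ext ?_
    rw [DirectSum.decompose_of_mem_ne 𝒢 ha (fun h => hi (by rw [← h]; exact j.2))]
    rfl

theorem isCompl_gradedPart (h : ∀ i, i ∈ S ↔ i ∉ S') :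
    IsCompl (gradedPart 𝒢 S).toSubmodule (gradedPart 𝒢 S').toSubmodule := by
  constructor
  · rw [Submodule.disjoint_def]
    intro x hx hx'
    refine (DirectSum.decompose 𝒢).injective ?_
    rw [DirectSum.decompose_zero]
    ext i : 1
    by_cases hi : i ∈ S
    · exact decompose_eq_zero_of_mem_gradedPart 𝒢 ((h i).1 hi) hx'
    · exact decompose_eq_zero_of_mem_gradedPart 𝒢 hi hx
  · rw [codisjoint_iff, eq_top_iff]
    rintro x -
    induction x using DirectSum.Decomposition.inductionOn 𝒢 with
    | zero => exact Submodule.zero_mem _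
    | add a b ha hb => exact Submodule.add_mem _ ha hb
    | @homogeneous i a =>
      by_cases hi : i ∈ S
      · exact Submodule.mem_sup_left (mem_gradedPart_of_mem 𝒢 hi a.2)
      · exact Submodule.mem_sup_right
          (mem_gradedPart_of_mem 𝒢 (not_not.1 fun h' => hi ((h i).2 h')) a.2)

theorem incl_mem_uDeg {k : ℤ} {u : U (gradedPart 𝒢 S)} (hu : u ∈ uDeg (partGrading 𝒢 S) k) :
    incl (gradedPart 𝒢 S) u ∈ uDeg 𝒢 k := by
  induction hu using uDeg_induction with
  | one => rw [map_one]; exact one_mem_uDeg 𝒢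
  | zero => rw [map_zero]; exact Submodule.zero_mem _
  | add k u v _ _ hu hv => rw [map_add]; exact Submodule.add_mem _ hu hv
  | smul k c u _ hu => rw [map_smul]; exact Submodule.smul_mem _ c hu
  | mul i x hx j u _ ih =>
    rw [map_mul, incl_ι]
    exact mul_mem_uDeg 𝒢 rfl (ι_mem_uDeg 𝒢 ⟨x, hx⟩) ih

theorem partGrading_eq_bot {i : ℤ} (hi : i ∉ S) : partGrading 𝒢 S i = ⊥ := by
  refine (Submodule.eq_bot_iff _).2 fun x hx => Subtype.ext ?_
  have h := decompose_eq_zero_of_mem_gradedPart 𝒢 hi x.2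
  have h' := DirectSum.decompose_of_mem_same 𝒢 (show (x : 𝔤) ∈ 𝒢 i from hx)
  rw [h] at h'
  exact h'.symm

variable (hS : IsCompl (gradedPart 𝒢 S).toSubmodule (gradedPart 𝒢 S').toSubmodule)
  (hSS' : ∀ i, i ∈ S ↔ i ∉ S') (ψ : 𝔤 →ₗ[ℂ] ℂ)
  (hψ : ∀ b ∈ gradedPart 𝒢 S', ∀ c ∈ gradedPart 𝒢 S', ψ ⁅b, c⁆ = 0)
  (hψ0 : ∀ i ≠ 0, ∀ x ∈ 𝒢 i, ψ x = 0)

include hSS' hψ0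

/-- The only place where degrees could fail to add is the scalar by which the complement acts on
`1`; `hψ0` makes it vanish outside degree zero. -/
theorem charRep_mem_uDeg {i j k : ℤ} (hk : i + j = k) {g : 𝔤} (hg : g ∈ 𝒢 i)
    {u : U (gradedPart 𝒢 S)} (hu : u ∈ uDeg (partGrading 𝒢 S) j) :
    charRep hS ψ hψ g u ∈ uDeg (partGrading 𝒢 S) k := by
  subst hk
  induction hu using uDeg_induction generalizing i g with
  | one =>
    by_cases hi : i ∈ S
    · have h := charRep_left hS ψ hψ ⟨g, mem_gradedPart_of_mem 𝒢 hi hg⟩ 1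
      simp only at h
      rw [h, mul_one, add_zero]
      exact ι_mem_uDeg (partGrading 𝒢 S) ⟨⟨g, mem_gradedPart_of_mem 𝒢 hi hg⟩, hg⟩
    · have hi' : i ∈ S' := not_not.1 fun h' => hi ((hSS' i).2 h')
      rw [charRep_right_one hS ψ hψ (mem_gradedPart_of_mem 𝒢 hi' hg)]
      by_cases h0 : i = 0
      · subst h0
        rw [Algebra.algebraMap_eq_smul_one]
        exact Submodule.smul_mem _ _ (one_mem_uDeg _)
      · rw [hψ0 i h0 g hg, map_zero]
        exact Submodule.zero_mem _
  | zero => rw [map_zero]; exact Submodule.zero_mem _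
  | add k u v _ _ hu hv => rw [map_add]; exact Submodule.add_mem _ (hu hg) (hv hg)
  | smul k c u _ hu => rw [map_smul]; exact Submodule.smul_mem _ c (hu hg)
  | mul j x hx k u _ ih =>
    rw [charRep_ι_mul]
    refine Submodule.add_mem _ ?_ (mul_mem_uDeg _ (by ring) (ι_mem_uDeg _ ⟨x, hx⟩) (ih hg))
    rw [← add_assoc]
    exact ih (SetLike.GradedBracket.bracket_mem hg hx)

theorem charAct_mem_uDeg {i j k : ℤ} (hk : i + j = k) {a : U 𝔤} (ha : a ∈ uDeg 𝒢 i)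
    {u : U (gradedPart 𝒢 S)} (hu : u ∈ uDeg (partGrading 𝒢 S) j) :
    charAct hS ψ hψ a u ∈ uDeg (partGrading 𝒢 S) k := by
  subst hk
  induction ha using uDeg_induction with
  | one => simpa using hu
  | zero => simp
  | add k a b _ _ ha hb => rw [map_add]; exact Submodule.add_mem _ ha hb
  | smul k c a _ ha => rw [map_smul]; exact Submodule.smul_mem _ c ha
  | mul i x hx j a _ ih =>
    rw [map_mul, charAct_ι]
    exact charRep_mem_uDeg 𝒢 hS hSS' ψ hψ hψ0 (by ring) hx ih

end GradedParts

/-! ### Linear independence of monomials -/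

section Monomials

variable {L : Type*} [LieRing L] [LieAlgebra ℂ L] {I : Type*} (b : I → L)

/-- The product in `U L` of the elements of a list of generators. -/
def listProd (l : List I) : U L := (l.map fun i => (ι ℂ (b i) : U L)).prod

/-- The monomial of a multiset of generators, in an arbitrary order. -/
def monomial (s : Multiset I) : U L := listProd b s.toList

@[simp]
theorem listProd_nil : listProd b [] = 1 := rfl

@[simp]
theorem listProd_cons (i : I) (l : List I) : listProd b (i :: l) = ι ℂ (b i) * listProd b l := by
  simp [listProd]

/-- The span of products of fewer than `d` generators. -/
def filtLT (d : ℕ) : Submodule ℂ (U L) :=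
  Submodule.span ℂ {u | ∃ l : List I, l.length < d ∧ listProd b l = u}

theorem listProd_mem_filtLT {l : List I} {d : ℕ} (h : l.length < d) : listProd b l ∈ filtLT b d :=
  Submodule.subset_span ⟨l, h, rfl⟩

theorem filtLT_mono {d e : ℕ} (h : d ≤ e) : filtLT b d ≤ filtLT b e :=
  Submodule.span_mono fun _ ⟨l, hl, hu⟩ => ⟨l, hl.trans_le h, hu⟩

theorem filtLT_zero : filtLT b 0 = ⊥ := by
  rw [filtLT, Submodule.span_eq_bot]
  rintro _ ⟨l, hl, -⟩
  exact absurd hl (Nat.not_lt_zero _)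

theorem ι_mul_mem_filtLT (i : I) {d : ℕ} {u : U L} (hu : u ∈ filtLT b d) :
    ι ℂ (b i) * u ∈ filtLT b (d + 1) := by
  induction hu using Submodule.span_induction with
  | mem u h =>
    obtain ⟨l, hl, rfl⟩ := h
    rw [← listProd_cons]
    exact listProd_mem_filtLT b (by simpa using hl)
  | zero => simp
  | add x y _ _ hx hy => rw [mul_add]; exact Submodule.add_mem _ hx hy
  | smul c x _ hx => rw [mul_smul_comm]; exact Submodule.smul_mem _ c hx

theorem ι_mul_mem_filtLT_pred (i : I) {d : ℕ} {u : U L} (hu : u ∈ filtLT b (d - 1)) :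
    ι ℂ (b i) * u ∈ filtLT b d := by
  cases d with
  -- Truncated subtraction gives `0 - 1 = 0`, and nothing but zero lies in `filtLT b 0`.
  | zero =>
    rw [Nat.zero_sub, filtLT_zero, Submodule.mem_bot] at hu
    simp [hu]
  | succ d => exact ι_mul_mem_filtLT b i hu

variable (hb : Submodule.span ℂ (Set.range b) = ⊤)

include hb

theorem ι_mul_mem_filtLT' (x : L) {d : ℕ} {u : U L} (hu : u ∈ filtLT b d) :
    ι ℂ x * u ∈ filtLT b (d + 1) := by
  have hx : x ∈ Submodule.span ℂ (Set.range b) := by rw [hb]; trivial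
  induction hx using Submodule.span_induction with
  | mem x hx => obtain ⟨i, rfl⟩ := hx; exact ι_mul_mem_filtLT b i hu
  | zero => simp
  | add x y _ _ hx hy => rw [map_add, add_mul]; exact Submodule.add_mem _ hx hy
  | smul c x _ hx => rw [map_smul, smul_mul_assoc]; exact Submodule.smul_mem _ c hx

/-- Swapping two neighbours costs a bracket, which is one element of `L` in place of two and so
shortens the word. -/
theorem listProd_sub_mem_of_perm {l m : List I} (h : l.Perm m) :
    listProd b l - listProd b m ∈ filtLT b l.length := by
  induction h with
  | nil => simp
  | cons i h ih =>
    rw [listProd_cons, listProd_cons, ← mul_sub]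
    exact ι_mul_mem_filtLT b i ih
  | swap i j l =>
    simp only [listProd_cons, ← mul_assoc]
    rw [← sub_mul, ← ι_lie]
    exact ι_mul_mem_filtLT' b hb _ (listProd_mem_filtLT b (Nat.lt_succ_self _))
  | trans h₁ _ ih₁ ih₂ =>
    rw [← h₁.length_eq] at ih₂
    simpa using Submodule.add_mem _ ih₁ ih₂

theorem filtLT_le_span_monomial (d : ℕ) :
    filtLT b d ≤ Submodule.span ℂ (Set.range (monomial b)) := by
  induction d with
  | zero => rw [filtLT_zero]; exact bot_le
  | succ d ih =>
    refine Submodule.span_le.2 ?_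
    rintro _ ⟨l, hl, rfl⟩
    have h := listProd_sub_mem_of_perm b hb
      (Multiset.coe_eq_coe.1 (Multiset.coe_toList (l : Multiset I)).symm)
    have h' := ih (filtLT_mono b (Nat.lt_succ_iff.1 hl) h)
    have h'' : monomial b (l : Multiset I) ∈ Submodule.span ℂ (Set.range (monomial b)) :=
      Submodule.subset_span ⟨_, rfl⟩
    have := Submodule.add_mem _ h' h''
    rwa [monomial, sub_add_cancel] at this

/-- Monomials in arbitrarily chosen orders span the enveloping algebra. -/
theorem span_monomial : Submodule.span ℂ (Set.range (monomial b)) = ⊤ := by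
  refine eq_top_iff.2 fun u hu => ?_
  clear hu
  have h : ∃ d, u ∈ filtLT b d := by
    induction u using induction_left with
    | one => exact ⟨1, listProd_mem_filtLT b (l := []) (by simp)⟩
    | zero => exact ⟨0, Submodule.zero_mem _⟩
    | add u v hu hv =>
      obtain ⟨d, hd⟩ := hu
      obtain ⟨e, he⟩ := hv
      exact ⟨max d e, Submodule.add_mem _ (filtLT_mono b (le_max_left _ _) hd)
        (filtLT_mono b (le_max_right _ _) he)⟩
    | smul c u hu => obtain ⟨d, hd⟩ := hu; exact ⟨d, Submodule.smul_mem _ c hd⟩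
    | mul x u hu => obtain ⟨d, hd⟩ := hu; exact ⟨d + 1, ι_mul_mem_filtLT' b hb x hd⟩
  obtain ⟨d, hd⟩ := h
  exact filtLT_le_span_monomial b hb d hd

omit hb

/-- The map `u ↦ f(u') u''`, where `Δ u = u' ⊗ u''`. -/
def contractLeft (f : U L →ₗ[ℂ] ℂ) : U L →ₗ[ℂ] U L :=
  (TensorProduct.lid ℂ (U L)).toLinearMap ∘ₗ
    TensorProduct.map f LinearMap.id ∘ₗ (comul L).toLinearMap

@[simp]
theorem contractLeft_one (f : U L →ₗ[ℂ] ℂ) : contractLeft f 1 = f 1 • 1 := by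
  simp [contractLeft, Algebra.TensorProduct.one_def]

/-- As `x` is primitive, it goes either into the leg seen by `f` or into the leg that is kept. -/
theorem contractLeft_ι_mul (f : U L →ₗ[ℂ] ℂ) (x : L) (u : U L) :
    contractLeft f (ι ℂ x * u) =
      contractLeft (f ∘ₗ LinearMap.mulLeft ℂ (ι ℂ x)) u + ι ℂ x * contractLeft f u := by
  simp only [contractLeft, LinearMap.comp_apply, AlgHom.toLinearMap_apply, map_mul, comul_ι]
  induction comul L u using TensorProduct.induction_on with
  | zero => simp
  | add y z hy hz =>
    simp only [mul_add, map_add, hy, hz]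
    abel
  | tmul y z =>
    simp [add_mul]

/-- Full length survives only when every factor stays in the second leg, a term weighted by `f 1`.
-/
theorem contractLeft_listProd_sub_mem (f : U L →ₗ[ℂ] ℂ) (l : List I) :
    contractLeft f (listProd b l) - f 1 • listProd b l ∈ filtLT b l.length := by
  induction l generalizing f with
  | nil => simp
  | cons i l ih =>
    rw [listProd_cons, contractLeft_ι_mul, add_sub_assoc, ← mul_smul_comm, ← mul_sub]
    refine Submodule.add_mem _ ?_ (ι_mul_mem_filtLT b i (ih f))
    have h := ih (f ∘ₗ LinearMap.mulLeft ℂ (ι ℂ (b i)))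
    have h' := Submodule.add_mem _ (filtLT_mono b (Nat.le_succ _) h)
      (Submodule.smul_mem _ ((f ∘ₗ LinearMap.mulLeft ℂ (ι ℂ (b i))) 1)
        (listProd_mem_filtLT b (Nat.lt_succ_self l.length)))
    rwa [sub_add_cancel] at h'

end Monomials

/-! ### Dual functionals acting as partial derivatives -/

section Independence

variable {L : Type*} [LieRing L] [LieAlgebra ℂ L] {I : Type*} [DecidableEq I]
  (b : I → L) (hb : Submodule.span ℂ (Set.range b) = ⊤) (f : I → U L →ₗ[ℂ] ℂ)
  (hf1 : ∀ i, f i 1 = 0) (hf : ∀ i j, f i (ι ℂ (b j)) = if i = j then 1 else 0)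

include hb hf1 hf

/-- To leading order, contraction with the dual functional `f i` is the partial derivative in `b i`.
The term with no factor in the first leg dies because `f i 1 = 0`, one factor there gives the
derivative, and two or more leave a shorter word. -/
theorem contractLeft_dual_sub_mem (i : I) (l : List I) :
    contractLeft (f i) (listProd b l) - (l.count i : ℂ) • listProd b (l.erase i) ∈
      filtLT b (l.length - 1) := by
  induction l with
  | nil => simp [hf1]
  | cons j l ih =>
    have h1 := contractLeft_listProd_sub_mem b (f i ∘ₗ LinearMap.mulLeft ℂ (ι ℂ (b j))) l
    have h2 := ι_mul_mem_filtLT_pred b j ih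
    simp only [LinearMap.comp_apply, LinearMap.mulLeft_apply, mul_one, hf] at h1
    rw [listProd_cons, contractLeft_ι_mul, List.length_cons, Nat.add_sub_cancel]
    have h3 := Submodule.add_mem _ h1 h2
    by_cases hij : i = j
    · subst hij
      rw [if_pos rfl, one_smul] at h3
      rw [List.count_cons_self, List.erase_cons_head]
      by_cases hi : i ∈ l
      · have h4 := listProd_sub_mem_of_perm b hb (List.perm_cons_erase hi)
        rw [listProd_cons] at h4
        have h5 := Submodule.sub_mem _ h3 (Submodule.smul_mem _ (l.count i : ℂ) h4)
        convert h5 using 1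
        push_cast
        rw [mul_sub, mul_smul_comm, add_smul, smul_sub, one_smul]
        abel
      · rw [List.count_eq_zero.2 hi] at h3 ⊢
        convert h3 using 1
        simp only [Nat.cast_zero, zero_smul, sub_zero, zero_add, Nat.cast_one, one_smul]
        abel
    · rw [if_neg hij, zero_smul, sub_zero] at h3
      rw [List.count_cons_of_ne (Ne.symm hij), List.erase_cons_tail (by simpa using Ne.symm hij),
        listProd_cons]
      convert h3 using 1
      rw [mul_sub, mul_smul_comm]
      abel

omit hb hf1 hf in
/-- The functional `ε ∘ ∂_{iᵣ} ∘ ⋯ ∘ ∂_{i₁}`. -/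
def iterContract : List I → U L →ₗ[ℂ] ℂ
  | [] => (counit L).toLinearMap
  | i :: l => iterContract l ∘ₗ contractLeft (f i)

theorem contractLeft_dual_mem (i : I) {d : ℕ} {u : U L} (hu : u ∈ filtLT b (d + 1)) :
    contractLeft (f i) u ∈ filtLT b d := by
  induction hu using Submodule.span_induction with
  | mem u h =>
    obtain ⟨l, hl, rfl⟩ := h
    have h1 := filtLT_mono b (show l.length - 1 ≤ d by omega)
      (contractLeft_dual_sub_mem b hb f hf1 hf i l)
    rw [← sub_add_cancel (contractLeft (f i) (listProd b l))]
    refine Submodule.add_mem _ h1 ?_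
    by_cases hi : i ∈ l
    · refine Submodule.smul_mem _ _ (listProd_mem_filtLT b ?_)
      have := List.length_pos_of_mem hi
      rw [List.length_erase_of_mem hi]
      omega
    · simp [List.count_eq_zero.2 hi]
  | zero => simp
  | add x y _ _ hx hy => rw [map_add]; exact Submodule.add_mem _ hx hy
  | smul c x _ hx => rw [map_smul]; exact Submodule.smul_mem _ c hx

theorem iterContract_eq_zero (l : List I) {u : U L} (hu : u ∈ filtLT b l.length) :
    iterContract f l u = 0 := by
  induction l generalizing u with
  | nil =>
    rw [List.length_nil, filtLT_zero, Submodule.mem_bot] at hu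
    rw [hu, map_zero]
  | cons i l ih => exact ih (contractLeft_dual_mem b hb f hf1 hf i hu)

/-- Differentiating a word along another of the same length gives a product of multiplicities if
they agree up to order and zero otherwise; the error terms are too short to survive the remaining
derivatives. -/
theorem iterContract_ne_zero_iff (l m : List I) (h : m.length = l.length) :
    iterContract f l (listProd b m) ≠ 0 ↔ l.Perm m := by
  induction l generalizing m with
  | nil =>
    rw [List.length_nil, List.length_eq_zero_iff] at h
    subst h
    simp [iterContract]
  | cons i l ih =>
    have h1 := contractLeft_dual_sub_mem b hb f hf1 hf i m
    have h2 := iterContract_eq_zero b hb f hf1 hf l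
      (filtLT_mono b (by rw [h]; simp) h1)
    rw [map_sub, sub_eq_zero, map_smul] at h2
    change iterContract f l (contractLeft (f i) (listProd b m)) ≠ 0 ↔ _
    rw [h2, List.cons_perm_iff_perm_erase]
    by_cases hi : i ∈ m
    · have h3 : (m.count i : ℂ) ≠ 0 := Nat.cast_ne_zero.2 (List.count_pos_iff.2 hi).ne'
      rw [smul_ne_zero_iff, ih _ (by rw [List.length_erase_of_mem hi, h]; simp)]
      simp [h3, hi]
    · simp [List.count_eq_zero.2 hi, hi]

theorem linearIndependent_monomial_of_dual : LinearIndependent ℂ (monomial b) := by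
  rw [linearIndependent_iff']
  by_contra! hcon
  obtain ⟨s, g, hsum, i, his, hi⟩ := hcon
  -- In a nontrivial relation take a monomial of maximal length. Differentiating along it kills all
  -- shorter monomials and all others of equal length, isolating its coefficient.
  obtain ⟨m, hm, hmax⟩ := Finset.exists_max_image (s.filter fun j => g j ≠ 0) Multiset.card
    ⟨i, Finset.mem_filter.2 ⟨his, hi⟩⟩
  rw [Finset.mem_filter] at hm
  have h := congrArg (iterContract f m.toList) hsum
  rw [map_sum, map_zero, Finset.sum_eq_single m] at h
  · rw [map_smul, smul_eq_zero] at h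
    refine h.elim hm.2 ?_
    exact (iterContract_ne_zero_iff b hb f hf1 hf _ _ rfl).2 (List.Perm.refl _)
  · intro t ht htm
    by_cases hg : g t = 0
    · rw [hg, zero_smul, map_zero]
    have hle := hmax t (Finset.mem_filter.2 ⟨ht, hg⟩)
    rw [map_smul]
    refine smul_eq_zero_of_right _ ?_
    rcases hle.lt_or_eq with hlt | heq
    · exact iterContract_eq_zero b hb f hf1 hf _ (listProd_mem_filtLT b (by simpa using hlt))
    · by_contra h0
      have hp := (iterContract_ne_zero_iff b hb f hf1 hf _ _ (by simpa using heq)).1 h0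
      have := Multiset.coe_eq_coe.2 hp
      rw [Multiset.coe_toList, Multiset.coe_toList] at this
      exact htm this.symm
  · exact fun h' => absurd hm.1 h'

end Independence

/-! ### Monomials in a basis -/

section Basis

variable {L : Type*} [LieRing L] [LieAlgebra ℂ L]

/-- The counit separates scalars from `L`, so `ℂ × L` embeds in `U L`. Composing the coordinates of
a basis with `r` yields dual functionals that vanish at `1`. -/
theorem exists_leftInverse_ι (hι : Function.Injective (ι ℂ : L → U L)) :
    ∃ r : U L →ₗ[ℂ] L, r 1 = 0 ∧ ∀ x, r (ι ℂ x) = x := by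
  let j : ℂ × L →ₗ[ℂ] U L :=
    LinearMap.coprod (Algebra.linearMap ℂ (U L)) (ι ℂ : L →ₗ⁅ℂ⁆ U L).toLinearMap
  have hj : LinearMap.ker j = ⊥ := by
    refine LinearMap.ker_eq_bot'.2 ?_
    rintro ⟨c, x⟩ h
    have h' : algebraMap ℂ (U L) c + ι ℂ x = 0 := h
    have hc := congrArg (counit L) h'
    simp only [map_add, AlgHom.commutes, counit_ι, add_zero, map_zero, Algebra.algebraMap_self,
      RingHom.id_apply] at hc
    subst hc
    rw [map_zero, zero_add] at h'
    rw [Prod.mk_eq_zero]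
    exact ⟨rfl, hι (by rw [h', map_zero])⟩
  obtain ⟨r, hr⟩ := j.exists_leftInverse_of_injective hj
  refine ⟨LinearMap.snd ℂ ℂ L ∘ₗ r, ?_, fun x => ?_⟩
  · have := congrArg Prod.snd (LinearMap.congr_fun hr (1, 0))
    simpa [j] using this
  · have := congrArg Prod.snd (LinearMap.congr_fun hr (0, x))
    simpa [j] using this

/-- If `L` embeds into `U L`, then monomials in a basis of `L` are linearly independent. -/
theorem linearIndependent_monomial (hι : Function.Injective (ι ℂ : L → U L)) {I : Type*}
    (b : Module.Basis I ℂ L) : LinearIndependent ℂ (monomial b) := by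
  classical
  obtain ⟨r, hr1, hr⟩ := exists_leftInverse_ι hι
  refine linearIndependent_monomial_of_dual b b.span_eq (fun i => b.coord i ∘ₗ r) ?_ ?_
  · intro i
    simp [hr1]
  · intro i j
    simp [hr, Finsupp.single_apply, eq_comm]

end Basis

/-! ### Dimensions of homogeneous components -/

section HomogeneousMonomials

variable {L : Type*} [LieRing L] [LieAlgebra ℂ L] (ℒ : ℤ → Submodule ℂ L) {I : Type*} (b : I → L)
  (deg : I → ℤ) (hdeg : ∀ i, b i ∈ ℒ (deg i))

include hdeg

theorem listProd_mem_uDeg (l : List I) : listProd b l ∈ uDeg ℒ (l.map deg).sum := by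
  induction l with
  | nil => exact one_mem_uDeg ℒ
  | cons i l ih =>
    rw [listProd_cons, List.map_cons, List.sum_cons]
    exact mul_mem_uDeg ℒ rfl (ι_mem_uDeg ℒ ⟨_, hdeg i⟩) ih

theorem monomial_mem_uDeg (s : Multiset I) : monomial b s ∈ uDeg ℒ (s.map deg).sum := by
  have h := listProd_mem_uDeg ℒ b deg hdeg s.toList
  rwa [← Multiset.sum_coe, ← Multiset.map_coe, Multiset.coe_toList] at h

/-- The monomials are homogeneous and span `U L`; projecting to degree `n` keeps exactly those of
degree `n`. -/
theorem uDeg_eq_span_monomial [GradedLieAlgebra ℒ] (hb : Submodule.span ℂ (Set.range b) = ⊤)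
    (n : ℤ) :
    uDeg ℒ n = Submodule.span ℂ (monomial b '' {s | (s.map deg).sum = n}) := by
  refine le_antisymm (fun u hu => ?_) (Submodule.span_le.2 ?_)
  · have key : ∀ v : U L, (DirectSum.decompose (uDeg ℒ) v n : U L) ∈
        Submodule.span ℂ (monomial b '' {s | (s.map deg).sum = n}) := by
      intro v
      have hv : v ∈ Submodule.span ℂ (Set.range (monomial b)) := by
        rw [span_monomial b hb]; trivial
      induction hv using Submodule.span_induction with
      | mem v h =>
        obtain ⟨s, rfl⟩ := h
        by_cases hs : (s.map deg).sum = n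
        · rw [DirectSum.decompose_of_mem_same (uDeg ℒ) (hs ▸ monomial_mem_uDeg ℒ b deg hdeg s)]
          exact Submodule.subset_span ⟨s, hs, rfl⟩
        · rw [DirectSum.decompose_of_mem_ne (uDeg ℒ) (monomial_mem_uDeg ℒ b deg hdeg s) hs]
          exact Submodule.zero_mem _
      | zero => simp
      | add x y _ _ hx hy =>
        rw [DirectSum.decompose_add, DirectSum.add_apply, Submodule.coe_add]
        exact Submodule.add_mem _ hx hy
      | smul c x _ hx =>
        rw [DirectSum.decompose_smul, DirectSum.smul_apply, Submodule.coe_smul]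
        exact Submodule.smul_mem _ c hx
    have h := key u
    rwa [DirectSum.decompose_of_mem_same (uDeg ℒ) hu] at h
  · rintro _ ⟨s, hs, rfl⟩
    have h := monomial_mem_uDeg ℒ b deg hdeg s
    rwa [show (s.map deg).sum = n from hs] at h

omit hdeg in
theorem finite_multiset_sum_eq (hpos : ∀ i, 0 < deg i) (hfin : ∀ k, {i | deg i = k}.Finite) (n : ℤ) :
    {s : Multiset I | (s.map deg).sum = n}.Finite := by
  classical
  have hF : {i | deg i ≤ n}.Finite := by
    refine ((Finset.Icc 1 n).finite_toSet.biUnion fun k _ => hfin k).subset fun i hi => ?_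
    have h1 : deg i ∈ Finset.Icc 1 n := Finset.mem_Icc.2 ⟨hpos i, hi⟩
    exact Set.mem_biUnion (Finset.mem_coe.2 h1) rfl
  have hcard : ∀ s : Multiset I, (s.card : ℤ) ≤ (s.map deg).sum := by
    intro s
    induction s using Multiset.induction_on with
    | empty => simp
    | cons a s ih =>
      rw [Multiset.card_cons, Multiset.map_cons, Multiset.sum_cons]
      have := hpos a
      push_cast
      linarith
  -- Since degrees are at least one, a multiset of total degree `n` has at most `n` elements, all of
  -- degree at most `n`. Hence it lies below `n` copies of the finite set of such indices.
  refine (Set.finite_Iic (n.toNat • hF.toFinset.val)).subset fun s hs => ?_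
  have hs' : (s.map deg).sum = n := hs
  rw [Set.mem_Iic, Multiset.le_iff_count]
  intro i
  by_cases hi : i ∈ s
  · have hin : deg i ≤ n := by
      rw [← hs', ← Multiset.cons_erase hi, Multiset.map_cons, Multiset.sum_cons]
      have := hcard (s.erase i)
      have := Int.natCast_nonneg (s.erase i).card
      linarith
    have h1 : i ∈ hF.toFinset := hF.mem_toFinset.2 hin
    rw [Multiset.count_nsmul, Multiset.count_eq_one_of_mem hF.toFinset.nodup h1, mul_one]
    have h2 := Multiset.count_le_card i s
    have h3 := hcard s
    omega
  · rw [Multiset.count_eq_zero_of_notMem hi]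
    exact Nat.zero_le _

end HomogeneousMonomials

/-! ### Dimension count from nonsingularity of the character -/

section Nonsingular

variable {𝔤 : Type*} [LieRing 𝔤] [LieAlgebra ℂ 𝔤] (𝒢 : ℤ → Submodule ℂ 𝔤) [GradedLieAlgebra 𝒢]
  (χ : LieAlgebra.LieCharacter ℂ (gZero 𝒢))

/-- The projection `x ↦ x₀` as a linear map. -/
def zeroPartLin : 𝔤 →ₗ[ℂ] gZero 𝒢 where
  toFun := zeroPart 𝒢
  map_add' x y := Subtype.ext (by simp [zeroPart])
  map_smul' c x := by
    refine Subtype.ext ?_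
    change ((DirectSum.decompose 𝒢 (c • x) 0 : 𝒢 0) : 𝔤) = c • (DirectSum.decompose 𝒢 x 0 : 𝔤)
    rw [DirectSum.decompose_smul]
    rfl

theorem zeroPartLin_apply (x : 𝔤) : zeroPartLin 𝒢 x = zeroPart 𝒢 x := rfl

theorem zeroPartLin_of_mem {x : 𝔤} (hx : x ∈ 𝒢 0) : zeroPartLin 𝒢 x = ⟨x, hx⟩ :=
  Subtype.ext (DirectSum.decompose_of_mem_same 𝒢 hx)

theorem zeroPartLin_eq_zero {i : ℤ} (hi : i ≠ 0) {x : 𝔤} (hx : x ∈ 𝒢 i) : zeroPartLin 𝒢 x = 0 :=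
  Subtype.ext (DirectSum.decompose_of_mem_ne 𝒢 hx hi)

/-- The linear form `x ↦ λ χ(x₀)` on `𝔤`. -/
def charForm (lam : ℂ) : 𝔤 →ₗ[ℂ] ℂ := lam • ((χ : gZero 𝒢 →ₗ[ℂ] ℂ) ∘ₗ zeroPartLin 𝒢)

theorem charForm_apply (lam : ℂ) (x : 𝔤) : charForm 𝒢 χ lam x = lam * χ (zeroPart 𝒢 x) := rfl

theorem charForm_eq_zero (lam : ℂ) (i : ℤ) (hi : i ≠ 0) (x : 𝔤) (hx : x ∈ 𝒢 i) :
    charForm 𝒢 χ lam x = 0 := by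
  rw [charForm_apply, ← zeroPartLin_apply, zeroPartLin_eq_zero 𝒢 hi hx, map_zero, mul_zero]

instance finiteDimensional_partGrading [∀ i, FiniteDimensional ℂ (𝒢 i)] (S : AddSubsemigroup ℤ)
    (i : ℤ) : FiniteDimensional ℂ (partGrading 𝒢 S i) := by
  let f : partGrading 𝒢 S i →ₗ[ℂ] 𝒢 i :=
    LinearMap.codRestrict (𝒢 i) ((gradedPart 𝒢 S).toSubmodule.subtype ∘ₗ
      (partGrading 𝒢 S i).subtype) (fun x => x.2)
  refine FiniteDimensional.of_injective f fun x y h => ?_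
  exact Subtype.ext (Subtype.ext (congrArg (fun z : 𝒢 i => (z : 𝔤)) h))

/-- An element of `𝒢 i` that pairs to zero with the part of degree `-i` of `⊕_{j ∈ S} 𝒢 j` pairs to
zero with the whole sum. -/
theorem charForm_lie_eq_zero {S : AddSubsemigroup ℤ} (lam : ℂ) {i : ℤ} {u : 𝔤} (hu : u ∈ 𝒢 i)
    (h : ∀ v : gradedPart 𝒢 S, v ∈ partGrading 𝒢 S (-i) → charForm 𝒢 χ lam ⁅u, (v : 𝔤)⁆ = 0)
    {v : 𝔤} (hv : v ∈ gradedPart 𝒢 S) : charForm 𝒢 χ lam ⁅u, v⁆ = 0 := by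
  rw [mem_gradedPart] at hv
  induction hv using Submodule.iSup_induction' with
  | zero => simp
  | add a b _ _ ha hb => rw [lie_add, map_add, ha, hb, add_zero]
  | mem j a ha =>
    by_cases hj : (j : ℤ) = -i
    · exact h ⟨a, mem_gradedPart_of_mem 𝒢 j.2 ha⟩ (hj ▸ ha)
    · exact charForm_eq_zero 𝒢 χ lam (i + j) (by omega) _ (SetLike.GradedBracket.bracket_mem hu ha)

/-- The pairing `(u, v) ↦ χ([u, v]₀)`, restricted to homogeneous components. -/
def gradedPairing (S T : AddSubsemigroup ℤ) (i j : ℤ) :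
    partGrading 𝒢 S i →ₗ[ℂ] partGrading 𝒢 T j →ₗ[ℂ] ℂ :=
  ((LieModule.toEnd ℂ 𝔤 𝔤 : 𝔤 →ₗ[ℂ] Module.End ℂ 𝔤).compr₂ (charForm 𝒢 χ 1)).compl₁₂
    ((gradedPart 𝒢 S).toSubmodule.subtype ∘ₗ (partGrading 𝒢 S i).subtype)
    ((gradedPart 𝒢 T).toSubmodule.subtype ∘ₗ (partGrading 𝒢 T j).subtype)

/-- An element of degree `i` pairs nontrivially only with degree `-i`, so nondegeneracy on one side
embeds the degree `i` part in the dual of the degree `-i` part. -/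
theorem finrank_partGrading_le [∀ i, FiniteDimensional ℂ (𝒢 i)] {S T : AddSubsemigroup ℤ}
    (h : ∀ u ∈ gradedPart 𝒢 S, (∀ v ∈ gradedPart 𝒢 T, charForm 𝒢 χ 1 ⁅u, v⁆ = 0) → u = 0) (i : ℤ) :
    Module.finrank ℂ (partGrading 𝒢 S i) ≤ Module.finrank ℂ (partGrading 𝒢 T (-i)) := by
  rw [← Subspace.dual_finrank_eq (V := partGrading 𝒢 T (-i))]
  refine LinearMap.finrank_le_finrank_of_injective (f := gradedPairing 𝒢 χ S T i (-i)) ?_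
  rw [← LinearMap.ker_eq_bot, LinearMap.ker_eq_bot']
  intro u hu
  refine Subtype.ext (Subtype.ext (h _ u.1.2 fun v hv => ?_))
  refine charForm_lie_eq_zero 𝒢 χ 1 u.2 (fun v hv => ?_) hv
  exact LinearMap.congr_fun hu ⟨v, hv⟩

variable {χ} (hχ : IsNonsingular 𝒢 χ)

include hχ

theorem finrank_partGrading_eq [∀ i, FiniteDimensional ℂ (𝒢 i)] (i : ℤ) :
    Module.finrank ℂ (partGrading 𝒢 posDeg i) = Module.finrank ℂ (partGrading 𝒢 negDeg (-i)) := by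
  refine le_antisymm (finrank_partGrading_le 𝒢 χ (fun u hu h => hχ.1 u hu fun v hv => ?_) i) ?_
  · simpa [charForm_apply] using h v hv
  · have := finrank_partGrading_le 𝒢 χ (S := negDeg) (T := posDeg)
      (fun u hu h => hχ.2 u hu fun v hv => ?_) (-i)
    · rwa [neg_neg] at this
    · have h' := h v hv
      rw [← lie_skew, map_neg, neg_eq_zero] at h'
      simpa [charForm_apply] using h'

/-- The adjoint action of `𝔫₋` on `𝔤` factors through `U 𝔫₋`. An element killed by `ι` therefore
commutes with all of `𝔤`, pairs to zero with `𝔫₊`, and vanishes by nonsingularity. -/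
theorem ι_nMinus_injective : Function.Injective (ι ℂ : nMinus 𝒢 → U (nMinus 𝒢)) := by
  refine (injective_iff_map_eq_zero (ι ℂ : nMinus 𝒢 →ₗ⁅ℂ⁆ U (nMinus 𝒢))).2 fun x hx => ?_
  have h := UniversalEnvelopingAlgebra.lift_ι_apply ℂ
    ((LieAlgebra.ad ℂ 𝔤).comp (nMinus 𝒢).incl) x
  rw [hx, map_zero] at h
  refine Subtype.ext (hχ.2 x x.2 fun u _ => ?_)
  have h' : ⁅(x : 𝔤), u⁆ = 0 := (LinearMap.congr_fun h u).symm
  rw [← lie_skew, h', neg_zero]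
  have := charForm_apply 𝒢 χ 1 (0 : 𝔤)
  rw [map_zero, one_mul] at this
  exact this.symm

/-- One finite set of multisets indexes a spanning family of `(U 𝔫₊)_n` and a basis of `(U
𝔫₋)_{-n}`. The inequality is enough, as the form supplies the reverse one. -/
theorem finiteDimensional_and_finrank_le [∀ i, FiniteDimensional ℂ (𝒢 i)] (n : ℤ) :
    FiniteDimensional ℂ (UPlus 𝒢 n) ∧ FiniteDimensional ℂ (UMinus 𝒢 (-n)) ∧
      Module.finrank ℂ (UPlus 𝒢 n) ≤ Module.finrank ℂ (UMinus 𝒢 (-n)) := by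
  let I := Σ i : ℤ, Fin (Module.finrank ℂ (partGrading 𝒢 posDeg i))
  let b : Module.Basis I ℂ (nPlus 𝒢) :=
    (partGrading_isInternal 𝒢 posDeg).collectedBasis fun i => Module.finBasis ℂ (partGrading 𝒢 posDeg i)
  let J := Σ i : ℤ, Fin (Module.finrank ℂ (partGrading 𝒢 negDeg i))
  let c' : Module.Basis J ℂ (nMinus 𝒢) :=
    (partGrading_isInternal 𝒢 negDeg).collectedBasis fun i => Module.finBasis ℂ (partGrading 𝒢 negDeg i)
  -- Matches basis vectors of degree `i` with basis vectors of degree `-i`, so that both kinds of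
  -- monomials are indexed by multisets of `I`.
  let e : I ≃ J := Equiv.sigmaCongr (Equiv.neg ℤ) fun i => finCongr (finrank_partGrading_eq 𝒢 hχ i)
  let c : Module.Basis I ℂ (nMinus 𝒢) := c'.reindex e.symm
  have hb : ∀ i : I, b i ∈ partGrading 𝒢 posDeg i.1 := fun i =>
    (partGrading_isInternal 𝒢 posDeg).collectedBasis_mem _ i
  have hc : ∀ i : I, c i ∈ partGrading 𝒢 negDeg (-i.1) := fun i => by
    have := (partGrading_isInternal 𝒢 negDeg).collectedBasis_mem
      (fun i => Module.finBasis ℂ (partGrading 𝒢 negDeg i)) (e i)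
    have h : c i = c' (e i) := by simp [c]
    rw [h]
    exact this
  have hpos : ∀ i : I, 0 < i.1 := by
    intro i
    by_contra hi
    have := i.2.pos
    rw [partGrading_eq_bot 𝒢 (S := posDeg) hi] at this
    simp at this
  have hfib : ∀ k : ℤ, {i : I | i.1 = k}.Finite := by
    intro k
    refine (Set.finite_range fun a : Fin (Module.finrank ℂ (partGrading 𝒢 posDeg k)) =>
      (⟨k, a⟩ : I)).subset ?_
    rintro ⟨i, a⟩ rfl
    exact ⟨a, rfl⟩
  have hfinset := finite_multiset_sum_eq (I := I) Sigma.fst hpos hfib n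
  have hneg : ∀ s : Multiset I, (s.map fun i => -i.1).sum = -(s.map Sigma.fst).sum := fun s =>
    Multiset.sum_map_neg
  have h1 : UPlus 𝒢 n = _ := uDeg_eq_span_monomial (partGrading 𝒢 posDeg) b Sigma.fst hb b.span_eq n
  have h2 : UMinus 𝒢 (-n) = _ := uDeg_eq_span_monomial (partGrading 𝒢 negDeg) c (fun i => -i.1) hc c.span_eq (-n)
  simp only [hneg, neg_inj] at h2
  have hli := linearIndependent_monomial (ι_nMinus_injective 𝒢 hχ) c
  have : Fintype {s : Multiset I | (s.map Sigma.fst).sum = n} := hfinset.fintype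
  have hf1 : FiniteDimensional ℂ (UPlus 𝒢 n) := by
    rw [h1]; exact FiniteDimensional.span_of_finite ℂ (hfinset.image _)
  have hf2 : FiniteDimensional ℂ (UMinus 𝒢 (-n)) := by
    rw [h2]; exact FiniteDimensional.span_of_finite ℂ (hfinset.image _)
  refine ⟨hf1, hf2, ?_⟩
  rw [h1, h2, Set.image_eq_range, Set.image_eq_range]
  exact (finrank_range_le_card _).trans_eq (finrank_span_eq_card
    (hli.comp (fun s : {s : Multiset I | (s.map Sigma.fst).sum = n} => (s : Multiset I))
      Subtype.val_injective)).symm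

end Nonsingular

/-! ### The triangular projection -/

section TriangularProjection

variable {𝔤 : Type*} [LieRing 𝔤] [LieAlgebra ℂ 𝔤] (𝒢 : ℤ → Submodule ℂ 𝔤) [GradedLieAlgebra 𝒢]
  (χ : LieAlgebra.LieCharacter ℂ (gZero 𝒢)) (lam : ℂ)

/-- The semigroup of nonpositive degrees. -/
def nonposDeg : AddSubsemigroup ℤ where
  carrier := {i | i ≤ 0}
  add_mem' := fun {a b} (ha : a ≤ 0) (hb : b ≤ 0) => add_nonpos ha hb

/-- `𝔭₋ = ⊕_{i ≤ 0} 𝔤_i`. -/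
abbrev pMinus : LieSubalgebra ℂ 𝔤 := gradedPart 𝒢 nonposDeg

theorem negDeg_compl (i : ℤ) : i ∈ negDeg ↔ i ∉ nonnegDeg := by
  change i < 0 ↔ ¬ 0 ≤ i
  omega

theorem posDeg_compl (i : ℤ) : i ∈ posDeg ↔ i ∉ nonposDeg := by
  change 0 < i ↔ ¬ i ≤ 0
  omega

/-- Induction on elements of a graded part. -/
theorem gradedPart_induction {S : AddSubsemigroup ℤ} {P : 𝔤 → Prop}
    (mem : ∀ i ∈ S, ∀ x ∈ 𝒢 i, P x) (zero : P 0) (add : ∀ x y, P x → P y → P (x + y)) {x : 𝔤}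
    (hx : x ∈ gradedPart 𝒢 S) : P x := by
  rw [mem_gradedPart] at hx
  induction hx using Submodule.iSup_induction' with
  | zero => exact zero
  | add a b _ _ ha hb => exact add a b ha hb
  | mem j a ha => exact mem j j.2 a ha

theorem zeroPartLin_eq_zero_of_mem {S : AddSubsemigroup ℤ} (hS : (0 : ℤ) ∉ S) {x : 𝔤}
    (hx : x ∈ gradedPart 𝒢 S) : zeroPartLin 𝒢 x = 0 :=
  gradedPart_induction 𝒢 (P := fun x => zeroPartLin 𝒢 x = 0)
    (fun i hi _ hx => zeroPartLin_eq_zero 𝒢 (fun h => hS (h ▸ hi)) hx) (map_zero _)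
    (fun x y hx hy => by rw [map_add, hx, hy, add_zero]) hx

theorem charForm_eq_zero_of_mem {S : AddSubsemigroup ℤ} (hS : (0 : ℤ) ∉ S) {x : 𝔤}
    (hx : x ∈ gradedPart 𝒢 S) : charForm 𝒢 χ lam x = 0 := by
  rw [charForm_apply, ← zeroPartLin_apply, zeroPartLin_eq_zero_of_mem 𝒢 hS hx, map_zero, mul_zero]

theorem zero_notMem_posDeg : (0 : ℤ) ∉ posDeg := lt_irrefl (0 : ℤ)

theorem zero_notMem_negDeg : (0 : ℤ) ∉ negDeg := lt_irrefl (0 : ℤ)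

/-- Two degrees in `S` cancel only if both are zero, so the degree zero part of a bracket comes from
the degree zero parts alone. Used for `𝔭₊` and `𝔭₋`. -/
theorem zeroPartLin_lie {S : AddSubsemigroup ℤ} (hS : ∀ i ∈ S, ∀ j ∈ S, i + j = 0 → i = 0)
    {x y : 𝔤} (hx : x ∈ gradedPart 𝒢 S) (hy : y ∈ gradedPart 𝒢 S) :
    zeroPartLin 𝒢 ⁅x, y⁆ = ⁅zeroPartLin 𝒢 x, zeroPartLin 𝒢 y⁆ := by
  refine gradedPart_induction 𝒢
    (P := fun x => zeroPartLin 𝒢 ⁅x, y⁆ = ⁅zeroPartLin 𝒢 x, zeroPartLin 𝒢 y⁆)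
    (fun i hi x hx => ?_) (by simp) (fun a b ha hb => by simp [ha, hb]) hx
  refine gradedPart_induction 𝒢
    (P := fun y => zeroPartLin 𝒢 ⁅x, y⁆ = ⁅zeroPartLin 𝒢 x, zeroPartLin 𝒢 y⁆)
    (fun j hj y hy => ?_) (by simp) (fun a b ha hb => by simp [ha, hb]) hy
  have hxy : ⁅x, y⁆ ∈ 𝒢 (i + j) := SetLike.GradedBracket.bracket_mem hx hy
  by_cases hij : i + j = 0
  · have hi0 := hS i hi j hj hij
    have hj0 : j = 0 := by omega
    subst hi0 hj0
    rw [zeroPartLin_of_mem 𝒢 hx, zeroPartLin_of_mem 𝒢 hy, zeroPartLin_of_mem 𝒢 (hij ▸ hxy)]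
    rfl
  · rw [zeroPartLin_eq_zero 𝒢 hij hxy]
    by_cases hi0 : i = 0
    · rw [zeroPartLin_eq_zero 𝒢 (show j ≠ 0 by omega) hy, lie_zero]
    · rw [zeroPartLin_eq_zero 𝒢 hi0 hx, zero_lie]

theorem nonnegDeg_add_eq_zero (i : ℤ) (hi : i ∈ nonnegDeg) (j : ℤ) (hj : j ∈ nonnegDeg)
    (h : i + j = 0) : i = 0 := by
  have h1 : 0 ≤ i := hi
  have h2 : 0 ≤ j := hj
  omega

theorem nonposDeg_add_eq_zero (i : ℤ) (hi : i ∈ nonposDeg) (j : ℤ) (hj : j ∈ nonposDeg)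
    (h : i + j = 0) : i = 0 := by
  have h1 : i ≤ 0 := hi
  have h2 : j ≤ 0 := hj
  omega

theorem charForm_lie {S : AddSubsemigroup ℤ} (hS : ∀ i ∈ S, ∀ j ∈ S, i + j = 0 → i = 0)
    (x : 𝔤) (hx : x ∈ gradedPart 𝒢 S) (y : 𝔤) (hy : y ∈ gradedPart 𝒢 S) :
    charForm 𝒢 χ lam ⁅x, y⁆ = 0 := by
  rw [charForm_apply, ← zeroPartLin_apply, zeroPartLin_lie 𝒢 hS hx hy,
    LieAlgebra.lieCharacter_apply_lie, mul_zero]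

/-- The action of `U 𝔤` on the Verma module `M⁺_λ`, identified with `U 𝔫₋`. -/
def actMinus : U 𝔤 →ₐ[ℂ] Module.End ℂ (U (nMinus 𝒢)) :=
  charAct (isCompl_gradedPart 𝒢 negDeg_compl) (charForm 𝒢 χ lam)
    (charForm_lie 𝒢 χ lam nonnegDeg_add_eq_zero)

/-- The action of `U 𝔤` on the opposite Verma module `M⁻_{-λ}`, identified with `U 𝔫₊`. -/
def actPlus : U 𝔤 →ₐ[ℂ] Module.End ℂ (U (nPlus 𝒢)) :=
  charAct (isCompl_gradedPart 𝒢 posDeg_compl) (charForm 𝒢 χ (-lam))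
    (charForm_lie 𝒢 χ (-lam) nonposDeg_add_eq_zero)

theorem actMinus_incl (u v : U (nMinus 𝒢)) : actMinus 𝒢 χ lam (incl _ u) v = u * v :=
  charAct_incl _ _ _ u v

theorem actMinus_ι_mul (g : 𝔤) (a : nMinus 𝒢) (u : U (nMinus 𝒢)) :
    actMinus 𝒢 χ lam (ι ℂ g) (ι ℂ a * u) =
      actMinus 𝒢 χ lam (ι ℂ ⁅g, (a : 𝔤)⁆) u + ι ℂ a * actMinus 𝒢 χ lam (ι ℂ g) u := by
  simp only [actMinus, charAct_ι, charRep_ι_mul]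

theorem actMinus_left (a : nMinus 𝒢) (u : U (nMinus 𝒢)) :
    actMinus 𝒢 χ lam (ι ℂ (a : 𝔤)) u = ι ℂ a * u := by
  rw [actMinus, charAct_ι, charRep_left]

theorem actPlus_left (a : nPlus 𝒢) (u : U (nPlus 𝒢)) :
    actPlus 𝒢 χ lam (ι ℂ (a : 𝔤)) u = ι ℂ a * u := by
  rw [actPlus, charAct_ι, charRep_left]

theorem actMinus_one {g : 𝔤} (hg : g ∈ pPlus 𝒢) :
    actMinus 𝒢 χ lam (ι ℂ g) 1 = algebraMap ℂ _ (charForm 𝒢 χ lam g) := by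
  rw [actMinus, charAct_ι, charRep_right_one _ _ _ hg]

theorem actMinus_mem_uDeg {i j k : ℤ} (hk : i + j = k) {a : U 𝔤} (ha : a ∈ uDeg 𝒢 i)
    {u : U (nMinus 𝒢)} (hu : u ∈ UMinus 𝒢 j) : actMinus 𝒢 χ lam a u ∈ UMinus 𝒢 k :=
  charAct_mem_uDeg 𝒢 _ negDeg_compl _ _ (charForm_eq_zero 𝒢 χ lam) hk ha hu

theorem actPlus_mem_uDeg {i j k : ℤ} (hk : i + j = k) {a : U 𝔤} (ha : a ∈ uDeg 𝒢 i)
    {u : U (nPlus 𝒢)} (hu : u ∈ UPlus 𝒢 j) : actPlus 𝒢 χ lam a u ∈ UPlus 𝒢 k :=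
  charAct_mem_uDeg 𝒢 _ posDeg_compl _ _ (charForm_eq_zero 𝒢 χ (-lam)) hk ha hu

/-- The map `x ↦ (z ↦ x₀ z)` from `𝔤` to endomorphisms of `U 𝔤₀`. -/
def zeroPartMul : 𝔤 →ₗ[ℂ] Module.End ℂ (U (gZero 𝒢)) :=
  LinearMap.mul ℂ (U (gZero 𝒢)) ∘ₗ (ι ℂ : gZero 𝒢 →ₗ⁅ℂ⁆ U (gZero 𝒢)).toLinearMap ∘ₗ zeroPartLin 𝒢

theorem zeroPartMul_apply (x : 𝔤) (z : U (gZero 𝒢)) :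
    zeroPartMul 𝒢 x z = ι ℂ (zeroPartLin 𝒢 x) * z := rfl

theorem zeroPartMul_lie (x : 𝔤) (hx : x ∈ pPlus 𝒢) (y : 𝔤) (hy : y ∈ pPlus 𝒢) :
    zeroPartMul 𝒢 ⁅x, y⁆ =
      zeroPartMul 𝒢 x * zeroPartMul 𝒢 y - zeroPartMul 𝒢 y * zeroPartMul 𝒢 x := by
  refine LinearMap.ext fun z => ?_
  simp only [LinearMap.sub_apply, Module.End.mul_apply, zeroPartMul_apply,
    zeroPartLin_lie 𝒢 nonnegDeg_add_eq_zero hx hy, ι_lie, sub_mul, mul_assoc]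

/-- The action of `U 𝔤` on `U 𝔫₋ ⊗ U 𝔤₀`, the universal Verma module. -/
def universalAct : U 𝔤 →ₐ[ℂ] Module.End ℂ (U (nMinus 𝒢) ⊗[ℂ] U (gZero 𝒢)) :=
  UniversalEnvelopingAlgebra.lift ℂ
    (induced (isCompl_gradedPart 𝒢 negDeg_compl) (zeroPartMul 𝒢) (zeroPartMul_lie 𝒢))

theorem universalAct_ι (g : 𝔤) : universalAct 𝒢 (ι ℂ g) =
    inducedLin (isCompl_gradedPart 𝒢 negDeg_compl) (zeroPartMul 𝒢) g :=
  UniversalEnvelopingAlgebra.lift_ι_apply ℂ _ g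

theorem gZero_le_pPlus (z : gZero 𝒢) : (z : 𝔤) ∈ pPlus 𝒢 :=
  mem_gradedPart_of_mem 𝒢 (S := nonnegDeg) (le_refl (0 : ℤ)) z.2

theorem nPlus_le_pPlus {x : 𝔤} (hx : x ∈ nPlus 𝒢) : x ∈ pPlus 𝒢 :=
  gradedPart_induction 𝒢 (P := fun x => x ∈ pPlus 𝒢)
    (fun i hi _ hx => mem_gradedPart_of_mem 𝒢 (S := nonnegDeg) (le_of_lt (show 0 < i from hi)) hx)
    (zero_mem _) (fun _ _ hx hy => add_mem hx hy) hx

theorem universalAct_incl_one (z : U (gZero 𝒢)) :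
    universalAct 𝒢 (incl _ z) (1 ⊗ₜ 1) = 1 ⊗ₜ z := by
  induction z using induction_left with
  | one => simp
  | zero => simp
  | add x y hx hy => simp [hx, hy, TensorProduct.tmul_add]
  | smul c x hx => simp [hx]
  | mul x z hz =>
    rw [map_mul, map_mul, Module.End.mul_apply, hz, incl_ι, universalAct_ι,
      inducedLin_right_one_tmul _ _ (gZero_le_pPlus 𝒢 x), zeroPartMul_apply, zeroPartLin_of_mem 𝒢 x.2]

theorem counit_leftAction {L W : Type*} [LieRing L] [LieAlgebra ℂ L] {A : LieSubalgebra ℂ L}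
    [AddCommGroup W] [Module ℂ W] (a : A) (m : U A ⊗[ℂ] W) :
    TensorProduct.map (counit A).toLinearMap LinearMap.id (leftAction A W (ι ℂ a) m) = 0 := by
  induction m using TensorProduct.induction_on with
  | zero => simp
  | add x y hx hy => simp [hx, hy]
  | tmul u w => simp

/-- Let `a` act on the generator of the universal Verma module `U 𝔫₋ ⊗ U 𝔤₀`, then apply the counit
to the first factor. The counit kills what starts with `𝔫₋`, and `𝔫₊` kills the generator. -/
theorem exists_isTriangularProjection :
    ∃ φ : U 𝔤 →ₗ[ℂ] U (gZero 𝒢), IsTriangularProjection 𝒢 φ := by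
  refine ⟨(TensorProduct.lid ℂ _).toLinearMap ∘ₗ
    TensorProduct.map (counit (nMinus 𝒢)).toLinearMap LinearMap.id ∘ₗ
    LinearMap.flip (universalAct 𝒢).toLinearMap (1 ⊗ₜ 1), fun z => ?_, fun x hx a => ?_,
    fun a x hx => ?_⟩
  · simp [universalAct_incl_one]
  · have h := inducedLin_left (isCompl_gradedPart 𝒢 negDeg_compl) (zeroPartMul 𝒢) ⟨x, hx⟩
      (universalAct 𝒢 a (1 ⊗ₜ 1))
    simp only at h
    simp [universalAct_ι, h, counit_leftAction]
  · simp [universalAct_ι, inducedLin_right_one_tmul _ _ (nPlus_le_pPlus 𝒢 hx), zeroPartMul_apply,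
      zeroPartLin_eq_zero_of_mem 𝒢 zero_notMem_posDeg hx]

theorem isTriangularProjection_triangularProjection :
    IsTriangularProjection 𝒢 (triangularProjection 𝒢) := by
  rw [triangularProjection, dif_pos (exists_isTriangularProjection 𝒢)]
  exact (exists_isTriangularProjection 𝒢).choose_spec

/-- The left ideal `U 𝔤 · 𝔫₊`. -/
def leftIdealPlus : Submodule (U 𝔤) (U 𝔤) := Submodule.span (U 𝔤) (ι ℂ '' (nPlus 𝒢 : Set 𝔤))

theorem mul_mem_leftIdealPlus (a : U 𝔤) {b : U 𝔤} (hb : b ∈ leftIdealPlus 𝒢) :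
    a * b ∈ leftIdealPlus 𝒢 := (leftIdealPlus 𝒢).smul_mem a hb

theorem ι_mem_leftIdealPlus {x : 𝔤} (hx : x ∈ nPlus 𝒢) : ι ℂ x ∈ leftIdealPlus 𝒢 :=
  Submodule.subset_span ⟨x, hx, rfl⟩

theorem lie_mem_of_forall {S T R : AddSubsemigroup ℤ} (h : ∀ i ∈ S, ∀ j ∈ T, i + j ∈ R) {x y : 𝔤}
    (hx : x ∈ gradedPart 𝒢 S) (hy : y ∈ gradedPart 𝒢 T) : ⁅x, y⁆ ∈ gradedPart 𝒢 R := by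
  refine gradedPart_induction 𝒢 (P := fun x => ⁅x, y⁆ ∈ gradedPart 𝒢 R)
    (fun i hi x hx => ?_) (by simp) (fun a b ha hb => by rw [add_lie]; exact add_mem ha hb) hx
  exact gradedPart_induction 𝒢 (P := fun y => ⁅x, y⁆ ∈ gradedPart 𝒢 R)
    (fun j hj y hy => mem_gradedPart_of_mem 𝒢 (h i hi j hj) (SetLike.GradedBracket.bracket_mem hx hy))
    (by simp) (fun a b ha hb => by rw [lie_add]; exact add_mem ha hb) hy

theorem ι_mul_incl_gZero_mem {x : 𝔤} (hx : x ∈ nPlus 𝒢) (z : U (gZero 𝒢)) :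
    ι ℂ x * incl _ z ∈ leftIdealPlus 𝒢 := by
  induction z using induction_left generalizing x with
  | one => rw [map_one, mul_one]; exact ι_mem_leftIdealPlus 𝒢 hx
  | zero => simp
  | add y z hy hz => rw [map_add, mul_add]; exact add_mem (hy hx) (hz hx)
  | smul c y hy =>
    rw [map_smul, mul_smul_comm]; exact Submodule.smul_of_tower_mem _ c (hy hx)
  | mul y z hz =>
    have h1 : ⁅x, (y : 𝔤)⁆ ∈ nPlus 𝒢 :=
      lie_mem_of_forall 𝒢 (T := nonnegDeg) (fun i (hi : 0 < i) j (hj : 0 ≤ j) =>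
        show 0 < i + j by omega) hx (gZero_le_pPlus 𝒢 y)
    have h2 : ι ℂ x * ι ℂ (y : 𝔤) = ι ℂ ⁅x, (y : 𝔤)⁆ + ι ℂ (y : 𝔤) * ι ℂ x := by
      rw [ι_lie, sub_add_cancel]
    rw [map_mul, incl_ι, ← mul_assoc, h2, add_mul, mul_assoc]
    exact add_mem (hz h1) (mul_mem_leftIdealPlus 𝒢 _ (hz hx))

/-- The multiplication map `U 𝔫₋ ⊗ U 𝔤₀ → U 𝔤`. -/
def mulMinusZero : U (nMinus 𝒢) ⊗[ℂ] U (gZero 𝒢) →ₗ[ℂ] U 𝔤 :=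
  TensorProduct.lift ((LinearMap.mul ℂ (U 𝔤)).compl₁₂ (incl (nMinus 𝒢)).toLinearMap
    (incl (gZero 𝒢)).toLinearMap)

@[simp]
theorem mulMinusZero_tmul (u : U (nMinus 𝒢)) (z : U (gZero 𝒢)) :
    mulMinusZero 𝒢 (u ⊗ₜ z) = incl _ u * incl _ z := rfl

theorem mulMinusZero_leftAction (a : nMinus 𝒢) (t : U (nMinus 𝒢) ⊗[ℂ] U (gZero 𝒢)) :
    mulMinusZero 𝒢 (leftAction _ _ (ι ℂ a) t) = ι ℂ (a : 𝔤) * mulMinusZero 𝒢 t := by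
  induction t using TensorProduct.induction_on with
  | zero => simp
  | add x y hx hy => simp only [map_add, hx, hy, mul_add]
  | tmul u z => simp [mul_assoc]

/-- Multiplication `U 𝔫₋ ⊗ U 𝔤₀ → U 𝔤` is `𝔤`-equivariant modulo `U 𝔤 · 𝔫₊`. On `1 ⊗ w` the
discrepancy is `(b - b₀) w` with `b - b₀` in `𝔫₊`, and `𝔫₊` can be moved past `U 𝔤₀`. -/
theorem ι_mul_sub_mulMinusZero_mem (g : 𝔤) (t : U (nMinus 𝒢) ⊗[ℂ] U (gZero 𝒢)) :
    ι ℂ g * mulMinusZero 𝒢 t - mulMinusZero 𝒢 (universalAct 𝒢 (ι ℂ g) t) ∈ leftIdealPlus 𝒢 := by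
  rw [universalAct_ι]
  induction t using tmul_induction generalizing g with
  | one w =>
    obtain ⟨a, b, hab, -⟩ := Submodule.existsUnique_add_of_isCompl
      (isCompl_gradedPart 𝒢 negDeg_compl) g
    have h1 := inducedLin_left (isCompl_gradedPart 𝒢 negDeg_compl) (zeroPartMul 𝒢) (⟨a, a.2⟩ : nMinus 𝒢)
      (1 ⊗ₜ w)
    simp only [leftAction_tmul, mul_one] at h1
    have hb : (b : 𝔤) - zeroPartLin 𝒢 b ∈ nPlus 𝒢 := by
      refine gradedPart_induction 𝒢 (S := nonnegDeg)
        (P := fun b => b - (zeroPartLin 𝒢 b : 𝔤) ∈ nPlus 𝒢) (fun i hi x hx => ?_) (by simp)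
        (fun x y hx hy => ?_) b.2
      · by_cases h0 : i = 0
        · subst h0
          rw [zeroPartLin_of_mem 𝒢 hx, sub_self]
          exact zero_mem _
        · rw [zeroPartLin_eq_zero 𝒢 h0 hx, ZeroMemClass.coe_zero, sub_zero]
          exact mem_gradedPart_of_mem 𝒢 (S := posDeg) (lt_of_le_of_ne (show 0 ≤ i from hi) (Ne.symm h0)) hx
      · rw [map_add, AddMemClass.coe_add, add_sub_add_comm]
        exact add_mem hx hy
    rw [← hab, map_add, map_add, LinearMap.add_apply, h1, inducedLin_right_one_tmul _ _ b.2]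
    have h3 := ι_mul_incl_gZero_mem 𝒢 hb w
    rw [map_sub, sub_mul] at h3
    convert h3 using 1
    simp [zeroPartMul_apply, add_mul]
  | zero => simp
  | add x y hx hy =>
    rw [map_add, map_add, map_add, mul_add, add_sub_add_comm]
    exact add_mem (hx g) (hy g)
  | smul c x hx =>
    rw [map_smul, map_smul, map_smul, mul_smul_comm, ← smul_sub]
    exact Submodule.smul_of_tower_mem _ c (hx g)
  | mul a t ht =>
    rw [inducedLin_ι_smul, map_add, mulMinusZero_leftAction, mulMinusZero_leftAction]
    have h := add_mem (ht ⁅g, (a : 𝔤)⁆) (mul_mem_leftIdealPlus 𝒢 (ι ℂ (a : 𝔤)) (ht g))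
    convert h using 1
    rw [ι_lie]
    noncomm_ring

/-- `U 𝔤 = U 𝔫₋ · U 𝔤₀ + U 𝔤 · 𝔫₊`. -/
theorem sub_mulMinusZero_mem (a : U 𝔤) :
    a - mulMinusZero 𝒢 (universalAct 𝒢 a (1 ⊗ₜ 1)) ∈ leftIdealPlus 𝒢 := by
  induction a using induction_left with
  | one => simp
  | zero => simp
  | add x y hx hy =>
    rw [map_add, LinearMap.add_apply, map_add, add_sub_add_comm]
    exact add_mem hx hy
  | smul c x hx =>
    rw [map_smul, LinearMap.smul_apply, map_smul, ← smul_sub]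
    exact Submodule.smul_of_tower_mem _ c hx
  | mul g a ha =>
    rw [map_mul, Module.End.mul_apply]
    have h := add_mem (mul_mem_leftIdealPlus 𝒢 (ι ℂ g) ha)
      (ι_mul_sub_mulMinusZero_mem 𝒢 g (universalAct 𝒢 a (1 ⊗ₜ 1)))
    rwa [mul_sub, sub_add_sub_cancel] at h

/-- The linear form on `U 𝔤` given by the coefficient of the generating vector of `M⁺_λ`. -/
def vacuum : U 𝔤 →ₗ[ℂ] ℂ :=
  (counit (nMinus 𝒢)).toLinearMap ∘ₗ LinearMap.flip (actMinus 𝒢 χ lam).toLinearMap 1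

theorem vacuum_apply (a : U 𝔤) : vacuum 𝒢 χ lam a = counit _ (actMinus 𝒢 χ lam a 1) := rfl

theorem actMinus_one_eq_zero {a : U 𝔤} (ha : a ∈ leftIdealPlus 𝒢) : actMinus 𝒢 χ lam a 1 = 0 := by
  induction ha using Submodule.span_induction with
  | mem a h =>
    obtain ⟨x, hx, rfl⟩ := h
    rw [actMinus_one _ _ _ (nPlus_le_pPlus 𝒢 hx),
      charForm_eq_zero_of_mem 𝒢 χ lam zero_notMem_posDeg hx, map_zero]
  | zero => simp
  | add x y _ _ hx hy => simp [hx, hy]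
  | smul c x _ hx => simp [hx]

theorem actMinus_incl_gZero_one (z : U (gZero 𝒢)) :
    actMinus 𝒢 χ lam (incl _ z) 1 = algebraMap ℂ _ (chiU 𝒢 χ lam z) := by
  induction z using induction_left with
  | one => simp
  | zero => simp
  | add x y hx hy => simp [hx, hy]
  | smul c x hx => simp [hx, Algebra.smul_def]
  | mul x z hz =>
    have h : chiU 𝒢 χ lam (ι ℂ x) = charForm 𝒢 χ lam x := by
      refine (UniversalEnvelopingAlgebra.lift_ι_apply ℂ _ x).trans ?_
      rw [charForm_apply, ← zeroPartLin_apply, zeroPartLin_of_mem 𝒢 x.2]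
      rfl
    rw [map_mul, map_mul, Module.End.mul_apply, hz, incl_ι, Algebra.algebraMap_eq_smul_one, map_smul,
      actMinus_one _ _ _ (gZero_le_pPlus 𝒢 x), map_mul, h, map_mul, Algebra.algebraMap_eq_smul_one,
      Algebra.algebraMap_eq_smul_one, smul_mul_smul_comm, smul_smul, mul_one, mul_comm]

/-- Both linear forms kill `U 𝔤 · 𝔫₊` and agree on `U 𝔫₋ · U 𝔤₀`, and these two subspaces span. The
form can thus be computed inside the Verma module, whichever projection was chosen. -/
theorem chiU_triangularProjection (a : U 𝔤) :
    chiU 𝒢 χ lam (triangularProjection 𝒢 a) = vacuum 𝒢 χ lam a := by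
  obtain ⟨h1, h2, h3⟩ := isTriangularProjection_triangularProjection 𝒢
  have hJ : ∀ b ∈ leftIdealPlus 𝒢, ∀ c : U 𝔤, triangularProjection 𝒢 (c * b) = 0 := by
    intro b hb
    induction hb using Submodule.span_induction with
    | mem b h => obtain ⟨x, hx, rfl⟩ := h; exact fun c => h3 c x hx
    | zero => simp
    | add x y _ _ hx hy => intro c; rw [mul_add, map_add, hx, hy, add_zero]
    | smul d x _ hx => intro c; rw [smul_eq_mul, ← mul_assoc, hx]
  have hT : ∀ (u : U (nMinus 𝒢)) (z : U (gZero 𝒢)),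
      triangularProjection 𝒢 (incl _ u * incl _ z) = counit _ u • z := by
    intro u z
    induction u using induction_left with
    | one => simp [h1]
    | zero => simp
    | add x y hx hy => simp only [map_add, add_mul, hx, hy, add_smul]
    | smul c x hx => simp only [map_smul, smul_mul_assoc, hx, smul_eq_mul, mul_smul]
    | mul x u _ => rw [map_mul (incl _), incl_ι, mul_assoc, h2 _ x.2, map_mul, counit_ι, zero_mul, zero_smul]
  have key : ∀ t, chiU 𝒢 χ lam (triangularProjection 𝒢 (mulMinusZero 𝒢 t)) =
      vacuum 𝒢 χ lam (mulMinusZero 𝒢 t) := by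
    intro t
    induction t using TensorProduct.induction_on with
    | zero => simp
    | add x y hx hy => simp only [map_add, hx, hy]
    | tmul u z =>
      rw [mulMinusZero_tmul, hT, vacuum_apply, map_mul, Module.End.mul_apply,
        actMinus_incl_gZero_one, actMinus_incl]
      simp
  have hsub := sub_mulMinusZero_mem 𝒢 a
  have e1 := hJ _ hsub 1
  rw [one_mul, map_sub, sub_eq_zero] at e1
  have e2 : vacuum 𝒢 χ lam (a - mulMinusZero 𝒢 (universalAct 𝒢 a (1 ⊗ₜ 1))) = 0 := by
    rw [vacuum_apply, actMinus_one_eq_zero 𝒢 χ lam hsub, map_zero]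
  rw [map_sub, sub_eq_zero] at e2
  rw [e1, e2, key]

theorem shapovalov_eq_vacuum (x : U (nMinus 𝒢)) (y : U (nPlus 𝒢)) :
    shapovalov 𝒢 χ lam x y =
      vacuum 𝒢 χ lam (antipode 𝔤 (incl (nPlus 𝒢) y) * incl (nMinus 𝒢) x) := by
  rw [shapovalov_apply, chiU_triangularProjection]

end TriangularProjection

/-! ### Invariance and nondegeneracy of the Shapovalov pairing -/

section DualAction

variable (L : Type*) [LieRing L] [LieAlgebra ℂ L]

/-- The action of `U L` on its dual, `(c f)(a) = f(S(c) a)`. -/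
def dualAct : U L →ₐ[ℂ] Module.End ℂ (U L →ₗ[ℂ] ℂ) :=
  UniversalEnvelopingAlgebra.lift ℂ
    { toFun := fun x => -LinearMap.lcomp ℂ ℂ (LinearMap.mulLeft ℂ (ι ℂ x : U L))
      map_add' := fun x y => by ext f a; simp [add_mul]; abel
      map_smul' := fun c x => by ext f a; simp
      map_lie' := fun {x y} => by
        ext f a
        simp [LieRing.of_associative_ring_bracket, sub_mul, mul_assoc] }

variable {L}

theorem dualAct_apply (c : U L) (f : U L →ₗ[ℂ] ℂ) (a : U L) :
    dualAct L c f a = f (antipode L c * a) := by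
  induction c using induction_left generalizing f a with
  | one => simp
  | zero => simp
  | add x y hx hy => simp [hx, hy, add_mul]
  | smul c x hx => simp [hx]
  | mul x c hc =>
    have h : ∀ (f : U L →ₗ[ℂ] ℂ) a, dualAct L (ι ℂ x) f a = f (-ι ℂ x * a) := by
      intro f a
      rw [dualAct, UniversalEnvelopingAlgebra.lift_ι_apply]
      simp
    rw [map_mul, Module.End.mul_apply, h, hc, antipode_mul, antipode_ι, mul_assoc]

theorem antipode_antipode (u : U L) : antipode L (antipode L u) = u := by
  induction u using induction_left with
  | one => simp
  | zero => simp
  | add x y hx hy => simp [hx, hy]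
  | smul c x hx => simp [hx]
  | mul x u hu => rw [antipode_mul, antipode_mul, hu, antipode_ι, map_neg, antipode_ι, neg_neg]

end DualAction

section Invariance

variable {𝔤 : Type*} [LieRing 𝔤] [LieAlgebra ℂ 𝔤] (𝒢 : ℤ → Submodule ℂ 𝔤) [GradedLieAlgebra 𝒢]
  (χ : LieAlgebra.LieCharacter ℂ (gZero 𝒢)) (lam : ℂ)

theorem charForm_neg (x : 𝔤) : charForm 𝒢 χ (-lam) x = -charForm 𝒢 χ lam x := by
  rw [charForm_apply, charForm_apply, neg_mul]

/-- The counit is a vector of weight `λχ` for this action of `𝔭₋`: elements of `𝔫₋` land in the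
augmentation ideal, and brackets of `𝔭₋` with `𝔫₋` stay in `𝔫₋`, so they contribute nothing. -/
theorem counit_actMinus {b : 𝔤} (hb : b ∈ pMinus 𝒢) (u : U (nMinus 𝒢)) :
    counit _ (actMinus 𝒢 χ lam (ι ℂ b) u) = charForm 𝒢 χ lam b * counit _ u := by
  have hneg : ∀ {b : 𝔤} (hb : b ∈ nMinus 𝒢) (u : U (nMinus 𝒢)),
      counit _ (actMinus 𝒢 χ lam (ι ℂ b) u) = 0 := by
    intro b hb u
    have h := actMinus_left 𝒢 χ lam ⟨b, hb⟩ u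
    simp only at h
    rw [h, map_mul, counit_ι, zero_mul]
  induction u using induction_left generalizing b with
  | one =>
    refine gradedPart_induction 𝒢 (S := nonposDeg) (P := fun b =>
      counit _ (actMinus 𝒢 χ lam (ι ℂ b) 1) = charForm 𝒢 χ lam b * counit _ 1)
      (fun i hi x hx => ?_) (by simp) (fun x y hx hy => by simp [hx, hy]) hb
    by_cases h0 : i = 0
    · subst h0
      rw [actMinus_one 𝒢 χ lam (gZero_le_pPlus 𝒢 ⟨x, hx⟩)]
      simp
    · rw [hneg (mem_gradedPart_of_mem 𝒢 (S := negDeg) (lt_of_le_of_ne (show i ≤ 0 from hi) h0) hx),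
        charForm_eq_zero 𝒢 χ lam i h0 x hx, zero_mul]
  | zero => simp
  | add x y hx hy => simp [hx hb, hy hb, mul_add]
  | smul c x hx => simp [hx hb, mul_left_comm]
  | mul a u _ =>
    have h1 : ⁅b, (a : 𝔤)⁆ ∈ nMinus 𝒢 :=
      lie_mem_of_forall 𝒢 (S := nonposDeg) (T := negDeg) (R := negDeg)
        (fun i (hi : i ≤ 0) j (hj : j < 0) => show i + j < 0 by omega) hb a.2
    rw [actMinus_ι_mul, map_add, hneg h1]
    simp

theorem vacuum_ι_mul {b : 𝔤} (hb : b ∈ pMinus 𝒢) (a : U 𝔤) :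
    vacuum 𝒢 χ lam (ι ℂ b * a) = charForm 𝒢 χ lam b * vacuum 𝒢 χ lam a := by
  rw [vacuum_apply, map_mul, Module.End.mul_apply, counit_actMinus _ _ _ hb, vacuum_apply]

theorem vacuum_mul_ι {b : 𝔤} (hb : b ∈ pPlus 𝒢) (a : U 𝔤) :
    vacuum 𝒢 χ lam (a * ι ℂ b) = charForm 𝒢 χ lam b * vacuum 𝒢 χ lam a := by
  rw [vacuum_apply, map_mul, Module.End.mul_apply, actMinus_one _ _ _ hb,
    Algebra.algebraMap_eq_smul_one, map_smul, map_smul, smul_eq_mul, vacuum_apply]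

theorem vacuum_one : vacuum 𝒢 χ lam 1 = 1 := by simp [vacuum_apply]

/-- In the dual of `U 𝔤`, `𝔭₋` acts on `vacuum` through `-λχ`, the sign coming from the antipode.
The universal property of `M⁻_{-λ}` then gives an equivariant map into this dual. -/
theorem vacuum_antipode_actPlus (c a : U 𝔤) (y : U (nPlus 𝒢)) :
    vacuum 𝒢 χ lam (antipode 𝔤 (incl _ (actPlus 𝒢 χ lam c y)) * a) =
      vacuum 𝒢 χ lam (antipode 𝔤 (incl _ y) * (antipode 𝔤 c * a)) := by
  have h := incl_charAct_apply (isCompl_gradedPart 𝒢 posDeg_compl) (charForm 𝒢 χ (-lam))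
    (charForm_lie 𝒢 χ (-lam) nonposDeg_add_eq_zero) (dualAct 𝔤) (w := vacuum 𝒢 χ lam)
    (fun b hb => ?_) c y
  · have h' := LinearMap.congr_fun h a
    rwa [dualAct_apply, dualAct_apply, dualAct_apply] at h'
  · ext a
    rw [dualAct_apply, antipode_ι, neg_mul, map_neg, vacuum_ι_mul _ _ _ hb, LinearMap.smul_apply,
      charForm_neg, smul_eq_mul, neg_mul]

theorem vacuum_mul_incl_actMinus (a c : U 𝔤) (x : U (nMinus 𝒢)) :
    vacuum 𝒢 χ lam (a * incl _ (actMinus 𝒢 χ lam c x)) = vacuum 𝒢 χ lam (a * (c * incl _ x)) := by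
  simp only [vacuum_apply, map_mul, Module.End.mul_apply, actMinus_incl, mul_one]

/-- Invariance of the Shapovalov pairing. -/
theorem shapovalov_invariant (g : 𝔤) (x : U (nMinus 𝒢)) (y : U (nPlus 𝒢)) :
    shapovalov 𝒢 χ lam (actMinus 𝒢 χ lam (ι ℂ g) x) y =
      -shapovalov 𝒢 χ lam x (actPlus 𝒢 χ lam (ι ℂ g) y) := by
  rw [shapovalov_eq_vacuum, shapovalov_eq_vacuum, vacuum_antipode_actPlus,
    vacuum_mul_incl_actMinus, antipode_ι, neg_mul, mul_neg, map_neg, neg_neg]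

theorem shapovalov_eq_zero {i j : ℤ} (h : i + j ≠ 0) {x : U (nMinus 𝒢)} (hx : x ∈ UMinus 𝒢 i)
    {y : U (nPlus 𝒢)} (hy : y ∈ UPlus 𝒢 j) : shapovalov 𝒢 χ lam x y = 0 := by
  rw [shapovalov_eq_vacuum, vacuum_apply]
  refine counit_eq_zero_of_mem_uDeg (partGrading 𝒢 negDeg) h ?_
  refine actMinus_mem_uDeg 𝒢 χ lam (i := j + i) (j := 0) (by ring) ?_ (one_mem_uDeg _)
  exact mul_mem_uDeg 𝒢 rfl (antipode_mem_uDeg 𝒢 (incl_mem_uDeg 𝒢 hy)) (incl_mem_uDeg 𝒢 hx)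

/-- The radical `N` of `vacuum` is a proper left ideal containing the maximal left ideal `Ip` that
defines `M⁺_λ`, so it equals `Ip`. An `x` in the kernel of the form lies in `N`, hence annihilates
the generator, on which `U 𝔫₋` acts freely. -/
theorem eq_zero_of_shapovalov_eq_zero
    (hirr : IsSimpleModule (U 𝔤) (VermaPlus 𝒢 χ lam)) {x : U (nMinus 𝒢)}
    (h : ∀ y, shapovalov 𝒢 χ lam x y = 0) : x = 0 := by
  set Ip := Submodule.span (U 𝔤)
    {a : U 𝔤 | ∃ x ∈ pPlus 𝒢, a = ι ℂ x - algebraMap ℂ (U 𝔤) (lam * χ (zeroPart 𝒢 x))} with hI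
  have hco : IsCoatom Ip := isSimpleModule_iff_isCoatom.1 hirr
  let N : Submodule (U 𝔤) (U 𝔤) :=
    { carrier := {a | ∀ c, vacuum 𝒢 χ lam (c * a) = 0}
      zero_mem' := fun c => by simp
      add_mem' := fun {a b} ha hb c => by rw [mul_add, map_add, ha c, hb c, add_zero]
      smul_mem' := fun d a ha c => by rw [smul_eq_mul, ← mul_assoc]; exact ha _ }
  have hIN : Ip ≤ N := by
    refine Submodule.span_le.2 ?_
    rintro _ ⟨b, hb, rfl⟩ c
    rw [mul_sub, map_sub, vacuum_mul_ι _ _ _ hb, Algebra.algebraMap_eq_smul_one, mul_smul_comm,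
      map_smul, mul_one, smul_eq_mul, charForm_apply, sub_self]
  have hN : N ≠ ⊤ := by
    intro hN
    have h1 : (1 : U 𝔤) ∈ N := by rw [hN]; trivial
    have h2 := h1 1
    rw [one_mul, vacuum_one] at h2
    exact one_ne_zero h2
  have hNI : N ≤ Ip := by
    by_contra hcon
    exact hN (hco.2 N (lt_of_le_not_ge hIN hcon))
  have hx : incl _ x ∈ Ip := by
    refine hNI fun c => ?_
    -- Taking `S(c)` applied to the generator of `M⁻_{-λ}` as second argument of the form turns it
    -- into `vacuum (c x)`, because `S` is an involution.
    have h1 := vacuum_antipode_actPlus 𝒢 χ lam (antipode 𝔤 c) (incl _ x) 1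
    rw [antipode_antipode, ← shapovalov_eq_vacuum, h, map_one (incl _), antipode_one, one_mul] at h1
    exact h1.symm
  have hann : ∀ a ∈ Ip, actMinus 𝒢 χ lam a 1 = 0 := by
    intro a ha
    induction ha using Submodule.span_induction with
    | mem a h =>
      obtain ⟨b, hb, rfl⟩ := h
      rw [map_sub, AlgHom.commutes, LinearMap.sub_apply, actMinus_one _ _ _ hb, charForm_apply,
        Module.algebraMap_end_apply, Algebra.algebraMap_eq_smul_one, sub_self]
    | zero => simp
    | add x y _ _ hx hy => simp [hx, hy]
    | smul c x _ hx => simp [hx]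
  have := hann _ hx
  rwa [actMinus_incl, mul_one] at this

end Invariance

/-! ### Canonical tensors of bilinear pairings -/

section CanonicalTensor

variable {V W Z : Type*} [AddCommGroup V] [Module ℂ V] [AddCommGroup W] [Module ℂ W]
  [AddCommGroup Z] [Module ℂ Z]

/-- Injectivity and the dimension bound identify `V` with the dual of `W`; the tensor is then built
from a basis of `W` and its dual basis. -/
theorem exists_isCanonicalTensor [FiniteDimensional ℂ W] [FiniteDimensional ℂ V]
    (B : V →ₗ[ℂ] W →ₗ[ℂ] ℂ) (hB : Function.Injective B)
    (h : Module.finrank ℂ W ≤ Module.finrank ℂ V) : ∃ t, IsCanonicalTensor B t := by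
  have hle := LinearMap.finrank_le_finrank_of_injective (f := B) hB
  have hd : Module.finrank ℂ V = Module.finrank ℂ (Module.Dual ℂ W) := by
    refine le_antisymm hle ?_
    rw [Subspace.dual_finrank_eq]
    exact h
  let e : V ≃ₗ[ℂ] Module.Dual ℂ W := LinearEquiv.ofInjectiveOfFinrankEq B hB hd
  have he : ∀ f w, B (e.symm f) w = f w := fun f w =>
    LinearMap.congr_fun (e.apply_symm_apply f) w
  let b := Module.finBasis ℂ W
  refine ⟨∑ i, e.symm (b.coord i) ⊗ₜ b i, fun y => ?_, fun x => ?_⟩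
  · simp only [map_sum, TensorProduct.map_tmul, LinearMap.flip_apply, he, LinearMap.id_apply,
      TensorProduct.lid_tmul, Module.Basis.coord_apply, b.sum_repr]
  · simp only [map_sum, TensorProduct.map_tmul, LinearMap.id_apply, TensorProduct.rid_tmul]
    simp only [← map_smul, ← map_sum]
    rw [LinearEquiv.symm_apply_eq]
    refine LinearMap.ext fun w => ?_
    have h1 : e x w = B x w := rfl
    have h2 := congrArg (B x) (b.sum_repr w)
    rw [map_sum] at h2
    rw [h1, ← h2]
    simp only [LinearMap.sum_apply, LinearMap.smul_apply, Module.Basis.coord_apply, map_smul,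
      smul_eq_mul, mul_comm]

/-- A tensor whose contractions against a pairing with a canonical tensor vanish is zero. -/
theorem eq_zero_of_contractions {B : V →ₗ[ℂ] W →ₗ[ℂ] ℂ} {t₀ : V ⊗[ℂ] W}
    (ht₀ : ∀ y, TensorProduct.lid ℂ W (TensorProduct.map (B.flip y) LinearMap.id t₀) = y)
    {t : Z ⊗[ℂ] W}
    (h : ∀ x, TensorProduct.map (LinearMap.id : Z →ₗ[ℂ] Z) (B x) t = 0) : t = 0 := by
  -- The operator `P` on `W` obtained by contracting with `s` is a sum of maps factoring through
  -- functionals `B v`, so `1 ⊗ P` kills `t`. For `s = t₀` this operator is the identity.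
  have key : ∀ (s : V ⊗[ℂ] W) (P : W →ₗ[ℂ] W),
      (∀ y, TensorProduct.lid ℂ W (TensorProduct.map (B.flip y) LinearMap.id s) = P y) →
      TensorProduct.map (LinearMap.id : Z →ₗ[ℂ] Z) P t = 0 := by
    intro s
    induction s using TensorProduct.induction_on with
    | zero =>
      intro P hP
      have : P = 0 := LinearMap.ext fun x => by simpa using (hP x).symm
      rw [this, TensorProduct.map_zero_right, LinearMap.zero_apply]
    | add x y hx hy =>
      intro P hP
      let C : V ⊗[ℂ] W → W →ₗ[ℂ] W := fun s => (TensorProduct.lid ℂ W).toLinearMap ∘ₗ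
        LinearMap.flip (((TensorProduct.mapBilinear (.id ℂ) V W ℂ W).flip LinearMap.id) ∘ₗ B.flip) s
      have : P = C x + C y := by
        ext z
        rw [← hP z]
        simp [C]
      rw [this, TensorProduct.map_add_right, LinearMap.add_apply, hx _ fun _ => rfl,
        hy _ fun _ => rfl, add_zero]
    | tmul v w =>
      intro P hP
      have : P = LinearMap.toSpanSingleton ℂ W w ∘ₗ B v := by
        ext x
        rw [← hP x]
        simp
      rw [this, ← LinearMap.id_comp (LinearMap.id : Z →ₗ[ℂ] Z), TensorProduct.map_comp,
        LinearMap.comp_apply, h, map_zero]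
  have := key t₀ LinearMap.id ht₀
  rwa [TensorProduct.map_id] at this

theorem eq_zero_of_contractions_right {B : V →ₗ[ℂ] W →ₗ[ℂ] ℂ} {t₀ : V ⊗[ℂ] W}
    (ht₀ : IsCanonicalTensor B t₀) {t : Z ⊗[ℂ] W}
    (h : ∀ x, TensorProduct.rid ℂ Z (TensorProduct.map LinearMap.id (B x) t) = 0) : t = 0 :=
  eq_zero_of_contractions ht₀.1 fun x => (TensorProduct.rid ℂ Z).injective (by rw [h, map_zero])

theorem eq_zero_of_contractions_left {B : V →ₗ[ℂ] W →ₗ[ℂ] ℂ} {t₀ : V ⊗[ℂ] W}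
    (ht₀ : IsCanonicalTensor B t₀) {t : V ⊗[ℂ] Z}
    (h : ∀ y, TensorProduct.lid ℂ Z (TensorProduct.map (B.flip y) LinearMap.id t) = 0) : t = 0 := by
  refine (TensorProduct.comm ℂ V Z).injective ?_
  rw [map_zero]
  refine eq_zero_of_contractions (B := B.flip) (t₀ := TensorProduct.comm ℂ V W t₀) (fun x => ?_)
    fun y => ?_
  · rw [LinearMap.flip_flip, TensorProduct.map_comm, TensorProduct.lid_comm]
    exact ht₀.2 x
  · rw [TensorProduct.map_comm]
    refine (TensorProduct.comm ℂ Z ℂ).injective ((TensorProduct.lid ℂ Z).injective ?_)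
    have := h y
    simpa using this

theorem isCanonicalTensor_unique {B : V →ₗ[ℂ] W →ₗ[ℂ] ℂ} {t t' : V ⊗[ℂ] W}
    (ht : IsCanonicalTensor B t) (ht' : IsCanonicalTensor B t') : t = t' := by
  rw [← sub_eq_zero]
  refine eq_zero_of_contractions_left ht fun y => ?_
  rw [map_sub, map_sub, ht.1, ht'.1, sub_self]

end CanonicalTensor

/-! ### The equivariant map to `U 𝔤 / U 𝔤 · 𝔤₀` -/

section EquivariantMap

variable {𝔤 : Type*} [LieRing 𝔤] [LieAlgebra ℂ 𝔤] (𝒢 : ℤ → Submodule ℂ 𝔤) [GradedLieAlgebra 𝒢]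
  (χ : LieAlgebra.LieCharacter ℂ (gZero 𝒢)) (lam : ℂ)

theorem pMap_mul (c a : U 𝔤) : pMap 𝒢 (c * a) = c • pMap 𝒢 a := rfl

theorem pMap_ι_eq_zero {x : 𝔤} (hx : x ∈ 𝒢 0) : pMap 𝒢 (ι ℂ x) = 0 :=
  (Submodule.Quotient.mk_eq_zero _).2 (Submodule.subset_span ⟨x, hx, rfl⟩)

theorem nMinus_le_pMinus {x : 𝔤} (hx : x ∈ nMinus 𝒢) : x ∈ pMinus 𝒢 :=
  gradedPart_induction 𝒢 (P := fun x => x ∈ pMinus 𝒢)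
    (fun i hi _ hx => mem_gradedPart_of_mem 𝒢 (S := nonposDeg) (le_of_lt (show i < 0 from hi)) hx)
    (zero_mem _) (fun _ _ hx hy => add_mem hx hy) hx

/-- The subalgebra `𝔤₀` has weight `λχ` on the generator of `M⁺_λ` and weight zero on the class of
`1`, while `𝔫₋` acts on both sides by left multiplication. Hence `x ↦ p(x)` is a vector of weight
`-λχ` for `𝔭₋` in the space of linear maps, as needed to define a map out of `M⁻_{-λ}`. -/
theorem pMap_incl_actMinus {b : 𝔤} (hb : b ∈ pMinus 𝒢) (x : U (nMinus 𝒢)) :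
    pMap 𝒢 (incl _ (actMinus 𝒢 χ lam (ι ℂ b) x)) =
      (ι ℂ b : U 𝔤) • pMap 𝒢 (incl _ x) + charForm 𝒢 χ lam b • pMap 𝒢 (incl _ x) := by
  induction x using induction_left generalizing b with
  | one =>
    refine gradedPart_induction 𝒢 (S := nonposDeg) (P := fun b =>
      pMap 𝒢 (incl _ (actMinus 𝒢 χ lam (ι ℂ b) 1)) =
        (ι ℂ b : U 𝔤) • pMap 𝒢 (incl _ 1) + charForm 𝒢 χ lam b • pMap 𝒢 (incl _ 1))
      (fun i hi x hx => ?_) (by simp) (fun x y hx hy => ?_) hb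
    · by_cases h0 : i = 0
      · subst h0
        rw [actMinus_one 𝒢 χ lam (gZero_le_pPlus 𝒢 ⟨x, hx⟩), ← pMap_mul, map_one, mul_one,
          pMap_ι_eq_zero 𝒢 hx, zero_add, AlgHom.commutes, Algebra.algebraMap_eq_smul_one, map_smul]
      · have hx' : x ∈ nMinus 𝒢 :=
          mem_gradedPart_of_mem 𝒢 (S := negDeg) (lt_of_le_of_ne (show i ≤ 0 from hi) h0) hx
        have h := actMinus_left 𝒢 χ lam ⟨x, hx'⟩ 1
        simp only at h
        rw [h, charForm_eq_zero 𝒢 χ lam i h0 x hx, zero_smul, add_zero, ← pMap_mul, map_mul, incl_ι]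
    · simp only [map_add, LinearMap.add_apply, hx, hy, add_smul]
      abel
  | zero => simp
  | add x y hx hy =>
    simp only [map_add, hx hb, hy hb, smul_add]
    abel
  | smul c x hx =>
    simp only [map_smul, hx hb, smul_add]
    rw [smul_comm c (ι ℂ b : U 𝔤), smul_comm c (charForm 𝒢 χ lam b)]
  | mul a u hu =>
    have h1 : ⁅b, (a : 𝔤)⁆ ∈ nMinus 𝒢 :=
      lie_mem_of_forall 𝒢 (S := nonposDeg) (T := negDeg) (R := negDeg)
        (fun i (hi : i ≤ 0) j (hj : j < 0) => show i + j < 0 by omega) hb a.2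
    rw [actMinus_ι_mul, map_add, map_add, hu (nMinus_le_pMinus 𝒢 h1), map_mul (incl _), map_mul (incl _), incl_ι,
      pMap_mul, pMap_mul, hu hb, charForm_eq_zero_of_mem 𝒢 χ lam zero_notMem_negDeg h1, zero_smul,
      add_zero, ι_lie, sub_smul, mul_smul, mul_smul, smul_add,
      smul_comm (charForm 𝒢 χ lam b) (ι ℂ (a : 𝔤) : U 𝔤)]
    abel

/-- The action of `𝔤` on linear maps from `M⁺_λ` to `U 𝔤 / U 𝔤 · 𝔤₀`. -/
def homActLie : 𝔤 →ₗ⁅ℂ⁆ Module.End ℂ (U (nMinus 𝒢) →ₗ[ℂ] Quot₀ 𝒢) where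
  toFun g :=
    { toFun := fun f => Algebra.lsmul ℂ ℂ (Quot₀ 𝒢) (ι ℂ g) ∘ₗ f - f ∘ₗ actMinus 𝒢 χ lam (ι ℂ g)
      map_add' := fun f f' => by ext x; simp; abel
      map_smul' := fun c f => by
        ext x
        simp only [LinearMap.sub_apply, LinearMap.comp_apply, LinearMap.smul_apply, map_smul,
          RingHom.id_apply, smul_sub] }
  map_add' g h := by ext f x; simp; abel
  map_smul' c g := by
    ext f x
    simp only [map_smul, LinearMap.coe_mk, AddHom.coe_mk, LinearMap.sub_apply,
      LinearMap.comp_apply, LinearMap.smul_apply, RingHom.id_apply, smul_sub]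
  map_lie' {g h} := by
    ext f x
    simp only [LieRing.of_associative_ring_bracket, ι_lie, map_sub, map_mul, LinearMap.coe_mk,
      AddHom.coe_mk, LinearMap.sub_apply, LinearMap.comp_apply, Module.End.mul_apply]
    abel

/-- The action of `U 𝔤` on linear maps from `M⁺_λ` to `U 𝔤 / U 𝔤 · 𝔤₀`. -/
def homAct : U 𝔤 →ₐ[ℂ] Module.End ℂ (U (nMinus 𝒢) →ₗ[ℂ] Quot₀ 𝒢) :=
  UniversalEnvelopingAlgebra.lift ℂ (homActLie 𝒢 χ lam)

theorem homAct_ι (g : 𝔤) (f : U (nMinus 𝒢) →ₗ[ℂ] Quot₀ 𝒢) (x : U (nMinus 𝒢)) :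
    homAct 𝒢 χ lam (ι ℂ g) f x = (ι ℂ g : U 𝔤) • f x - f (actMinus 𝒢 χ lam (ι ℂ g) x) := by
  rw [homAct, UniversalEnvelopingAlgebra.lift_ι_apply]
  rfl

/-- The equivariant map `M⁻_{-λ} ⊗ M⁺_λ → U 𝔤 / U 𝔤 · 𝔤₀` sending the generator to the class
of `1`. -/
def equivMap : U (nPlus 𝒢) →ₗ[ℂ] U (nMinus 𝒢) →ₗ[ℂ] Quot₀ 𝒢 :=
  LinearMap.flip (homAct 𝒢 χ lam).toLinearMap (pMap 𝒢 ∘ₗ (incl (nMinus 𝒢)).toLinearMap) ∘ₗ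
    (incl (nPlus 𝒢)).toLinearMap

theorem equivMap_apply (y : U (nPlus 𝒢)) :
    equivMap 𝒢 χ lam y =
      homAct 𝒢 χ lam (incl _ y) (pMap 𝒢 ∘ₗ (incl (nMinus 𝒢)).toLinearMap) := rfl

theorem equivMap_equivariant (g : 𝔤) (y : U (nPlus 𝒢)) (x : U (nMinus 𝒢)) :
    equivMap 𝒢 χ lam (actPlus 𝒢 χ lam (ι ℂ g) y) x =
      (ι ℂ g : U 𝔤) • equivMap 𝒢 χ lam y x -
        equivMap 𝒢 χ lam y (actMinus 𝒢 χ lam (ι ℂ g) x) := by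
  have h := incl_charAct_apply (isCompl_gradedPart 𝒢 posDeg_compl) (charForm 𝒢 χ (-lam))
    (charForm_lie 𝒢 χ (-lam) nonposDeg_add_eq_zero) (homAct 𝒢 χ lam)
    (w := pMap 𝒢 ∘ₗ (incl (nMinus 𝒢)).toLinearMap) (fun b hb => ?_) (ι ℂ g) y
  · have h' := LinearMap.congr_fun h x
    rw [homAct_ι] at h'
    exact h'
  · refine LinearMap.ext fun x => ?_
    rw [homAct_ι]
    simp only [LinearMap.comp_apply, AlgHom.toLinearMap_apply, LinearMap.smul_apply]
    rw [pMap_incl_actMinus 𝒢 χ lam hb, charForm_neg, neg_smul]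
    abel

theorem equivMap_one_left (x : U (nMinus 𝒢)) : equivMap 𝒢 χ lam 1 x = pMap 𝒢 (incl _ x) := by
  simp [equivMap_apply]

theorem equivMap_ι_mul_left (b : nPlus 𝒢) (y : U (nPlus 𝒢)) (x : U (nMinus 𝒢)) :
    equivMap 𝒢 χ lam (ι ℂ b * y) x =
      (ι ℂ (b : 𝔤) : U 𝔤) • equivMap 𝒢 χ lam y x -
        equivMap 𝒢 χ lam y (actMinus 𝒢 χ lam (ι ℂ (b : 𝔤)) x) := by
  rw [← equivMap_equivariant, actPlus_left]

theorem equivMap_ι_mul_right (a : nMinus 𝒢) (y : U (nPlus 𝒢)) (x : U (nMinus 𝒢)) :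
    equivMap 𝒢 χ lam y (ι ℂ a * x) =
      (ι ℂ (a : 𝔤) : U 𝔤) • equivMap 𝒢 χ lam y x -
        equivMap 𝒢 χ lam (actPlus 𝒢 χ lam (ι ℂ (a : 𝔤)) y) x := by
  rw [equivMap_equivariant, actMinus_left]
  abel

/-- The correction term in the recursion vanishes because `𝔫₊` kills the generator of `M⁺_λ`. -/
theorem equivMap_one_right (y : U (nPlus 𝒢)) : equivMap 𝒢 χ lam y 1 = pMap 𝒢 (incl _ y) := by
  induction y using induction_left with
  | one => simp [equivMap_one_left]
  | zero => simp
  | add x y hx hy => simp [hx, hy]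
  | smul c x hx => simp [hx]
  | mul b y hy =>
    rw [equivMap_ι_mul_left, hy, actMinus_one 𝒢 χ lam (nPlus_le_pPlus 𝒢 b.2),
      charForm_eq_zero_of_mem 𝒢 χ lam zero_notMem_posDeg b.2, map_zero, map_zero, sub_zero, map_mul,
      incl_ι, pMap_mul]

end EquivariantMap

/-! ### Contractions of the two sides -/

section Contractions

variable {𝔤 : Type*} [LieRing 𝔤] [LieAlgebra ℂ 𝔤] (𝒢 : ℤ → Submodule ℂ 𝔤) [GradedLieAlgebra 𝒢]
  (χ : LieAlgebra.LieCharacter ℂ (gZero 𝒢)) (lam : ℂ)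

/-- The map `a ⊗ q ↦ (a, y)_λ p(q)`. -/
def contractFst (y : U (nPlus 𝒢)) : U (nMinus 𝒢) ⊗[ℂ] U 𝔤 →ₗ[ℂ] Quot₀ 𝒢 :=
  (TensorProduct.lid ℂ _).toLinearMap ∘ₗ
    TensorProduct.map ((shapovalov 𝒢 χ lam).flip y) (pMap 𝒢)

@[simp]
theorem contractFst_tmul (y : U (nPlus 𝒢)) (a : U (nMinus 𝒢)) (q : U 𝔤) :
    contractFst 𝒢 χ lam y (a ⊗ₜ q) = shapovalov 𝒢 χ lam a y • pMap 𝒢 q := rfl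

/-- The map `q ⊗ b ↦ (x, b)_λ p(q)`. -/
def contractSnd (x : U (nMinus 𝒢)) : U 𝔤 ⊗[ℂ] U (nPlus 𝒢) →ₗ[ℂ] Quot₀ 𝒢 :=
  (TensorProduct.rid ℂ _).toLinearMap ∘ₗ TensorProduct.map (pMap 𝒢) (shapovalov 𝒢 χ lam x)

@[simp]
theorem contractSnd_tmul (x : U (nMinus 𝒢)) (q : U 𝔤) (b : U (nPlus 𝒢)) :
    contractSnd 𝒢 χ lam x (q ⊗ₜ b) = shapovalov 𝒢 χ lam x b • pMap 𝒢 q := rfl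

/-- The map `a ⊗ q ⊗ b ↦ (a, y)_λ (x, b)_λ p(q)`. -/
def contractBoth (y : U (nPlus 𝒢)) (x : U (nMinus 𝒢)) : Triple 𝒢 →ₗ[ℂ] Quot₀ 𝒢 :=
  (TensorProduct.lid ℂ _).toLinearMap ∘ₗ
    TensorProduct.map ((shapovalov 𝒢 χ lam).flip y) (contractSnd 𝒢 χ lam x)

@[simp]
theorem contractBoth_tmul (y : U (nPlus 𝒢)) (x a : U (nMinus 𝒢)) (t : U 𝔤 ⊗[ℂ] U (nPlus 𝒢)) :
    contractBoth 𝒢 χ lam y x (a ⊗ₜ t) = shapovalov 𝒢 χ lam a y • contractSnd 𝒢 χ lam x t := rfl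

/-- The contraction `a ⊗ b ↦ (a, y)_λ b`. -/
def evalFst (y : U (nPlus 𝒢)) : U (nMinus 𝒢) ⊗[ℂ] U (nPlus 𝒢) →ₗ[ℂ] U (nPlus 𝒢) :=
  (TensorProduct.lid ℂ _).toLinearMap ∘ₗ
    TensorProduct.map ((shapovalov 𝒢 χ lam).flip y) LinearMap.id

@[simp]
theorem evalFst_tmul (y b : U (nPlus 𝒢)) (a : U (nMinus 𝒢)) :
    evalFst 𝒢 χ lam y (a ⊗ₜ b) = shapovalov 𝒢 χ lam a y • b := rfl

/-- The contraction `a ⊗ b ↦ (x, b)_λ a`. -/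
def evalSnd (x : U (nMinus 𝒢)) : U (nMinus 𝒢) ⊗[ℂ] U (nPlus 𝒢) →ₗ[ℂ] U (nMinus 𝒢) :=
  (TensorProduct.rid ℂ _).toLinearMap ∘ₗ
    TensorProduct.map LinearMap.id (shapovalov 𝒢 χ lam x)

@[simp]
theorem evalSnd_tmul (x a : U (nMinus 𝒢)) (b : U (nPlus 𝒢)) :
    evalSnd 𝒢 χ lam x (a ⊗ₜ b) = shapovalov 𝒢 χ lam x b • a := rfl

/-- The map `a ⊗ b ↦ a ⊗ b` from `U 𝔫₋ ⊗ U 𝔞` to `U 𝔫₋ ⊗ U 𝔤`. -/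
def inclSnd (𝔞 : LieSubalgebra ℂ 𝔤) : U (nMinus 𝒢) ⊗[ℂ] U 𝔞 →ₐ[ℂ] U (nMinus 𝒢) ⊗[ℂ] U 𝔤 :=
  Algebra.TensorProduct.map (AlgHom.id ℂ _) (incl 𝔞)

@[simp]
theorem inclSnd_tmul (𝔞 : LieSubalgebra ℂ 𝔤) (a : U (nMinus 𝒢)) (b : U 𝔞) :
    inclSnd 𝒢 𝔞 (a ⊗ₜ b) = a ⊗ₜ incl 𝔞 b := rfl

/-- The map `a ⊗ b ↦ a ⊗ b` from `U 𝔞 ⊗ U 𝔫₊` to `U 𝔤 ⊗ U 𝔫₊`. -/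
def inclFst (𝔞 : LieSubalgebra ℂ 𝔤) : U 𝔞 ⊗[ℂ] U (nPlus 𝒢) →ₐ[ℂ] U 𝔤 ⊗[ℂ] U (nPlus 𝒢) :=
  Algebra.TensorProduct.map (incl 𝔞) (AlgHom.id ℂ _)

@[simp]
theorem inclFst_tmul (𝔞 : LieSubalgebra ℂ 𝔤) (a : U 𝔞) (b : U (nPlus 𝒢)) :
    inclFst 𝒢 𝔞 (a ⊗ₜ b) = incl 𝔞 a ⊗ₜ b := rfl

/-- The third leg comes from the first factor alone, so pairing it with `x` can be done before
applying `Δ`. -/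
theorem contractBoth_comulOne (y : U (nPlus 𝒢)) (x : U (nMinus 𝒢))
    (s G : U (nMinus 𝒢) ⊗[ℂ] U (nPlus 𝒢)) :
    contractBoth 𝒢 χ lam y x (comulOne 𝒢 s * tensorOne 𝒢 G) =
      contractFst 𝒢 χ lam y
        (inclSnd 𝒢 _ (comul _ (evalSnd 𝒢 χ lam x s)) * inclSnd 𝒢 _ G) := by
  induction s using TensorProduct.induction_on with
  | zero => simp
  | add s t hs ht => simp only [map_add, add_mul, hs, ht]
  | tmul a b =>
    rw [evalSnd_tmul, map_smul, map_smul, smul_mul_assoc, map_smul]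
    simp only [comulOne, AlgHom.comp_apply, Algebra.TensorProduct.map_tmul, AlgHom.id_apply]
    induction comul (nMinus 𝒢) a using TensorProduct.induction_on with
    | zero => simp
    | add s t hs ht =>
      simp only [TensorProduct.add_tmul, map_add, add_mul, smul_add] at hs ht ⊢
      rw [hs, ht]
    | tmul a' a'' =>
      induction G using TensorProduct.induction_on with
      | zero => simp
      | add s t hs ht => simp only [map_add, mul_add, smul_add, hs, ht]
      | tmul f g =>
        simp [tensorOne]
        exact smul_comm _ _ _

/-- Mirror image: the first leg comes from the first factor alone and is paired with `y` before `Δ`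
is applied. -/
theorem contractBoth_oneComul (y : U (nPlus 𝒢)) (x : U (nMinus 𝒢))
    (s G : U (nMinus 𝒢) ⊗[ℂ] U (nPlus 𝒢)) :
    contractBoth 𝒢 χ lam y x (oneComul 𝒢 s * oneTensor 𝒢 G) =
      contractSnd 𝒢 χ lam x
        (inclFst 𝒢 _ (comul _ (evalFst 𝒢 χ lam y s)) * inclFst 𝒢 _ G) := by
  induction s using TensorProduct.induction_on with
  | zero => simp
  | add s t hs ht => simp only [map_add, add_mul, hs, ht]
  | tmul a b =>
    rw [evalFst_tmul, map_smul, map_smul, smul_mul_assoc, map_smul]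
    simp only [oneComul, AlgHom.comp_apply, Algebra.TensorProduct.map_tmul, AlgHom.id_apply]
    induction comul (nPlus 𝒢) b using TensorProduct.induction_on with
    | zero => simp
    | add s t hs ht =>
      simp only [TensorProduct.tmul_add, map_add, add_mul, smul_add] at hs ht ⊢
      rw [hs, ht]
    | tmul b' b'' =>
      induction G using TensorProduct.induction_on with
      | zero => simp
      | add s t hs ht => simp only [map_add, mul_add, smul_add, hs, ht]
      | tmul f g => simp [oneTensor]

theorem contractFst_inclSnd (y : U (nPlus 𝒢)) (G : U (nMinus 𝒢) ⊗[ℂ] U (nPlus 𝒢)) :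
    contractFst 𝒢 χ lam y (inclSnd 𝒢 _ G) = pMap 𝒢 (incl _ (evalFst 𝒢 χ lam y G)) := by
  induction G using TensorProduct.induction_on with
  | zero => simp
  | add s t hs ht => simp only [map_add, hs, ht]
  | tmul f g => simp

theorem contractSnd_inclFst (x : U (nMinus 𝒢)) (G : U (nMinus 𝒢) ⊗[ℂ] U (nPlus 𝒢)) :
    contractSnd 𝒢 χ lam x (inclFst 𝒢 _ G) = pMap 𝒢 (incl _ (evalSnd 𝒢 χ lam x G)) := by
  induction G using TensorProduct.induction_on with
  | zero => simp
  | add s t hs ht => simp only [map_add, hs, ht]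
  | tmul f g => simp

theorem contractFst_tmul_one_mul (a : nMinus 𝒢) (y : U (nPlus 𝒢)) (t : U (nMinus 𝒢) ⊗[ℂ] U 𝔤) :
    contractFst 𝒢 χ lam y ((ι ℂ a ⊗ₜ[ℂ] (1 : U 𝔤)) * t) =
      -contractFst 𝒢 χ lam (actPlus 𝒢 χ lam (ι ℂ (a : 𝔤)) y) t := by
  induction t using TensorProduct.induction_on with
  | zero => simp
  | add s t hs ht => rw [mul_add, map_add, hs, ht, map_add, neg_add]
  | tmul f g =>
    rw [Algebra.TensorProduct.tmul_mul_tmul, contractFst_tmul, contractFst_tmul, one_mul,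
      ← actMinus_left 𝒢 χ lam, shapovalov_invariant, neg_smul]

theorem contractFst_one_tmul_mul (c : U 𝔤) (y : U (nPlus 𝒢)) (t : U (nMinus 𝒢) ⊗[ℂ] U 𝔤) :
    contractFst 𝒢 χ lam y (((1 : U (nMinus 𝒢)) ⊗ₜ[ℂ] c) * t) = c • contractFst 𝒢 χ lam y t := by
  induction t using TensorProduct.induction_on with
  | zero => simp
  | add s t hs ht => rw [mul_add, map_add, hs, ht, map_add, smul_add]
  | tmul f g =>
    rw [Algebra.TensorProduct.tmul_mul_tmul, contractFst_tmul, contractFst_tmul, one_mul,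
      pMap_mul, smul_comm]

theorem contractSnd_one_tmul_mul (b : nPlus 𝒢) (x : U (nMinus 𝒢)) (t : U 𝔤 ⊗[ℂ] U (nPlus 𝒢)) :
    contractSnd 𝒢 χ lam x (((1 : U 𝔤) ⊗ₜ[ℂ] ι ℂ b) * t) =
      -contractSnd 𝒢 χ lam (actMinus 𝒢 χ lam (ι ℂ (b : 𝔤)) x) t := by
  induction t using TensorProduct.induction_on with
  | zero => simp
  | add s t hs ht => rw [mul_add, map_add, hs, ht, map_add, neg_add]
  | tmul f g =>
    rw [Algebra.TensorProduct.tmul_mul_tmul, contractSnd_tmul, contractSnd_tmul, one_mul,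
      ← actPlus_left 𝒢 χ lam, shapovalov_invariant, neg_smul, neg_neg]

theorem contractSnd_tmul_one_mul (c : U 𝔤) (x : U (nMinus 𝒢)) (t : U 𝔤 ⊗[ℂ] U (nPlus 𝒢)) :
    contractSnd 𝒢 χ lam x ((c ⊗ₜ[ℂ] (1 : U (nPlus 𝒢))) * t) = c • contractSnd 𝒢 χ lam x t := by
  induction t using TensorProduct.induction_on with
  | zero => simp
  | add s t hs ht => rw [mul_add, map_add, hs, ht, map_add, smul_add]
  | tmul f g =>
    rw [Algebra.TensorProduct.tmul_mul_tmul, contractSnd_tmul, contractSnd_tmul, one_mul,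
      pMap_mul, smul_comm]

/-- Induction on `x`. A left factor `a` of `x` is primitive: one summand of `Δ(a)` is moved onto `y`
by invariance, the other acts on the quotient, which is the recursion `equivMap_ι_mul_right`. As `y`
changes along the way, `G` must reproduce a whole subspace `Y` stable under `𝔫₋`; this permits a
truncation of `F` as `G`. -/
theorem contractFst_comul {Y : Submodule ℂ (U (nPlus 𝒢))}
    (hY : ∀ (a : nMinus 𝒢), ∀ y ∈ Y, actPlus 𝒢 χ lam (ι ℂ (a : 𝔤)) y ∈ Y)
    {G : U (nMinus 𝒢) ⊗[ℂ] U (nPlus 𝒢)} (hG : ∀ y ∈ Y, evalFst 𝒢 χ lam y G = y)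
    {y : U (nPlus 𝒢)} (hy : y ∈ Y) (x : U (nMinus 𝒢)) :
    contractFst 𝒢 χ lam y (inclSnd 𝒢 _ (comul _ x) * inclSnd 𝒢 _ G) = equivMap 𝒢 χ lam y x := by
  induction x using induction_left generalizing y with
  | one => rw [map_one, map_one, one_mul, contractFst_inclSnd, hG y hy, equivMap_one_right]
  | zero => simp
  | add u v hu hv => simp only [map_add, add_mul, hu hy, hv hy]
  | smul c u hu => simp only [map_smul, smul_mul_assoc, hu hy]
  | mul a u hu =>
    rw [map_mul (comul _), comul_ι, map_mul (inclSnd _ _), map_add, inclSnd_tmul, inclSnd_tmul, map_one, incl_ι, mul_assoc,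
      add_mul, map_add, contractFst_tmul_one_mul, contractFst_one_tmul_mul, hu hy, hu (hY a y hy),
      equivMap_ι_mul_right]
    abel

theorem contractSnd_comul {X : Submodule ℂ (U (nMinus 𝒢))}
    (hX : ∀ (b : nPlus 𝒢), ∀ x ∈ X, actMinus 𝒢 χ lam (ι ℂ (b : 𝔤)) x ∈ X)
    {G : U (nMinus 𝒢) ⊗[ℂ] U (nPlus 𝒢)} (hG : ∀ x ∈ X, evalSnd 𝒢 χ lam x G = x)
    {x : U (nMinus 𝒢)} (hx : x ∈ X) (y : U (nPlus 𝒢)) :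
    contractSnd 𝒢 χ lam x (inclFst 𝒢 _ (comul _ y) * inclFst 𝒢 _ G) = equivMap 𝒢 χ lam y x := by
  induction y using induction_left generalizing x with
  | one => rw [map_one, map_one, one_mul, contractSnd_inclFst, hG x hx, equivMap_one_left]
  | zero => simp
  | add u v hu hv => simp only [map_add, add_mul, LinearMap.add_apply, hu hx, hv hx]
  | smul c u hu => simp only [map_smul, smul_mul_assoc, LinearMap.smul_apply, hu hx]
  | mul b u hu =>
    rw [map_mul (comul _), comul_ι, map_mul (inclFst _ _), map_add, inclFst_tmul, inclFst_tmul, map_one, incl_ι, mul_assoc,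
      add_mul, map_add, contractSnd_one_tmul_mul, contractSnd_tmul_one_mul, hu hx, hu (hX b x hx),
      equivMap_ι_mul_left]
    abel

end Contractions

/-! ### The cocycle equation -/

section Cocycle

variable {𝔤 : Type*} [LieRing 𝔤] [LieAlgebra ℂ 𝔤] (𝒢 : ℤ → Submodule ℂ 𝔤) [GradedLieAlgebra 𝒢]
  (χ : LieAlgebra.LieCharacter ℂ (gZero 𝒢)) (lam : ℂ)

theorem UPlus_eq_bot {n : ℤ} (hn : n < 0) : UPlus 𝒢 n = ⊥ :=
  uDeg_eq_bot_of_forall (partGrading 𝒢 posDeg) (D := {i | 0 < i})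
    (fun _ hi => partGrading_eq_bot 𝒢 (S := posDeg) hi) (AddSubmonoid.nonneg ℤ)
    (fun _ hi => AddSubmonoid.mem_nonneg.2 (le_of_lt hi))
    (fun h => absurd (AddSubmonoid.mem_nonneg.1 h) (not_le.2 hn))

theorem UMinus_eq_bot {n : ℤ} (hn : 0 < n) : UMinus 𝒢 n = ⊥ := by
  let M : AddSubmonoid ℤ :=
    { carrier := {i | i ≤ 0}
      zero_mem' := le_refl (0 : ℤ)
      add_mem' := fun {a b} (ha : a ≤ 0) (hb : b ≤ 0) => add_nonpos ha hb }
  exact uDeg_eq_bot_of_forall (partGrading 𝒢 negDeg) (D := {i | i < 0})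
    (fun i hi => partGrading_eq_bot 𝒢 (S := negDeg) hi) M (fun i (hi : i < 0) => hi.le)
    (fun (h : n ≤ 0) => absurd h (not_le.2 hn))

theorem lid_map_mapIncl {V W : Type*} [AddCommGroup V] [Module ℂ V] [AddCommGroup W] [Module ℂ W]
    (P : Submodule ℂ V) (R : Submodule ℂ W) (f : V →ₗ[ℂ] ℂ) (t : P ⊗[ℂ] R) :
    TensorProduct.lid ℂ W (TensorProduct.map f LinearMap.id (TensorProduct.mapIncl P R t)) =
      (TensorProduct.lid ℂ R (TensorProduct.map (f ∘ₗ P.subtype) LinearMap.id t) : R) := by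
  induction t using TensorProduct.induction_on with
  | zero => simp
  | add x y hx hy => simp only [map_add, hx, hy, Submodule.coe_add]
  | tmul v w => simp [TensorProduct.mapIncl]

theorem rid_map_mapIncl {V W : Type*} [AddCommGroup V] [Module ℂ V] [AddCommGroup W] [Module ℂ W]
    (P : Submodule ℂ V) (R : Submodule ℂ W) (f : W →ₗ[ℂ] ℂ) (t : P ⊗[ℂ] R) :
    TensorProduct.rid ℂ V (TensorProduct.map LinearMap.id f (TensorProduct.mapIncl P R t)) =
      (TensorProduct.rid ℂ P (TensorProduct.map LinearMap.id (f ∘ₗ R.subtype) t) : P) := by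
  induction t using TensorProduct.induction_on with
  | zero => simp
  | add x y hx hy => simp only [map_add, hx, hy, Submodule.coe_add]
  | tmul v w => simp [TensorProduct.mapIncl]

theorem lid_map_mapIncl_eq_zero {V W : Type*} [AddCommGroup V] [Module ℂ V] [AddCommGroup W]
    [Module ℂ W] (P : Submodule ℂ V) (R : Submodule ℂ W) (f : V →ₗ[ℂ] ℂ) (hf : ∀ p ∈ P, f p = 0)
    (t : P ⊗[ℂ] R) :
    TensorProduct.lid ℂ W (TensorProduct.map f LinearMap.id (TensorProduct.mapIncl P R t)) = 0 := by
  have h0 : f ∘ₗ P.subtype = 0 := LinearMap.ext fun p => hf p p.2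
  rw [lid_map_mapIncl, h0, TensorProduct.map_zero_left, LinearMap.zero_apply, map_zero,
    Submodule.coe_zero]

theorem rid_map_mapIncl_eq_zero {V W : Type*} [AddCommGroup V] [Module ℂ V] [AddCommGroup W]
    [Module ℂ W] (P : Submodule ℂ V) (R : Submodule ℂ W) (f : W →ₗ[ℂ] ℂ) (hf : ∀ r ∈ R, f r = 0)
    (t : P ⊗[ℂ] R) :
    TensorProduct.rid ℂ V (TensorProduct.map LinearMap.id f (TensorProduct.mapIncl P R t)) = 0 := by
  have h0 : f ∘ₗ R.subtype = 0 := LinearMap.ext fun p => hf p p.2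
  rw [rid_map_mapIncl, h0, TensorProduct.map_zero_right, LinearMap.zero_apply, map_zero,
    Submodule.coe_zero]

variable {χ lam} {F : Completed₂ 𝒢} (hF : IsCanonicalElement 𝒢 χ lam F)

theorem evalFst_piece (d : ℤ × ℤ) {k : ℤ} {y : U (nPlus 𝒢)} (hy : y ∈ UPlus 𝒢 k)
    (h : d.1 + k ≠ 0) : evalFst 𝒢 χ lam y (piece 𝒢 F d) = 0 :=
  lid_map_mapIncl_eq_zero _ _ _ (fun _ hx => shapovalov_eq_zero 𝒢 χ lam h hx hy) _

theorem evalSnd_piece (d : ℤ × ℤ) {k : ℤ} {x : U (nMinus 𝒢)} (hx : x ∈ UMinus 𝒢 k)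
    (h : k + d.2 ≠ 0) : evalSnd 𝒢 χ lam x (piece 𝒢 F d) = 0 :=
  rid_map_mapIncl_eq_zero _ _ _ (fun _ hy => shapovalov_eq_zero 𝒢 χ lam h hx hy) _

include hF

theorem evalFst_piece_self {n : ℤ} {y : U (nPlus 𝒢)} (hy : y ∈ UPlus 𝒢 n) :
    evalFst 𝒢 χ lam y (piece 𝒢 F (-n, n)) = y :=
  (lid_map_mapIncl _ _ _ _).trans (congrArg Subtype.val ((hF.1 n).1 ⟨y, hy⟩))

theorem evalSnd_piece_self {n : ℤ} {x : U (nMinus 𝒢)} (hx : x ∈ UMinus 𝒢 (-n)) :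
    evalSnd 𝒢 χ lam x (piece 𝒢 F (-n, n)) = x :=
  (rid_map_mapIncl _ _ _ _).trans (congrArg Subtype.val ((hF.1 n).2 ⟨x, hx⟩))

omit hF

variable (F) in
/-- The partial sum of the components of `F` of degree at most `N`. -/
def partialSum (N : ℤ) : U (nMinus 𝒢) ⊗[ℂ] U (nPlus 𝒢) :=
  ∑ n ∈ Finset.Icc 0 N, piece 𝒢 F (-n, n)

include hF

theorem evalFst_partialSum {N k : ℤ} (hk : k ≤ N) {y : U (nPlus 𝒢)} (hy : y ∈ UPlus 𝒢 k) :
    evalFst 𝒢 χ lam y (partialSum 𝒢 F N) = y := by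
  by_cases h0 : k < 0
  · rw [UPlus_eq_bot 𝒢 h0, Submodule.mem_bot] at hy
    simp [hy, evalFst]
  rw [partialSum, map_sum, Finset.sum_eq_single k]
  · exact evalFst_piece_self 𝒢 hF hy
  · intro n _ hn
    exact evalFst_piece 𝒢 _ hy (by simp only; omega)
  · intro h
    exact absurd (Finset.mem_Icc.2 ⟨not_lt.1 h0, hk⟩) h

theorem evalSnd_partialSum {N k : ℤ} (hk : -N ≤ k) {x : U (nMinus 𝒢)} (hx : x ∈ UMinus 𝒢 k) :
    evalSnd 𝒢 χ lam x (partialSum 𝒢 F N) = x := by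
  by_cases h0 : 0 < k
  · rw [UMinus_eq_bot 𝒢 h0, Submodule.mem_bot] at hx
    simp [hx, evalSnd]
  obtain ⟨m, rfl⟩ : ∃ m, k = -m := ⟨-k, (neg_neg k).symm⟩
  rw [partialSum, map_sum, Finset.sum_eq_single m]
  · exact evalSnd_piece_self 𝒢 hF hx
  · intro n _ hn
    exact evalSnd_piece 𝒢 _ hx (by simp only; omega)
  · intro h
    exact absurd (Finset.mem_Icc.2 ⟨by omega, by omega⟩) h

theorem contractBoth_left {N k l : ℤ} (hk : k ≤ N) (hl : -N ≤ l) {y : U (nPlus 𝒢)}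
    (hy : y ∈ UPlus 𝒢 k) {x : U (nMinus 𝒢)} (hx : x ∈ UMinus 𝒢 l) :
    contractBoth 𝒢 χ lam y x
      (comulOne 𝒢 (partialSum 𝒢 F N) * tensorOne 𝒢 (partialSum 𝒢 F N)) =
        equivMap 𝒢 χ lam y x := by
  rw [contractBoth_comulOne, evalSnd_partialSum 𝒢 hF hl hx]
  -- Elements of `𝔫₋` lower degrees, so the part of degree at most `N` is stable, and the truncated
  -- sum reproduces it.
  refine contractFst_comul 𝒢 χ lam (Y := ⨆ k : Set.Iic N, UPlus 𝒢 k) (fun a y hy => ?_)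
    (fun y hy => ?_) (Submodule.mem_iSup_of_mem (p := fun k : Set.Iic N => UPlus 𝒢 k) ⟨k, hk⟩ hy) x
  · induction hy using Submodule.iSup_induction' with
    | zero => rw [map_zero]; exact Submodule.zero_mem _
    | add u v _ _ hu hv => rw [map_add]; exact Submodule.add_mem _ hu hv
    | mem k u hu =>
      refine gradedPart_induction 𝒢 (S := negDeg) (P := fun a =>
        actPlus 𝒢 χ lam (ι ℂ a) u ∈ ⨆ k : Set.Iic N, UPlus 𝒢 k) (fun i hi a ha => ?_)
        (by simp) (fun a b ha hb => by
          rw [map_add, map_add]; exact Submodule.add_mem _ ha hb) a.2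
      have hi' : i < 0 := hi
      have hk' : (k : ℤ) ≤ N := k.2
      exact Submodule.mem_iSup_of_mem (p := fun k : Set.Iic N => UPlus 𝒢 k)
        ⟨i + k, show i + k ≤ N by omega⟩
        (actPlus_mem_uDeg 𝒢 χ lam rfl (ι_mem_uDeg 𝒢 ⟨a, ha⟩) hu)
  · induction hy using Submodule.iSup_induction' with
    | zero => simp [evalFst]
    | add u v _ _ hu hv =>
      have h : evalFst 𝒢 χ lam (u + v) (partialSum 𝒢 F N) =
          evalFst 𝒢 χ lam u (partialSum 𝒢 F N) + evalFst 𝒢 χ lam v (partialSum 𝒢 F N) := by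
        simp [evalFst, TensorProduct.map_add_left]
      rw [h, hu, hv]
    | mem k u hu => exact evalFst_partialSum 𝒢 hF k.2 hu

theorem contractBoth_right {N k l : ℤ} (hk : k ≤ N) (hl : -N ≤ l) {y : U (nPlus 𝒢)}
    (hy : y ∈ UPlus 𝒢 k) {x : U (nMinus 𝒢)} (hx : x ∈ UMinus 𝒢 l) :
    contractBoth 𝒢 χ lam y x
      (oneComul 𝒢 (partialSum 𝒢 F N) * oneTensor 𝒢 (partialSum 𝒢 F N)) =
        equivMap 𝒢 χ lam y x := by
  rw [contractBoth_oneComul, evalFst_partialSum 𝒢 hF hk hy]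
  -- Elements of `𝔫₊` raise degrees, so the part of degree at least `-N` is stable.
  refine contractSnd_comul 𝒢 χ lam (X := ⨆ k : Set.Ici (-N), UMinus 𝒢 k) (fun a y hy => ?_)
    (fun y hy => ?_)
    (Submodule.mem_iSup_of_mem (p := fun k : Set.Ici (-N) => UMinus 𝒢 k) ⟨l, hl⟩ hx) y
  · induction hy using Submodule.iSup_induction' with
    | zero => rw [map_zero]; exact Submodule.zero_mem _
    | add u v _ _ hu hv => rw [map_add]; exact Submodule.add_mem _ hu hv
    | mem k u hu =>
      refine gradedPart_induction 𝒢 (S := posDeg) (P := fun a =>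
        actMinus 𝒢 χ lam (ι ℂ a) u ∈ ⨆ k : Set.Ici (-N), UMinus 𝒢 k) (fun i hi a ha => ?_)
        (by simp) (fun a b ha hb => by
          rw [map_add, map_add]; exact Submodule.add_mem _ ha hb) a.2
      have hi' : 0 < i := hi
      have hk' : -N ≤ (k : ℤ) := k.2
      exact Submodule.mem_iSup_of_mem (p := fun k : Set.Ici (-N) => UMinus 𝒢 k)
        ⟨i + k, show -N ≤ i + k by omega⟩
        (actMinus_mem_uDeg 𝒢 χ lam rfl (ι_mem_uDeg 𝒢 ⟨a, ha⟩) hu)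
  · induction hy using Submodule.iSup_induction' with
    | zero => simp [evalSnd]
    | add u v _ _ hu hv =>
      have h : evalSnd 𝒢 χ lam (u + v) (partialSum 𝒢 F N) =
          evalSnd 𝒢 χ lam u (partialSum 𝒢 F N) + evalSnd 𝒢 χ lam v (partialSum 𝒢 F N) := by
        simp [evalSnd, TensorProduct.map_add_right]
      rw [h, hu, hv]
    | mem k u hu => exact evalSnd_partialSum 𝒢 hF k.2 hu

omit hF

theorem uProj_of_mem {L : Type*} [LieRing L] [LieAlgebra ℂ L] (ℒ : ℤ → Submodule ℂ L)
    [GradedLieAlgebra ℒ] {k : ℤ} {u : U L} (hu : u ∈ uDeg ℒ k) : uProj ℒ k u = ⟨u, hu⟩ :=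
  Subtype.ext (DirectSum.decompose_of_mem_same (uDeg ℒ) hu)

theorem uProj_of_mem_ne {L : Type*} [LieRing L] [LieAlgebra ℂ L] (ℒ : ℤ → Submodule ℂ L)
    [GradedLieAlgebra ℒ] {k l : ℤ} (h : k ≠ l) {u : U L} (hu : u ∈ uDeg ℒ k) : uProj ℒ l u = 0 :=
  Subtype.ext (DirectSum.decompose_of_mem_ne (uDeg ℒ) hu h)

theorem shapovalov_uProj_left {n : ℤ} (a : U (nMinus 𝒢)) {y : U (nPlus 𝒢)} (hy : y ∈ UPlus 𝒢 n) :
    shapovalov 𝒢 χ lam (uProj (partGrading 𝒢 negDeg) (-n) a) y = shapovalov 𝒢 χ lam a y := by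
  induction a using DirectSum.Decomposition.inductionOn (uDeg (partGrading 𝒢 negDeg)) with
  | zero => simp
  | add a b ha hb => simp only [map_add, Submodule.coe_add, LinearMap.add_apply, ha, hb]
  | @homogeneous k a =>
    by_cases hk : k = -n
    · subst hk
      rw [uProj_of_mem _ a.2]
    · rw [uProj_of_mem_ne _ hk a.2, shapovalov_eq_zero 𝒢 χ lam (by omega) a.2 hy]
      simp

theorem shapovalov_uProj_right {n : ℤ} {x : U (nMinus 𝒢)} (hx : x ∈ UMinus 𝒢 (-n))
    (b : U (nPlus 𝒢)) :
    shapovalov 𝒢 χ lam x (uProj (partGrading 𝒢 posDeg) n b) = shapovalov 𝒢 χ lam x b := by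
  induction b using DirectSum.Decomposition.inductionOn (uDeg (partGrading 𝒢 posDeg)) with
  | zero => simp
  | add a b ha hb => simp only [map_add, Submodule.coe_add, ha, hb]
  | @homogeneous k a =>
    by_cases hk : k = n
    · subst hk
      rw [uProj_of_mem _ a.2]
    · rw [uProj_of_mem_ne _ hk a.2, shapovalov_eq_zero 𝒢 χ lam (by omega) hx a.2]
      simp

/-- The bidegree components of `1 ⊗ p ⊗ 1`, as linear maps. -/
def onePoneLin (i j : ℤ) : Triple 𝒢 →ₗ[ℂ] UMinus 𝒢 i ⊗[ℂ] (Quot₀ 𝒢 ⊗[ℂ] UPlus 𝒢 j) :=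
  TensorProduct.map (uProj (partGrading 𝒢 negDeg) i)
    (TensorProduct.map (pMap 𝒢) (uProj (partGrading 𝒢 posDeg) j))

/-- The homogeneous projections may be dropped, since components of non-opposite degrees pair to
zero. -/
theorem contract_onePoneLin {n m : ℤ} (y : UPlus 𝒢 n) (x : UMinus 𝒢 (-m)) (t : Triple 𝒢) :
    TensorProduct.rid ℂ (Quot₀ 𝒢) (TensorProduct.map LinearMap.id
      ((shapovalov 𝒢 χ lam).domRestrict₁₂ (UMinus 𝒢 (-m)) (UPlus 𝒢 m) x)
      (TensorProduct.lid ℂ _ (TensorProduct.map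
        (((shapovalov 𝒢 χ lam).domRestrict₁₂ (UMinus 𝒢 (-n)) (UPlus 𝒢 n)).flip y) LinearMap.id
        (onePoneLin 𝒢 (-n) m t)))) = contractBoth 𝒢 χ lam y x t := by
  induction t using TensorProduct.induction_on with
  | zero => simp
  | add s t hs ht => simp only [map_add, hs, ht]
  | tmul a s =>
    induction s using TensorProduct.induction_on with
    | zero => simp
    | add s t hs ht => simp only [TensorProduct.tmul_add, map_add, hs, ht]
    | tmul q b =>
      simp only [onePoneLin, TensorProduct.map_tmul, TensorProduct.lid_tmul, LinearMap.id_apply,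
        map_smul, TensorProduct.rid_tmul, contractBoth_tmul, contractSnd_tmul,
        LinearMap.flip_apply, LinearMap.domRestrict₁₂_apply]
      rw [shapovalov_uProj_left 𝒢 a y.2, shapovalov_uProj_right 𝒢 x.2 b]

include hF

theorem onePoneLin_left_eq_right {N i j : ℤ} (hi : -i ≤ N) (hj : j ≤ N) :
    onePoneLin 𝒢 i j (comulOne 𝒢 (partialSum 𝒢 F N) * tensorOne 𝒢 (partialSum 𝒢 F N)) =
      onePoneLin 𝒢 i j (oneComul 𝒢 (partialSum 𝒢 F N) * oneTensor 𝒢 (partialSum 𝒢 F N)) := by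
  obtain ⟨n, rfl⟩ : ∃ n, i = -n := ⟨-i, (neg_neg i).symm⟩
  rw [← sub_eq_zero, ← map_sub]
  refine eq_zero_of_contractions_left (hF.1 n) fun y => ?_
  refine eq_zero_of_contractions_right (hF.1 j) fun x => ?_
  rw [contract_onePoneLin, map_sub,
    contractBoth_left 𝒢 hF (by omega) (neg_le_neg hj) y.2 x.2,
    contractBoth_right 𝒢 hF (by omega) (neg_le_neg hj) y.2 x.2, sub_self]

theorem piece_eq_zero {d : ℤ × ℤ} (h : ¬ (d.1 = -d.2 ∧ 0 ≤ d.2)) : piece 𝒢 F d = 0 := by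
  rw [piece]
  by_cases h1 : d.1 = -d.2
  · have h2 : UPlus 𝒢 d.2 = ⊥ := UPlus_eq_bot 𝒢 (by by_contra h3; exact h ⟨h1, not_lt.1 h3⟩)
    have : Subsingleton (UPlus 𝒢 d.2) := by rw [h2]; infer_instance
    rw [Subsingleton.elim (F d.1 d.2) 0, map_zero]
  · rw [hF.2 _ _ h1, map_zero]

omit hF

/-- Left multiplication in `U 𝔫₋` cannot raise degrees. -/
theorem uProj_mul_eq_zero_left {i k : ℤ} (hk : k < i) (u : U (nMinus 𝒢)) {f : U (nMinus 𝒢)}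
    (hf : f ∈ UMinus 𝒢 k) : uProj (partGrading 𝒢 negDeg) i (u * f) = 0 := by
  induction u using DirectSum.Decomposition.inductionOn (uDeg (partGrading 𝒢 negDeg)) with
  | zero => simp
  | add a b ha hb => rw [add_mul, map_add, ha, hb, add_zero]
  | @homogeneous l a =>
    by_cases hl : 0 < l
    · have h : (a : U (nMinus 𝒢)) ∈ (⊥ : Submodule ℂ (U (nMinus 𝒢))) := UMinus_eq_bot 𝒢 hl ▸ a.2
      rw [(Submodule.mem_bot ℂ).1 h, zero_mul, map_zero]
    · exact uProj_of_mem_ne _ (by omega) (mul_mem_uDeg _ rfl a.2 hf)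

theorem uProj_mul_eq_zero_right {j k : ℤ} (hk : j < k) (u : U (nPlus 𝒢)) {f : U (nPlus 𝒢)}
    (hf : f ∈ UPlus 𝒢 k) : uProj (partGrading 𝒢 posDeg) j (u * f) = 0 := by
  induction u using DirectSum.Decomposition.inductionOn (uDeg (partGrading 𝒢 posDeg)) with
  | zero => simp
  | add a b ha hb => rw [add_mul, map_add, ha, hb, add_zero]
  | @homogeneous l a =>
    by_cases hl : l < 0
    · have h : (a : U (nPlus 𝒢)) ∈ (⊥ : Submodule ℂ (U (nPlus 𝒢))) := UPlus_eq_bot 𝒢 hl ▸ a.2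
      rw [(Submodule.mem_bot ℂ).1 h, zero_mul, map_zero]
    · exact uProj_of_mem_ne _ (by omega) (mul_mem_uDeg _ rfl a.2 hf)

/-- A bilinear expression in two components vanishes if it vanishes on simple tensors. -/
theorem piece_bilinear_eq_zero {M : Type*} [AddCommGroup M] [Module ℂ M] {R : Type*} [Ring R]
    [Algebra ℂ R] (Λ : R →ₗ[ℂ] M) (f g : U (nMinus 𝒢) ⊗[ℂ] U (nPlus 𝒢) →ₐ[ℂ] R) (d e : ℤ × ℤ)
    (h : ∀ a ∈ UMinus 𝒢 d.1, ∀ b ∈ UPlus 𝒢 d.2, ∀ a' ∈ UMinus 𝒢 e.1, ∀ b' ∈ UPlus 𝒢 e.2,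
      Λ (f (a ⊗ₜ b) * g (a' ⊗ₜ b')) = 0) :
    Λ (f (piece 𝒢 F d) * g (piece 𝒢 F e)) = 0 := by
  rw [piece, piece]
  induction F d.1 d.2 using TensorProduct.induction_on with
  | zero => simp
  | add s t hs ht => rw [map_add, map_add, add_mul, map_add, hs, ht, add_zero]
  | tmul a b =>
    induction F e.1 e.2 using TensorProduct.induction_on with
    | zero => simp
    | add s t hs ht => rw [map_add, map_add, mul_add, map_add, hs, ht, add_zero]
    | tmul a' b' => exact h a a.2 b b.2 a' a'.2 b' b'.2

/-- The third leg has degree exactly `d.2`, and the first has degree at most `e.1`, since the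
remaining factor from `U 𝔫₋` contributes a nonpositive degree. This bounds both summation indices.
-/
theorem onePoneLin_comulOne_eq_zero {d e : ℤ × ℤ} {i j : ℤ} (h : j ≠ d.2 ∨ e.1 < i) :
    onePoneLin 𝒢 i j (comulOne 𝒢 (piece 𝒢 F d) * tensorOne 𝒢 (piece 𝒢 F e)) = 0 := by
  refine piece_bilinear_eq_zero 𝒢 _ _ _ d e fun a _ b hb a' ha' b' _ => ?_
  simp only [comulOne, AlgHom.comp_apply, Algebra.TensorProduct.map_tmul, AlgHom.id_apply]
  induction comul (nMinus 𝒢) a using TensorProduct.induction_on with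
  | zero => simp
  | add s t hs ht =>
    simp only [TensorProduct.add_tmul, map_add, add_mul] at hs ht ⊢
    rw [hs, ht, add_zero]
  | tmul u v =>
    have e1 : onePoneLin 𝒢 i j ((u * a') ⊗ₜ[ℂ] ((incl _ v * incl _ b') ⊗ₜ[ℂ] b)) = 0 := by
      rw [onePoneLin, TensorProduct.map_tmul, TensorProduct.map_tmul]
      rcases h with h | h
      · rw [uProj_of_mem_ne _ (Ne.symm h) hb, TensorProduct.tmul_zero, TensorProduct.tmul_zero]
      · rw [uProj_mul_eq_zero_left 𝒢 h u ha', TensorProduct.zero_tmul]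
    simpa [tensorOne] using e1

theorem onePoneLin_oneComul_eq_zero {d e : ℤ × ℤ} {i j : ℤ} (h : i ≠ d.1 ∨ j < e.2) :
    onePoneLin 𝒢 i j (oneComul 𝒢 (piece 𝒢 F d) * oneTensor 𝒢 (piece 𝒢 F e)) = 0 := by
  refine piece_bilinear_eq_zero 𝒢 _ _ _ d e fun a ha b _ a' _ b' hb' => ?_
  simp only [oneComul, AlgHom.comp_apply, Algebra.TensorProduct.map_tmul, AlgHom.id_apply]
  induction comul (nPlus 𝒢) b using TensorProduct.induction_on with
  | zero => simp
  | add s t hs ht =>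
    simp only [TensorProduct.tmul_add, map_add, add_mul] at hs ht ⊢
    rw [hs, ht, add_zero]
  | tmul u v =>
    have e1 : onePoneLin 𝒢 i j (a ⊗ₜ[ℂ] ((incl _ u * incl _ a') ⊗ₜ[ℂ] (v * b'))) = 0 := by
      rw [onePoneLin, TensorProduct.map_tmul, TensorProduct.map_tmul]
      rcases h with h | h
      · rw [uProj_of_mem_ne _ (Ne.symm h) ha, TensorProduct.zero_tmul]
      · rw [uProj_mul_eq_zero_right 𝒢 h v hb', TensorProduct.tmul_zero, TensorProduct.tmul_zero]
    simpa [oneTensor] using e1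

include hF

/-- A bilinear expression in the components of `F`, all of whose nonzero terms have bounded degree,
is computed by a partial sum. -/
theorem finsum_piece {M : Type*} [AddCommGroup M] [Module ℂ M] {R : Type*} [Ring R] [Algebra ℂ R]
    (Λ : R →ₗ[ℂ] M) (f g : U (nMinus 𝒢) ⊗[ℂ] U (nPlus 𝒢) →ₐ[ℂ] R) (N : ℤ)
    (h : ∀ n m : ℤ, 0 ≤ n → 0 ≤ m → (N < n ∨ N < m) →
      Λ (f (piece 𝒢 F (-n, n)) * g (piece 𝒢 F (-m, m))) = 0) :
    (Function.support fun d : (ℤ × ℤ) × (ℤ × ℤ) =>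
        Λ (f (piece 𝒢 F d.1) * g (piece 𝒢 F d.2))).Finite ∧
      ∑ᶠ d : (ℤ × ℤ) × (ℤ × ℤ), Λ (f (piece 𝒢 F d.1) * g (piece 𝒢 F d.2)) =
        Λ (f (partialSum 𝒢 F N) * g (partialSum 𝒢 F N)) := by
  -- Lists the pairs of antidiagonal bidegrees, the only ones in which `F` has nonzero components.
  let e : ℤ × ℤ → (ℤ × ℤ) × (ℤ × ℤ) := fun p => ((-p.1, p.1), (-p.2, p.2))
  have he : Function.Injective e := by
    rintro ⟨a, b⟩ ⟨c, d⟩ h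
    simp only [e, Prod.mk.injEq] at h
    exact Prod.ext h.1.2 h.2.2
  let s : Finset ((ℤ × ℤ) × (ℤ × ℤ)) := (Finset.Icc 0 N ×ˢ Finset.Icc 0 N).map ⟨e, he⟩
  have hsub : (Function.support fun d : (ℤ × ℤ) × (ℤ × ℤ) =>
      Λ (f (piece 𝒢 F d.1) * g (piece 𝒢 F d.2))) ⊆ s := by
    rintro ⟨⟨a, n⟩, ⟨b, m⟩⟩ hd
    rw [Function.mem_support] at hd
    have h1 : a = -n ∧ 0 ≤ n := by
      by_contra hc
      rw [piece_eq_zero 𝒢 hF (d := (a, n)) hc, map_zero, zero_mul, map_zero] at hd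
      exact hd rfl
    have h2 : b = -m ∧ 0 ≤ m := by
      by_contra hc
      rw [piece_eq_zero 𝒢 hF (d := (b, m)) hc, map_zero, mul_zero, map_zero] at hd
      exact hd rfl
    obtain ⟨rfl, hn⟩ := h1
    obtain ⟨rfl, hm⟩ := h2
    have h3 : n ≤ N ∧ m ≤ N := by
      by_contra hc
      exact hd (h n m hn hm (by omega))
    refine Finset.mem_coe.2 (Finset.mem_map.2 ⟨(n, m), ?_, rfl⟩)
    rw [Finset.mem_product, Finset.mem_Icc, Finset.mem_Icc]
    exact ⟨⟨hn, h3.1⟩, ⟨hm, h3.2⟩⟩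
  refine ⟨s.finite_toSet.subset hsub, ?_⟩
  rw [finsum_eq_sum_of_support_subset _ hsub, Finset.sum_map, Finset.sum_product]
  simp only [partialSum, map_sum, Finset.sum_mul_sum]
  rfl

theorem exists_left_right :
    ∃ T : Completed₃ 𝒢, IsLeftSide 𝒢 F T ∧ IsRightSide 𝒢 F T := by
  -- In bidegree `(i, j)` the left side involves only `n = j` and `m ≤ -i`, the right side only `n =
  -- -i` and `m ≤ j`. The bound `max (-i) j` serves both.
  refine ⟨fun i j => onePoneLin 𝒢 i j (comulOne 𝒢 (partialSum 𝒢 F (max (-i) j)) *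
    tensorOne 𝒢 (partialSum 𝒢 F (max (-i) j))), fun i j => ?_, fun i j => ?_⟩
  · refine finsum_piece 𝒢 hF (onePoneLin 𝒢 i j) (comulOne 𝒢) (tensorOne 𝒢) (max (-i) j)
      fun n m _ _ hnm => onePoneLin_comulOne_eq_zero 𝒢 ?_
    have h1 := le_max_left (-i) j
    have h2 := le_max_right (-i) j
    simp only
    omega
  · have heq := onePoneLin_left_eq_right 𝒢 hF (le_max_left (-i) j) (le_max_right (-i) j)
    have key := finsum_piece 𝒢 hF (onePoneLin 𝒢 i j) (oneComul 𝒢) (oneTensor 𝒢) (max (-i) j)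
      fun n m _ _ hnm => onePoneLin_oneComul_eq_zero 𝒢 (by
        have h1 := le_max_left (-i) j
        have h2 := le_max_right (-i) j
        simp only
        omega)
    rw [← heq] at key
    exact key

end Cocycle

/-! ### Existence and uniqueness of the canonical element -/

section Existence

variable {𝔤 : Type*} [LieRing 𝔤] [LieAlgebra ℂ 𝔤] (𝒢 : ℤ → Submodule ℂ 𝔤) [GradedLieAlgebra 𝒢]
  {χ : LieAlgebra.LieCharacter ℂ (gZero 𝒢)} {lam : ℂ}

/-- Other degrees of `U 𝔫₊` pair to zero with degree `-n` anyway, so an element in the kernel of the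
restriction is in the kernel of the whole form. -/
theorem shapovalov_restrict_injective (hirr : IsSimpleModule (U 𝔤) (VermaPlus 𝒢 χ lam)) (n : ℤ) :
    Function.Injective
      ((shapovalov 𝒢 χ lam).domRestrict₁₂ (UMinus 𝒢 (-n)) (UPlus 𝒢 n)) := by
  rw [← LinearMap.ker_eq_bot, LinearMap.ker_eq_bot']
  intro x hx
  refine Subtype.ext (eq_zero_of_shapovalov_eq_zero 𝒢 χ lam hirr fun y => ?_)
  rw [← shapovalov_uProj_right 𝒢 x.2 y]
  exact LinearMap.congr_fun hx (uProj (partGrading 𝒢 posDeg) n y)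

theorem existsUnique_isCanonicalElement [∀ i, FiniteDimensional ℂ (𝒢 i)]
    (hχ : IsNonsingular 𝒢 χ) (hirr : IsSimpleModule (U 𝔤) (VermaPlus 𝒢 χ lam)) :
    ∃! F : Completed₂ 𝒢, IsCanonicalElement 𝒢 χ lam F := by
  have hex : ∀ n : ℤ, ∃ t, IsCanonicalTensor
      ((shapovalov 𝒢 χ lam).domRestrict₁₂ (UMinus 𝒢 (-n)) (UPlus 𝒢 n)) t := by
    intro n
    obtain ⟨h1, h2, h3⟩ := finiteDimensional_and_finrank_le 𝒢 hχ n
    exact exists_isCanonicalTensor _ (shapovalov_restrict_injective 𝒢 hirr n) h3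
  choose t ht using hex
  refine ⟨fun i j => if h : i = -j then h ▸ t j else 0, ⟨fun n => ?_, fun i j h => ?_⟩,
    fun F hF => ?_⟩
  · simpa using ht n
  · simp only
    rw [dif_neg h]
  · funext i j
    by_cases h : i = -j
    · subst h
      simp only [dite_true]
      exact isCanonicalTensor_unique (hF.1 j) (ht j)
    · rw [dif_neg h, hF.2 i j h]

end Existence

end ShapovalovAssoc

end

theorem mainTheorem2 {𝔤 : Type*} [LieRing 𝔤] [LieAlgebra ℂ 𝔤]
    (𝒢 : ℤ → Submodule ℂ 𝔤) [GradedLieAlgebra 𝒢]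
    (hfin : ∀ i : ℤ, FiniteDimensional ℂ (𝒢 i))
    (χ : LieAlgebra.LieCharacter ℂ (ShapovalovAssoc.gZero 𝒢))
    (hχ : ShapovalovAssoc.IsNonsingular 𝒢 χ)
    (lam : ℂ)
    (hirr : IsSimpleModule (ShapovalovAssoc.U 𝔤) (ShapovalovAssoc.VermaPlus 𝒢 χ lam)) :
    (∃! F : ShapovalovAssoc.Completed₂ 𝒢, ShapovalovAssoc.IsCanonicalElement 𝒢 χ lam F) ∧
    ∀ F : ShapovalovAssoc.Completed₂ 𝒢, ShapovalovAssoc.IsCanonicalElement 𝒢 χ lam F →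
      ∃ T : ShapovalovAssoc.Completed₃ 𝒢,
        ShapovalovAssoc.IsLeftSide 𝒢 F T ∧ ShapovalovAssoc.IsRightSide 𝒢 F T := by
  have := hfin
  exact ⟨ShapovalovAssoc.existsUnique_isCanonicalElement 𝒢 hχ hirr,
    fun _ hF => ShapovalovAssoc.exists_left_right 𝒢 hF⟩
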